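/- Let $\phi=\frac{1+\sqrt5}{2}$ and let $\sigma$ be the Fibonacci substitution $\sigma(a)=ab$, $\sigma(b)=a$ on $\{a,b\}$. Let $N:\{0,1,2,\dots\}\to\{0,1,2,\dots\}$ be strictly increasing and $\Delta(n)=N(n)-N(n-1)$ for $n\ge 1$. Let $e$ be an additional letter and define words $S_n(x)$, $x\in\{a,b,e\}$, over $\{a,b,e\}$ by $S_0(x)=x$ and $S_n(x)=S_{n-1}(\tilde\sigma^{(n)}(x))$ for $n\ge1$ (where $S_{n-1}$ of a word is the concatenation of the $S_{n-1}$ of its letters). Here, for $x\in\{a,b\}$, $\tilde\sigma^{(n)}(x)=\sigma^{\Delta(n)}(x)$ if $n$ is odd, and, if $n$ is even, $\tilde\sigma^{(n)}(x)$ is $\sigma^{\Delta(n)}(x)$ with its last letter $b$ (if there is one) replaced by $e$; and $\tilde\sigma^{(n)}(e)$ is the word $\sigma^{\Delta(n)}(b)$ rearranged so that all $a$'s precede all $b$'s. Let $X_S$ be the set of bi-infinite sequences all of whose finite factors are subwords of some $S_n(x)$; these are sequences over $\{a,b\}$. Let $\Omega_S$ be the space of tilings of $\mathbb R$ (the scrambled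 Fibonacci tilings with tile lengths $\phi$ and $1$) obtained from the sequences in $X_S$ by replacing each letter $a$ by an interval of length $\phi$ and each letter $b$ by an interval of length $1$, with arbitrary position of the origin. A tiling is identified with the set of end points of its tiles, and spaces of tilings carry the usual tiling topology (two tilings are close if they agree on a large ball around $0$ up to small translations). A real number $\beta$ is a topological eigenvalue of a translation invariant space $\Omega$ if there is a continuous $f:\Omega\to\mathbb C$, not identically zero, with $f(\omega-t)=e^{2\pi i\beta t}f(\omega)$ for all $\omega\in\Omega$, $t\in\mathbb R$; it is a topological eigenvalue of a tiling if it is one of its hull, the closure of the set of its translates. A set $\Lambda\subset\mathbb R$ is a Meyer set if it is relatively dense and harmonious, i.e. for every group homomorphism $\chi$ from the group generated by $\Lambda$ to the unit circle and every $\epsilon>0$ there is $\beta\in\mathbb R$ with $|\chi(x)-e^{2\pi i\beta x}|<\epsilon$ for all $x\in\Lambda$; a tiling is a Meyer tiling if it is mutually locally derivable with a Meyer set. A set $\Lambda$ is pure point diffractive if its autocorrelation measure $\gamma=\lim_{R\to\infty}\frac1{2R}\sum_{x,y\in\Lambda\cap[-R,R]}\delta_{x-y}$ (vague limit) exists and its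 Fourier transform $\hat\gamma$ is a pure point measure. **Theorem.** Suppose that $\Delta(\kappa)\ge N(\kappa-1)$ for all odd $\kappa$ and that $\sum_{\kappa\text{ odd}}\phi^{-\Delta(\kappa+1)}<\infty$. Then $\Omega_S$ is non-empty and its only topological eigenvalue is $0$. Moreover, for every scrambled Fibonacci tiling $T\in\Omega_S$, the only topological eigenvalue of $T$ is $0$, and $T$ is a repetitive Delone set of finite local complexity which is pure point diffractive, but it is neither a Meyer set nor a Meyer tiling. In particular (a negative answer to Lagarias' Problem 4.10), there is a repetitive Delone set in $\mathbb R$ of finite local complexity which is pure point diffractive but not a Meyer set. -/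

import Mathlib

open MeasureTheory Filter Topology
open scoped FourierTransform

namespace ScrambledFibonacci

/-! ## Point sets on the line: patches, the tiling topology, hulls, eigenvalues -/

/-- The patch `(Λ - x) ∩ B_R(0)`. -/
def patch (Λ : Set ℝ) (x R : ℝ) : Set ℝ := {v | |v| ≤ R ∧ x + v ∈ Λ}

/-- `Λ - t`. -/
def translate (Λ : Set ℝ) (t : ℝ) : Set ℝ := {x | x + t ∈ Λ}

/-- `Λ` and `Λ'` agree on the ball of radius `1/ε` up to translating each by less than `ε`. -/
def Near (ε : ℝ) (Λ Λ' : Set ℝ) : Prop :=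
  ∃ s t : ℝ, |s| < ε ∧ |t| < ε ∧ patch Λ s (1 / ε) = patch Λ' t (1 / ε)

theorem Near.refl {ε : ℝ} (hε : 0 < ε) (Λ : Set ℝ) : Near ε Λ Λ :=
  ⟨0, 0, by simpa using hε, by simpa using hε, rfl⟩

theorem Near.symm {ε : ℝ} {Λ Λ' : Set ℝ} (h : Near ε Λ Λ') : Near ε Λ' Λ := by
  obtain ⟨s, t, hs, ht, h⟩ := h
  exact ⟨t, s, ht, hs, h.symm⟩

theorem Near.mono {δ ε : ℝ} (hδ : 0 < δ) (h : δ ≤ ε) {Λ Λ' : Set ℝ} (hn : Near δ Λ Λ') :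
    Near ε Λ Λ' := by
  obtain ⟨s, t, hs, ht, hp⟩ := hn
  refine ⟨s, t, hs.trans_le h, ht.trans_le h, ?_⟩
  have hle : 1 / ε ≤ 1 / δ := one_div_le_one_div_of_le hδ h
  ext v
  have hv := Set.ext_iff.mp hp v
  simp only [patch, Set.mem_ofPred_eq] at hv ⊢
  constructor
  · rintro ⟨h1, h2⟩
    exact ⟨h1, (hv.mp ⟨h1.trans hle, h2⟩).2⟩
  · rintro ⟨h1, h2⟩
    exact ⟨h1, (hv.mpr ⟨h1.trans hle, h2⟩).2⟩

theorem Near.comp {δ ε : ℝ} (hδ : 0 < δ) (hε : 0 < ε) (h2 : δ ≤ ε / 2) (h1 : δ ≤ 1 / ε)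
    {Λ M K : Set ℝ} (hn : Near δ Λ M) (hn' : Near δ M K) : Near ε Λ K := by
  obtain ⟨s, t, hs, ht, hp⟩ := hn
  obtain ⟨s', t', hs', ht', hp'⟩ := hn'
  have hle : 1 / ε + δ ≤ 1 / δ := by
    have h3 : 1 / (ε / 2) ≤ 1 / δ := one_div_le_one_div_of_le hδ h2
    have h4 : 1 / (ε / 2) = 1 / ε + 1 / ε := by field_simp; norm_num
    linarith
  refine ⟨s + s', t + t', ?_, ?_, ?_⟩
  · calc |s + s'| ≤ |s| + |s'| := abs_add_le _ _
      _ < ε := by linarith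
  · calc |t + t'| ≤ |t| + |t'| := abs_add_le _ _
      _ < ε := by linarith
  · ext v
    have e1 := Set.ext_iff.mp hp (v + s')
    have e2 := Set.ext_iff.mp hp' (v + t)
    simp only [patch, Set.mem_ofPred_eq] at e1 e2 ⊢
    refine and_congr_right fun hv => ?_
    have b1 : |v + s'| ≤ 1 / δ := (abs_add_le _ _).trans (by linarith)
    have b2 : |v + t| ≤ 1 / δ := (abs_add_le _ _).trans (by linarith)
    simp only [b1, b2, true_and] at e1 e2
    rw [show s + s' + v = s + (v + s') by ring, e1, show t + (v + s') = s' + (v + t) by ring, e2,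
      show t' + (v + t) = t + t' + v by ring]

/-- The uniform structure of the tiling metric on the subsets of the line: two sets are close
if, up to small translations, they agree on a large ball around the origin. -/
instance : UniformSpace (Set ℝ) :=
  UniformSpace.ofCore <| UniformSpace.Core.mkOfBasis
    { sets := {U | ∃ ε : ℝ, 0 < ε ∧ U = {p : Set ℝ × Set ℝ | Near ε p.1 p.2}}
      nonempty := ⟨_, 1, one_pos, rfl⟩
      inter_sets := by
        rintro _ _ ⟨ε, hε, rfl⟩ ⟨ε', hε', rfl⟩
        have hm : 0 < min ε ε' := lt_min hε hε'
        exact ⟨_, ⟨min ε ε', hm, rfl⟩, fun p hp =>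
          ⟨Near.mono hm (min_le_left _ _) hp, Near.mono hm (min_le_right _ _) hp⟩⟩ }
    (by
      rintro _ ⟨ε, hε, rfl⟩ Λ
      exact Near.refl hε Λ)
    (by
      rintro _ ⟨ε, hε, rfl⟩
      exact ⟨_, ⟨ε, hε, rfl⟩, fun p hp => Near.symm hp⟩)
    (by
      rintro _ ⟨ε, hε, rfl⟩
      have hm : 0 < min (ε / 2) (1 / ε) := lt_min (by positivity) (by positivity)
      refine ⟨_, ⟨_, hm, rfl⟩, ?_⟩
      rintro ⟨Λ, K⟩ ⟨M, h1, h2⟩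
      exact Near.comp hm hε (min_le_left _ _) (min_le_right _ _) h1 h2)

/-- The hull of `Λ`: the closure of the set of its translates. -/
def hull (Λ : Set ℝ) : Set (Set ℝ) := closure (Set.range (translate Λ))

/-- `β` is a topological eigenvalue of the translation action on `Ω`: the equation
`f (ω - t) = exp (2πiβt) f ω` has a continuous solution `f` on `Ω` that is not identically `0`. -/
def IsTopologicalEigenvalue (Ω : Set (Set ℝ)) (β : ℝ) : Prop :=
  ∃ f : Set ℝ → ℂ, ContinuousOn f Ω ∧ (∃ ω ∈ Ω, f ω ≠ 0) ∧
    ∀ ω ∈ Ω, ∀ t : ℝ,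
      f (translate ω t) = Complex.exp (2 * Real.pi * Complex.I * (β * t : ℝ)) * f ω

/-! ## Properties of point sets -/

def IsDelone (Λ : Set ℝ) : Prop := ∃ D : Delone.DeloneSet ℝ, (D : Set ℝ) = Λ

/-- Finite local complexity. -/
def HasFLC (Λ : Set ℝ) : Prop := ∀ R : ℝ, 0 < R → ((fun x => patch Λ x R) '' Λ).Finite

/-- Every patch of radius `R` recurs within a bounded distance of every point of the line. -/
def IsRepetitive (Λ : Set ℝ) : Prop :=
  ∀ R : ℝ, 0 < R → ∃ M : ℝ, ∀ x y : ℝ, ∃ z : ℝ, |z - y| ≤ M ∧ patch Λ z R = patch Λ x R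

def IsRelativelyDense (Λ : Set ℝ) : Prop := ∃ R : ℝ, ∀ x : ℝ, ∃ y ∈ Λ, |x - y| ≤ R

/-- Every character of the group generated by `Λ` (as a discrete group) is uniformly approximated
on `Λ` by continuous characters of the line. -/
def IsHarmonious (Λ : Set ℝ) : Prop :=
  ∀ χ : AddChar (AddSubgroup.closure Λ) Circle, ∀ ε : ℝ, 0 < ε → ∃ β : ℝ, ∀ a : ℝ, ∀ ha : a ∈ Λ,
    ‖(χ ⟨a, AddSubgroup.subset_closure ha⟩ : ℂ)
      - Complex.exp (2 * Real.pi * Complex.I * (β * a : ℝ))‖ < ε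

def IsMeyerSet (Λ : Set ℝ) : Prop := IsRelativelyDense Λ ∧ IsHarmonious Λ

/-- `Λ'` is locally derivable from `Λ`. -/
def IsLocallyDerivable (Λ' Λ : Set ℝ) : Prop :=
  ∃ R : ℝ, 0 < R ∧ ∀ x y : ℝ, patch Λ x R = patch Λ y R → (x ∈ Λ' ↔ y ∈ Λ')

/-- Mutual local derivability. -/
def MLD (Λ Λ' : Set ℝ) : Prop := IsLocallyDerivable Λ' Λ ∧ IsLocallyDerivable Λ Λ'

/-- A tiling, given by the set of boundary points of its tiles, is a Meyer tiling if it is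
mutually locally derivable with a Meyer set. -/
def IsMeyerTiling (T : Set ℝ) : Prop := ∃ Λ : Set ℝ, IsMeyerSet Λ ∧ MLD T Λ

/-- `γ` is the autocorrelation measure of `Λ`: the vague limit, as `R → ∞`, of
`(1 / 2R) ∑ δ_{x - y}`, the sum over `x, y ∈ Λ ∩ [-R, R]`. -/
def IsAutocorrelation (Λ : Set ℝ) (γ : Measure ℝ) : Prop :=
  IsLocallyFiniteMeasure γ ∧
    ∀ g : ℝ → ℝ, Continuous g → HasCompactSupport g →
      Tendsto (fun R : ℝ => (2 * R)⁻¹ *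
          ∑ᶠ p ∈ (Λ ∩ Set.Icc (-R) R) ×ˢ (Λ ∩ Set.Icc (-R) R), g (p.1 - p.2))
        atTop (𝓝 (∫ x, g x ∂γ))

/-- The positive measure `ν` is the Fourier transform of the measure `γ`, in the sense of
tempered distributions. -/
def IsFourierTransformOf (ν γ : Measure ℝ) : Prop :=
  ∀ f : SchwartzMap ℝ ℂ, Integrable (𝓕 (f : ℝ → ℂ)) γ ∧ Integrable f ν ∧
    ∫ x, 𝓕 (f : ℝ → ℂ) x ∂γ = ∫ k, f k ∂ν

def IsPurePointMeasure (ν : Measure ℝ) : Prop := ∃ C : Set ℝ, C.Countable ∧ ν Cᶜ = 0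

/-- `Λ` has an autocorrelation measure, and its Fourier transform is a pure point measure. -/
def IsPurePointDiffractive (Λ : Set ℝ) : Prop :=
  ∃ γ ν : Measure ℝ, IsAutocorrelation Λ γ ∧ IsFourierTransformOf ν γ ∧ IsPurePointMeasure ν

/-! ## Scrambled Fibonacci sequences -/

/-- The alphabet `{a, b}`. -/
inductive Letter
  | a
  | b
  deriving DecidableEq

/-- The alphabet `{a, b, e}`; `none` is the extra letter `e`. -/
abbrev ExtLetter := Option Letter

/-- The Fibonacci substitution. -/
def fib : Letter → List Letter
  | .a => [.a, .b]
  | .b => [.a]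

/-- The powers of the Fibonacci substitution. -/
def fibPow : ℕ → Letter → List Letter
  | 0, x => [x]
  | k + 1, x => (fibPow k x).flatMap fib

/-- Replace the last `b` of a word, if there is one, by `e`. -/
def replaceLastB : List Letter → List ExtLetter
  | [] => []
  | x :: w =>
    if Letter.b ∈ w then some x :: replaceLastB w
    else (if x = Letter.b then none else some x) :: w.map some

/-- Rearrange a word so that all its `a`s come before all its `b`s. -/
def rearrange (w : List Letter) : List Letter :=
  w.filter (· = Letter.a) ++ w.filter (· = Letter.b)

/-- `Δ(n) = N(n) - N(n - 1)`, for `n ≥ 1`. -/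
def Delta (N : ℕ → ℕ) (n : ℕ) : ℕ := N n - N (n - 1)

/-- The rule that composes superletters of order `n - 1` to superletters of order `n`. -/
def rule (N : ℕ → ℕ) (n : ℕ) : ExtLetter → List ExtLetter
  | some x =>
    if Odd n then (fibPow (Delta N n) x).map some else replaceLastB (fibPow (Delta N n) x)
  | none => (rearrange (fibPow (Delta N n) Letter.b)).map some

/-- The superletters `S_n(x)`. -/
def superletter (N : ℕ → ℕ) : ℕ → ExtLetter → List ExtLetter
  | 0, x => [x]
  | n + 1, x => (rule N (n + 1) x).flatMap (superletter N n)

/-- The space of scrambled Fibonacci sequences: all factors are subwords of superletters.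
(No superletter of order `≥ 1` contains `e`, so these are sequences over `{a, b}`.) -/
def sequenceSpace (N : ℕ → ℕ) : Set (ℤ → Letter) :=
  {ξ | ∀ (i : ℤ) (m : ℕ), ∃ (n : ℕ) (x : ExtLetter),
    List.ofFn (fun j : Fin m => some (ξ (i + (j : ℕ)))) <:+: superletter N n x}

/-! ## Scrambled Fibonacci tilings -/

def tileLength (L S : ℝ) : Letter → ℝ
  | .a => L
  | .b => S

/-- The left end point of the `k`-th tile if the `0`-th tile starts at `0`. -/
noncomputable def tilePosition (L S : ℝ) (ξ : ℤ → Letter) (k : ℤ) : ℝ :=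
  ∑ i ∈ Finset.Ico 0 k, tileLength L S (ξ i) - ∑ i ∈ Finset.Ico k 0, tileLength L S (ξ i)

/-- The set of boundary points of the tiles of the tiling obtained from `ξ` by suspending its
letters to intervals of lengths `L` and `S`, with the `0`-th tile starting at `t`. If `L ≠ S`, then
this set determines the tiling. -/
def tiling (L S : ℝ) (ξ : ℤ → Letter) (t : ℝ) : Set ℝ :=
  Set.range fun k : ℤ => t + tilePosition L S ξ k

/-- The space of scrambled Fibonacci tilings with tile lengths `L ≠ S`. -/
def tilingSpace (N : ℕ → ℕ) (L S : ℝ) : Set (Set ℝ) :=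
  {T | ∃ ξ ∈ sequenceSpace N, ∃ t : ℝ, T = tiling L S ξ t}

end ScrambledFibonacci

open ScrambledFibonacci

-- The superletter S_n(x) is φ^(N(n)-N(0)) times as long as the tile x. For even n, every factor of
-- a sequence in X_S is, up to its ends, a concatenation of words S_n(a) and S_n(b). Repetitivity
-- holds because S_{n+2}(a) contains all four concatenations of two such words.
--
-- No eigenvalues, not Meyer. For even n, S_{n+1}(e) is a run of copies of S_n(a) followed by a run
-- of copies of S_n(b), and it occurs in S_{n+2}(x) as soon as Δ(n+2) ≥ 2. Descending through the
-- levels, one may choose independently at each level which copy of the run to enter. So a patch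
-- recurs at positions that differ by the sums Σ ρ_m |S_{n_m}(x)|, where each ρ_m is any number
-- below the run length (`exists_occurrence`). If a character ψ of ℝ, continuous or not, is within
-- 1/4 of 1 on all return vectors of a patch, then products of such powers stay near 1, and the
-- series of (run length - 1) · |ψ(|S_{n_m}(x)|) - 1| converges (`sum_mul_norm_sub_one_le`). Because
-- Δ(n+1) ≥ N(n), the runs are, up to a constant, as long as the coefficients in F_{e+1} φ^e - F_e
-- φ^{e+1} = ±1 with e = N(n) - N(0). Since the terms of the series tend to 0, this forces ψ(1) = 1,
-- and likewise ψ(φ) = 1 (`char_eq_one`). For an eigenvalue β, continuity of the eigenfunction makes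
-- ψ(x) = exp(2πiβx) such a character, so β and βφ are integers and β = 0. For the Meyer property,
-- take a character χ with χ(1) = 1 and χ(φ) = -1. If exp(2πiβx) approximated χ on a harmonious set
-- derivable from T, the quotient would be such a ψ, so β and 1/2 - βφ would be integers, which is
-- absurd.
--
-- Pure point diffraction. The scrambling in an even step replaces one S_n(b) by S_n(e) in each new
-- superletter, a proportion of order φ^(-Δ). In an unscrambled word, translating by φ^j amounts to
-- moving a block σ^i(a) through the word, and σ^i(ab) and σ^i(ba) differ only in their last two
-- letters. Hence all subset sums of the φ^j, j in the r-th block of exponents, translate T onto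
-- itself up to a density ε_r, and Σ ε_r < ∞ (`mismatch_compose_le`). The autocorrelation γ exists
-- because pair counts are additive on words up to bounded errors. Convolved with exp(-|x|), it
-- becomes the Fourier transform of a finite measure ν (`exists_fourier_eq_smoothed`), and ∫ (1 - Re
-- exp(2πiks)) dν(k) is O(ε_r) for each such subset sum s. Averaging over the subsets of a block
-- produces the product of the (1 + exp(2πikφ^j))/2. Summability over r then gives, for ν-almost all
-- k, that kφ^j tends to the integers (`measure_compl_pisotFrequencies_eq_zero`). Only countably
-- many k have this property. Dividing ν by the Fourier transform of exp(-|x|) gives the diffraction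
-- measure.

namespace ScrambledFibonacci

/-! ## Words -/

/-- The length of the patch of tiles that a word describes. -/
noncomputable def len (w : List Letter) : ℝ := (w.map (tileLength Real.goldenRatio 1)).sum

@[simp] theorem len_nil : len [] = 0 := by simp [len]

@[simp] theorem len_cons (x : Letter) (w : List Letter) :
    len (x :: w) = tileLength Real.goldenRatio 1 x + len w := by simp [len]

@[simp] theorem len_append (u w : List Letter) : len (u ++ w) = len u + len w := by simp [len]

theorem one_le_tileLength (x : Letter) : 1 ≤ tileLength Real.goldenRatio 1 x := by
  cases x
  · exact Real.one_lt_goldenRatio.le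
  · exact le_rfl

theorem tileLength_le_two (x : Letter) : tileLength Real.goldenRatio 1 x ≤ 2 := by
  cases x
  · exact Real.goldenRatio_lt_two.le
  · exact one_le_two

theorem length_le_len (w : List Letter) : (w.length : ℝ) ≤ len w := by
  induction w with
  | nil => simp
  | cons x w ih => simp only [List.length_cons, len_cons]; push_cast; linarith [one_le_tileLength x]

theorem len_nonneg (w : List Letter) : 0 ≤ len w := (Nat.cast_nonneg _).trans (length_le_len w)

theorem len_le_two_mul_length (w : List Letter) : len w ≤ 2 * w.length := by
  induction w with
  | nil => simp
  | cons x w ih => simp only [List.length_cons, len_cons]; push_cast; linarith [tileLength_le_two x]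

theorem len_perm {u w : List Letter} (h : u.Perm w) : len u = len w := (h.map _).sum_eq

theorem len_eq_count (w : List Letter) :
    len w = w.count .a * Real.goldenRatio + w.count .b := by
  induction w with
  | nil => simp
  | cons x w ih => cases x <;> simp [ih, tileLength] <;> ring

theorem len_flatMap {α : Type*} (f : α → List Letter) (g : α → Letter) (c : ℝ)
    (h : ∀ x, len (f x) = c * tileLength Real.goldenRatio 1 (g x)) (w : List α) :
    len (w.flatMap f) = c * len (w.map g) := by
  induction w with
  | nil => simp
  | cons x w ih => simp [ih, h]; ring

/-! ### Powers of the Fibonacci substitution -/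

theorem fibPow_add (k l : ℕ) (x : Letter) :
    fibPow (k + l) x = (fibPow k x).flatMap (fibPow l) := by
  induction l with
  | zero => simp [fibPow]
  | succ l ih => simp [fibPow, ih, List.flatMap_assoc]

theorem fibPow_succ_a (k : ℕ) : fibPow (k + 1) .a = fibPow k .a ++ fibPow k .b := by
  rw [add_comm, fibPow_add]; simp [fibPow, fib]

theorem fibPow_succ_b (k : ℕ) : fibPow (k + 1) .b = fibPow k .a := by
  rw [add_comm, fibPow_add]; simp [fibPow, fib]

theorem count_fibPow (k : ℕ) :
    (fibPow k .a).count .a = (k + 1).fib ∧ (fibPow k .a).count .b = k.fib ∧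
    (fibPow (k + 1) .b).count .a = (k + 1).fib ∧ (fibPow (k + 1) .b).count .b = k.fib := by
  simp only [fibPow_succ_b]
  suffices ∀ k, (fibPow k .a).count .a = (k + 1).fib ∧ (fibPow k .a).count .b = k.fib from
    ⟨(this k).1, (this k).2, (this k).1, (this k).2⟩
  intro k
  induction k using Nat.strong_induction_on with
  | _ k ih =>
    match k with
    | 0 => decide
    | 1 => decide
    | k + 2 =>
      have h1 := ih (k + 1) (by omega)
      have h0 := ih k (by omega)
      rw [fibPow_succ_a, fibPow_succ_b, List.count_append, List.count_append, h1.1, h1.2, h0.1,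
        h0.2, Nat.fib_add_two (n := k + 1), Nat.fib_add_two (n := k)]
      constructor <;> omega

theorem len_fib (x : Letter) :
    len (fib x) = Real.goldenRatio * tileLength Real.goldenRatio 1 x := by
  cases x
  · have := Real.goldenRatio_sq
    simp only [fib, len_cons, len_nil, tileLength]; linarith
  · simp [fib, tileLength]

theorem len_fibPow (k : ℕ) (x : Letter) :
    len (fibPow k x) = Real.goldenRatio ^ k * tileLength Real.goldenRatio 1 x := by
  induction k with
  | zero => simp [fibPow]
  | succ k ih =>
    rw [fibPow, len_flatMap fib id _ len_fib, List.map_id, ih]; ring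

theorem a_mem_fibPow {k : ℕ} (hk : 1 ≤ k) (x : Letter) : Letter.a ∈ fibPow k x := by
  rw [← List.count_pos_iff]
  obtain ⟨k, rfl⟩ := Nat.exists_eq_add_of_le' hk
  cases x
  · rw [(count_fibPow _).1]; exact Nat.fib_pos.mpr (by omega)
  · rw [(count_fibPow _).2.2.1]; exact Nat.fib_pos.mpr (by omega)

theorem b_mem_fibPow {k : ℕ} (hk : 2 ≤ k) (x : Letter) : Letter.b ∈ fibPow k x := by
  rw [← List.count_pos_iff]
  obtain ⟨k, rfl⟩ := Nat.exists_eq_add_of_le' hk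
  cases x
  · rw [(count_fibPow _).2.1]; exact Nat.fib_pos.mpr (by omega)
  · rw [(count_fibPow (k + 1)).2.2.2]; exact Nat.fib_pos.mpr (by omega)

/-! ### Superletters as words over two letters -/

/-- The letter of the same length over `{a, b}`. -/
def toLetter (x : ExtLetter) : Letter := x.getD .b

@[simp] theorem toLetter_some (x : Letter) : toLetter (some x) = x := rfl
@[simp] theorem toLetter_none : toLetter none = .b := rfl

theorem toLetter_comp_some : toLetter ∘ some = id := rfl

/-- The superletters as words over `{a, b}`. -/
def word (N : ℕ → ℕ) : ℕ → ExtLetter → List Letter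
  | 0, x => [toLetter x]
  | n + 1, x => (rule N (n + 1) x).flatMap (word N n)

/-- The word over `{a, b}` that is composed to the superletters of a word. -/
def compose (N : ℕ → ℕ) (n : ℕ) (w : List Letter) : List Letter :=
  w.flatMap fun x => word N n (some x)

@[simp] theorem compose_nil (N : ℕ → ℕ) (n : ℕ) : compose N n [] = [] := rfl

@[simp] theorem compose_append (N : ℕ → ℕ) (n : ℕ) (u w : List Letter) :
    compose N n (u ++ w) = compose N n u ++ compose N n w := List.flatMap_append

@[simp] theorem compose_cons (N : ℕ → ℕ) (n : ℕ) (x : Letter) (w : List Letter) :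
    compose N n (x :: w) = word N n (some x) ++ compose N n w := List.flatMap_cons

theorem compose_infix (N : ℕ → ℕ) (n : ℕ) {u w : List Letter} (h : u <:+: w) :
    compose N n u <:+: compose N n w := by
  obtain ⟨s, t, rfl⟩ := h
  exact ⟨compose N n s, compose N n t, by simp⟩

theorem flatMap_map_some (N : ℕ → ℕ) (n : ℕ) (w : List Letter) :
    (w.map some).flatMap (word N n) = compose N n w := by
  simp [compose, List.flatMap_map]

theorem replaceLastB_of_notMem {w : List Letter} (h : Letter.b ∉ w) :
    replaceLastB w = w.map some := by
  cases w with
  | nil => rfl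
  | cons x w =>
    simp only [List.mem_cons, not_or] at h
    simp [replaceLastB, h.2, Ne.symm h.1]

theorem replaceLastB_of_mem {w : List Letter} (h : Letter.b ∈ w) :
    ∃ p q : List Letter, w = p ++ .b :: q ∧
      replaceLastB w = p.map some ++ none :: q.map some := by
  induction w with
  | nil => simp at h
  | cons x w ih =>
    by_cases hw : Letter.b ∈ w
    · obtain ⟨p, q, h1, h2⟩ := ih hw
      exact ⟨x :: p, q, by simp [h1], by rw [replaceLastB, if_pos hw, h2]; simp⟩
    · have hx : x = .b := by
        rcases List.mem_cons.mp h with h | h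
        · exact h.symm
        · exact absurd h hw
      exact ⟨[], w, by simp [hx], by simp [replaceLastB, hw, hx]⟩

theorem map_toLetter_replaceLastB (w : List Letter) : (replaceLastB w).map toLetter = w := by
  have hs : ∀ u : List Letter, (u.map some).map toLetter = u :=
    fun u => by simp [toLetter_comp_some]
  by_cases h : Letter.b ∈ w
  · obtain ⟨p, q, h1, h2⟩ := replaceLastB_of_mem h
    rw [h2, h1]; simp [toLetter_comp_some]
  · rw [replaceLastB_of_notMem h, hs]

theorem rearrange_perm (w : List Letter) : (rearrange w).Perm w := by
  have h : w.filter (· = Letter.b) = w.filter (fun x => ! decide (x = Letter.a)) := by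
    congr 1; funext x; cases x <;> rfl
  rw [rearrange, h]
  exact List.filter_append_perm _ w

theorem rearrange_eq (w : List Letter) :
    rearrange w = List.replicate (w.count .a) .a ++ List.replicate (w.count .b) .b := by
  have h : ∀ x : Letter, w.filter (· = x) = List.replicate (w.count x) x := fun x => by
    rw [← List.filter_beq]; rfl
  rw [rearrange, h, h]

theorem len_map_toLetter_rule (N : ℕ → ℕ) (n : ℕ) (x : ExtLetter) :
    len ((rule N n x).map toLetter) =
      Real.goldenRatio ^ Delta N n * tileLength Real.goldenRatio 1 (toLetter x) := by
  have hs : ∀ u : List Letter, (u.map some).map toLetter = u :=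
    fun u => by simp [toLetter_comp_some]
  cases x with
  | none => rw [rule, hs, len_perm (rearrange_perm _), len_fibPow]; rfl
  | some x =>
    rw [rule]
    split_ifs
    · rw [hs, len_fibPow]; rfl
    · rw [map_toLetter_replaceLastB, len_fibPow]; rfl

theorem sub_add_Delta {N : ℕ → ℕ} (hN : StrictMono N) (n : ℕ) :
    N (n + 1) - N 0 = (N n - N 0) + Delta N (n + 1) := by
  have h1 : N n ≤ N (n + 1) := hN.monotone (Nat.le_succ n)
  have h2 : N 0 ≤ N n := hN.monotone (Nat.zero_le n)
  simp only [Delta, Nat.add_sub_cancel]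
  omega

theorem len_word {N : ℕ → ℕ} (hN : StrictMono N) (n : ℕ) (x : ExtLetter) :
    len (word N n x) =
      Real.goldenRatio ^ (N n - N 0) * tileLength Real.goldenRatio 1 (toLetter x) := by
  induction n generalizing x with
  | zero => simp [word]
  | succ n ih =>
    rw [word, len_flatMap _ toLetter _ ih, len_map_toLetter_rule, sub_add_Delta hN, pow_add]
    ring

theorem len_compose {N : ℕ → ℕ} (hN : StrictMono N) (n : ℕ) (w : List Letter) :
    len (compose N n w) = Real.goldenRatio ^ (N n - N 0) * len w := by
  rw [compose, len_flatMap _ id _ (fun x => len_word hN n (some x)), List.map_id]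

theorem one_le_Delta {N : ℕ → ℕ} (hN : StrictMono N) {n : ℕ} (hn : 1 ≤ n) : 1 ≤ Delta N n := by
  have : N (n - 1) < N n := hN (by omega)
  simp only [Delta]; omega

/-- The first rule is of odd order and produces no e. All later superletters are composed of those
of order 1, so e never survives into a word. -/
theorem superletter_eq (N : ℕ → ℕ) (n : ℕ) (x : ExtLetter) (hx : n ≠ 0 ∨ x ≠ none) :
    superletter N n x = (word N n x).map some := by
  induction n generalizing x with
  | zero =>
    cases x with
    | none => simp at hx
    | some x => rfl
  | succ n ih =>
    rw [superletter, word, List.map_flatMap]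
    refine List.flatMap_congr fun y hy => ih y ?_
    rcases Nat.eq_zero_or_pos n with rfl | hn
    · right
      rintro rfl
      cases x <;> simp [rule] at hy
    · exact Or.inl hn.ne'

/-- The word that a superletter of order `n + 1` is composed of, if it does not contain `e`. -/
theorem word_succ_of_odd (N : ℕ → ℕ) {n : ℕ} (hn : Odd (n + 1)) (x : Letter) :
    word N (n + 1) (some x) = compose N n (fibPow (Delta N (n + 1)) x) := by
  rw [word, rule, if_pos hn, flatMap_map_some]

theorem word_succ_none (N : ℕ → ℕ) (n : ℕ) :
    word N (n + 1) none = compose N n (rearrange (fibPow (Delta N (n + 1)) .b)) := by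
  rw [word, rule, flatMap_map_some]

theorem word_succ_of_even (N : ℕ → ℕ) {n : ℕ} (hn : ¬ Odd (n + 1)) (x : Letter)
    (hb : Letter.b ∈ fibPow (Delta N (n + 1)) x) :
    ∃ p q, fibPow (Delta N (n + 1)) x = p ++ .b :: q ∧
      word N (n + 1) (some x) = compose N n p ++ (word N n none ++ compose N n q) := by
  obtain ⟨p, q, h1, h2⟩ := replaceLastB_of_mem hb
  refine ⟨p, q, h1, ?_⟩
  rw [word, rule, if_neg hn, h2, List.flatMap_append, List.flatMap_cons, flatMap_map_some,
    flatMap_map_some]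

theorem word_succ_of_even_of_notMem (N : ℕ → ℕ) {n : ℕ} (hn : ¬ Odd (n + 1)) (x : Letter)
    (hb : Letter.b ∉ fibPow (Delta N (n + 1)) x) :
    word N (n + 1) (some x) = compose N n (fibPow (Delta N (n + 1)) x) := by
  rw [word, rule, if_neg hn, replaceLastB_of_notMem hb, flatMap_map_some]

/-- The rule of the odd order n + 1 writes no e, so above an even level only S_n(a) and S_n(b) are
used. This is why even levels serve as the levels of decomposition throughout. -/
theorem exists_compose_eq_word (N : ℕ → ℕ) {n : ℕ} (hn : Even n) {M : ℕ} (hM : n + 1 ≤ M)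
    (x : ExtLetter) : ∃ w, word N M x = compose N n w := by
  induction M, hM using Nat.le_induction generalizing x with
  | base =>
    cases x with
    | none => exact ⟨_, word_succ_none N n⟩
    | some x => exact ⟨_, word_succ_of_odd N hn.add_one x⟩
  | succ M _ ih =>
    rw [word]
    generalize rule N (M + 1) x = r
    induction r with
    | nil => exact ⟨[], rfl⟩
    | cons y r ihr =>
      obtain ⟨w, hw⟩ := ih y
      obtain ⟨w', hw'⟩ := ihr
      exact ⟨w ++ w', by rw [List.flatMap_cons, hw, hw', compose_append]⟩

/-! ### Factors of composed words -/

theorem prefix_flatMap {α β : Type*} (f : α → List β) (B : ℕ) (hf : ∀ x, (f x).length ≤ B)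
    (w : List α) {u : List β} (h : u <+: w.flatMap f) :
    ∃ w' p, w' <+: w ∧ u = w'.flatMap f ++ p ∧ p.length ≤ B := by
  induction w generalizing u with
  | nil => exact ⟨[], [], List.prefix_rfl, by simpa using h, by simp⟩
  | cons x w ih =>
    rw [List.flatMap_cons] at h
    rcases List.prefix_or_prefix_of_prefix h (List.prefix_append _ _) with h | ⟨r, rfl⟩
    · exact ⟨[], u, List.nil_prefix, by simp, h.length_le.trans (hf x)⟩
    · obtain ⟨w', p, h1, h2, h3⟩ := ih ((List.prefix_append_right_inj _).mp h)
      exact ⟨x :: w', p, List.cons_prefix_cons.mpr ⟨rfl, h1⟩, by simp [h2], h3⟩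

/-- A factor of a composed word is a composed word up to two short words at its ends. -/
theorem infix_flatMap {α β : Type*} (f : α → List β) (B : ℕ) (hf : ∀ x, (f x).length ≤ B)
    (w : List α) {u : List β} (h : u <:+: w.flatMap f) :
    ∃ s w' p, w' <:+: w ∧ u = s ++ w'.flatMap f ++ p ∧ s.length ≤ B ∧ p.length ≤ B := by
  induction w with
  | nil =>
    exact ⟨[], [], [], List.infix_rfl, by simpa using h, by simp, by simp⟩
  | cons x w ih =>
    rw [List.flatMap_cons, List.infix_append_iff] at h
    rcases h with h | h | ⟨s, r, rfl, hs, hr⟩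
    · exact ⟨u, [], [], ⟨[], x :: w, rfl⟩, by simp, h.length_le.trans (hf x), by simp⟩
    · obtain ⟨s, w', p, h1, h2⟩ := ih h
      exact ⟨s, w', p, h1.trans (List.suffix_cons x w).isInfix, h2⟩
    · obtain ⟨w', p, h1, h2, h3⟩ := prefix_flatMap f B hf w hr
      exact ⟨s, w', p, h1.isInfix.trans (List.suffix_cons x w).isInfix,
        by simp [h2], hs.length_le.trans (hf x), h3⟩

/-! ## Factors of scrambled Fibonacci sequences -/

/-- The factor of length `m` that starts at position `i`. -/
def window (ξ : ℤ → Letter) (i : ℤ) (m : ℕ) : List Letter :=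
  List.ofFn fun j : Fin m => ξ (i + (j : ℕ))

@[simp] theorem length_window (ξ : ℤ → Letter) (i : ℤ) (m : ℕ) : (window ξ i m).length = m := by
  simp [window]

@[simp] theorem window_zero (ξ : ℤ → Letter) (i : ℤ) : window ξ i 0 = [] := by simp [window]

theorem window_succ (ξ : ℤ → Letter) (i : ℤ) (m : ℕ) :
    window ξ i (m + 1) = ξ i :: window ξ (i + 1) m := by
  simp only [window, List.ofFn_succ]
  simp [add_comm, add_left_comm]

theorem window_add (ξ : ℤ → Letter) (i : ℤ) (m k : ℕ) :
    window ξ i (m + k) = window ξ i m ++ window ξ (i + m) k := by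
  induction m generalizing i with
  | zero => simp
  | succ m ih =>
    rw [Nat.succ_add_eq_add_succ, ← Nat.succ_add_eq_add_succ, Nat.succ_eq_add_one,
      show m + 1 + k = m + k + 1 by omega, window_succ, ih, window_succ]
    push_cast
    rw [show i + 1 + (m : ℤ) = i + (m + 1) by ring]; rfl

theorem window_split {ξ : ℤ → Letter} {i : ℤ} {m : ℕ} {u v : List Letter}
    (h : window ξ i m = u ++ v) :
    window ξ i u.length = u ∧ window ξ (i + u.length) v.length = v := by
  have hm : m = u.length + v.length := by simpa using congrArg List.length h
  rw [hm, window_add] at h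
  exact List.append_inj h (by simp)

theorem window_middle {ξ : ℤ → Letter} {i : ℤ} {m : ℕ} {s u p : List Letter}
    (h : window ξ i m = s ++ u ++ p) : window ξ (i + s.length) u.length = u :=
  (window_split (window_split h).1).2

theorem window_infix (ξ : ℤ → Letter) (i : ℤ) (a m b : ℕ) :
    window ξ (i + a) m <:+: window ξ i (a + m + b) :=
  ⟨window ξ i a, window ξ (i + (a + m : ℕ)) b, by rw [window_add, window_add]⟩

theorem exists_window_of_infix {ξ : ℤ → Letter} {i : ℤ} {m : ℕ} {u : List Letter}
    (h : u <:+: window ξ i m) : ∃ k : ℕ, k + u.length ≤ m ∧ window ξ (i + k) u.length = u := by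
  obtain ⟨s, p, h⟩ := h
  refine ⟨s.length, ?_, window_middle h.symm⟩
  have := congrArg List.length h
  simp at this
  omega

/-- A bound for the lengths of the superletters of order `n`. -/
noncomputable def maxLength (N : ℕ → ℕ) (n : ℕ) : ℕ := ⌈2 * Real.goldenRatio ^ (N n - N 0)⌉₊

section

variable {N : ℕ → ℕ}

theorem length_word_le (hN : StrictMono N) (n : ℕ) (x : ExtLetter) :
    (word N n x).length ≤ maxLength N n := by
  have h1 := length_le_len (word N n x)
  rw [len_word hN] at h1
  have h2 := tileLength_le_two (toLetter x)
  have h3 : 0 < Real.goldenRatio ^ (N n - N 0) := pow_pos Real.goldenRatio_pos _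
  have : ((word N n x).length : ℝ) ≤ 2 * Real.goldenRatio ^ (N n - N 0) :=
    h1.trans (by nlinarith)
  exact_mod_cast this.trans (Nat.le_ceil _)

theorem pow_le_two_mul_length_word (hN : StrictMono N) (n : ℕ) (x : ExtLetter) :
    Real.goldenRatio ^ (N n - N 0) ≤ 2 * (word N n x).length := by
  have h1 := len_le_two_mul_length (word N n x)
  rw [len_word hN] at h1
  have h2 := one_le_tileLength (toLetter x)
  have h3 : 0 < Real.goldenRatio ^ (N n - N 0) := pow_pos Real.goldenRatio_pos _
  nlinarith

theorem le_sub_zero (hN : StrictMono N) (n : ℕ) : n ≤ N n - N 0 := by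
  have : n + N 0 ≤ N n := by simpa using hN.add_le_nat n 0
  omega

theorem exists_le_length_word (hN : StrictMono N) (m : ℕ) :
    ∃ n₀, ∀ n, n₀ ≤ n → ∀ x, m ≤ (word N n x).length := by
  obtain ⟨n₀, hn₀⟩ := pow_unbounded_of_one_lt (2 * m : ℝ) Real.one_lt_goldenRatio
  refine ⟨n₀, fun n hn x => ?_⟩
  have h1 := pow_le_two_mul_length_word hN n x
  have h2 : Real.goldenRatio ^ n₀ ≤ Real.goldenRatio ^ (N n - N 0) :=
    pow_le_pow_right₀ Real.one_lt_goldenRatio.le (hn.trans (le_sub_zero hN n))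
  have : (m : ℝ) ≤ (word N n x).length := by linarith
  exact_mod_cast this

theorem exists_window_infix_word (hN : StrictMono N) {ξ : ℤ → Letter} (hξ : ξ ∈ sequenceSpace N)
    (n₀ : ℕ) (i : ℤ) (m : ℕ) : ∃ n x, n₀ ≤ n ∧ window ξ i m <:+: word N n x := by
  -- The window is lengthened so that it fits into no superletter of order below `n₀`. The extra 1
  -- keeps it nonempty, which rules out S_0(e).
  obtain ⟨n, x, h⟩ := hξ i (m + (maxLength N n₀ + 1))
  have hx : n ≠ 0 ∨ x ≠ none := by
    by_contra! hc
    obtain ⟨rfl, rfl⟩ := hc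
    obtain ⟨s, p, h⟩ := h
    have : some (ξ i) ∈ superletter N 0 none := by
      rw [← h, List.mem_append, List.mem_append]
      left; right
      rw [List.mem_ofFn]
      exact ⟨⟨0, by omega⟩, by simp⟩
    simp [superletter] at this
  rw [superletter_eq N n x hx] at h
  have h' : window ξ i (m + (maxLength N n₀ + 1)) <:+: word N n x := by
    have := h.map toLetter
    rw [List.map_map, toLetter_comp_some, List.map_id, List.map_ofFn] at this
    exact this
  refine ⟨n, x, ?_, List.IsInfix.trans ?_ h'⟩
  · by_contra! hlt
    have h1 := h'.length_le
    rw [length_window] at h1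
    have h2 := length_word_le hN n x
    have h3 : maxLength N n ≤ maxLength N n₀ := by
      refine Nat.ceil_mono ?_
      have := pow_le_pow_right₀ Real.one_lt_goldenRatio.le
        (Nat.sub_le_sub_right (hN.monotone hlt.le) (N 0))
      linarith
    omega
  · simpa using window_infix ξ i 0 m (maxLength N n₀ + 1)

theorem exists_window_infix_compose (hN : StrictMono N) {ξ : ℤ → Letter}
    (hξ : ξ ∈ sequenceSpace N) {n : ℕ} (hn : Even n) (i : ℤ) (m : ℕ) :
    ∃ w, window ξ i m <:+: compose N n w := by
  obtain ⟨M, x, hM, h⟩ := exists_window_infix_word hN hξ (n + 1) i m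
  obtain ⟨w, hw⟩ := exists_compose_eq_word N hn hM x
  exact ⟨w, hw ▸ h⟩

/-- Every factor is composed of superletters of a given even order, up to its ends. -/
theorem exists_window_eq (hN : StrictMono N) {ξ : ℤ → Letter} (hξ : ξ ∈ sequenceSpace N)
    {n : ℕ} (hn : Even n) (i : ℤ) (m : ℕ) :
    ∃ s w p, window ξ i m = s ++ compose N n w ++ p ∧
      s.length ≤ maxLength N n ∧ p.length ≤ maxLength N n := by
  obtain ⟨w, h⟩ := exists_window_infix_compose hN hξ hn i m
  obtain ⟨s, w', p, -, h1, h2, h3⟩ :=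
    infix_flatMap _ (maxLength N n) (fun x => length_word_le hN n (some x)) w h
  exact ⟨s, w', p, h1, h2, h3⟩

/-! ### Recurrence -/

theorem infix_flatMap_of_mem {α β : Type*} (f : α → List β) {w : List α} {x : α} (hx : x ∈ w) :
    f x <:+: w.flatMap f := by
  obtain ⟨s, t, rfl⟩ := List.append_of_mem hx
  exact ⟨s.flatMap f, t.flatMap f, by simp⟩

theorem prefix_flatMap_of_length_le {α β : Type*} (f : α → List β) (w : List α) {u : List β}
    (hu : ∀ x, u.length ≤ (f x).length) (h : u <+: w.flatMap f) :
    u = [] ∨ ∃ x, u <+: f x := by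
  cases w with
  | nil => left; simpa using h
  | cons x w =>
    rw [List.flatMap_cons] at h
    exact Or.inr ⟨x, List.prefix_of_prefix_length_le h (List.prefix_append _ _) (hu x)⟩

/-- A factor no longer than any block can meet at most two consecutive blocks. -/
theorem infix_flatMap_of_length_le {α β : Type*} (f : α → List β) (w : List α) {u : List β}
    (hu : ∀ x, u.length ≤ (f x).length) (h : u <:+: w.flatMap f) :
    u = [] ∨ ∃ x y, u <:+: f x ++ f y := by
  induction w with
  | nil => left; simpa using h
  | cons x w ih =>
    rw [List.flatMap_cons, List.infix_append_iff] at h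
    rcases h with h | h | ⟨s, r, rfl, hs, hr⟩
    · exact Or.inr ⟨x, x, h.trans (List.prefix_append _ _).isInfix⟩
    · exact ih h
    · right
      have hr' : ∀ y, r.length ≤ (f y).length := fun y => le_trans (by simp) (hu y)
      rcases prefix_flatMap_of_length_le f w hr' hr with rfl | ⟨y, t, ht⟩
      · exact ⟨x, x, by simpa using hs.isInfix.trans (List.prefix_append (f x) (f x)).isInfix⟩
      · obtain ⟨s', hs'⟩ := hs
        exact ⟨x, y, s', t, by rw [← hs', ← ht]; simp⟩

theorem some_a_mem_rule (hN : StrictMono N) {n : ℕ} (hn : 1 ≤ n) (x : ExtLetter) :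
    some Letter.a ∈ rule N n x := by
  have ha : ∀ y, Letter.a ∈ fibPow (Delta N n) y := a_mem_fibPow (one_le_Delta hN hn)
  cases x with
  | none => exact List.mem_map_of_mem ((rearrange_perm _).mem_iff.mpr (ha .b))
  | some x =>
    rw [rule]
    split_ifs with h
    · exact List.mem_map_of_mem (ha x)
    · by_cases hb : Letter.b ∈ fibPow (Delta N n) x
      · obtain ⟨p, q, h1, h2⟩ := replaceLastB_of_mem hb
        have := ha x
        rw [h1] at this
        rw [h2]
        simpa using this
      · rw [replaceLastB_of_notMem hb]
        exact List.mem_map_of_mem (ha x)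

theorem word_a_infix_word_succ (hN : StrictMono N) (n : ℕ) (x : ExtLetter) :
    word N n (some .a) <:+: word N (n + 1) x :=
  infix_flatMap_of_mem (word N n) (some_a_mem_rule hN (Nat.succ_pos n) x)

theorem infix_word_of_le (hN : StrictMono N) {u : List Letter} {n : ℕ}
    (h : u <:+: word N n (some .a)) {M : ℕ} (hM : n + 1 ≤ M) (x : ExtLetter) :
    u <:+: word N M x := by
  induction M, hM using Nat.le_induction generalizing x with
  | base => exact h.trans (word_a_infix_word_succ hN n x)
  | succ M _ ih => exact (ih _).trans (word_a_infix_word_succ hN M x)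

/-- A superletter of even order contains a rearranged superletter. -/
theorem word_none_infix (N : ℕ → ℕ) {n : ℕ} (hn : ¬ Odd (n + 1)) (x : Letter)
    (hb : Letter.b ∈ fibPow (Delta N (n + 1)) x) :
    word N n none <:+: word N (n + 1) (some x) := by
  obtain ⟨p, q, -, h⟩ := word_succ_of_even N hn x hb
  exact ⟨compose N n p, compose N n q, by rw [h, List.append_assoc]⟩

theorem b_mem_fibPow_a {k : ℕ} (hk : 1 ≤ k) : Letter.b ∈ fibPow k .a := by
  rw [← List.count_pos_iff, (count_fibPow _).2.1]
  exact Nat.fib_pos.mpr (by omega)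

theorem aba_prefix_fibPow (k : ℕ) : [.a, .b, .a] <+: fibPow (k + 2) .a := by
  induction k with
  | zero => exact List.prefix_rfl
  | succ k ih => rw [fibPow_succ_a]; exact ih.trans (List.prefix_append _ _)

theorem pair_infix_replicate (x : Letter) {k : ℕ} (hk : 2 ≤ k) :
    [x, x] <:+: List.replicate k x := by
  obtain ⟨k, rfl⟩ := Nat.exists_eq_add_of_le hk
  exact ⟨[], List.replicate k x, by simp [List.replicate_add]⟩

/-- The pairs aa, ab and bb appear in S_{n+1}(e), whose two runs both have length at least 2. The
pair ba does not, and is taken from the Fibonacci prefix aba of S_{n+1}(a). -/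
theorem compose_pair_infix (hN : StrictMono N) {n : ℕ} (hn : Even n) (hΔ : 5 ≤ Delta N (n + 1))
    (y z : Letter) : compose N n [y, z] <:+: word N (n + 2) (some .a) := by
  obtain ⟨d, hd⟩ := Nat.exists_eq_add_of_le' hΔ
  have he : word N (n + 1) none <:+: word N (n + 2) (some .a) :=
    word_none_infix N (by rw [Nat.not_odd_iff_even]; exact hn.add_one.add_one) .a
      (b_mem_fibPow_a (one_le_Delta hN (by omega)))
  have hw := word_succ_none N n
  rw [rearrange_eq, hd, (count_fibPow (d + 4)).2.2.1, (count_fibPow (d + 4)).2.2.2] at hw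
  have hk : 2 ≤ (d + 4 + 1).fib := by
    calc 2 ≤ Nat.fib 3 := by decide
      _ ≤ _ := Nat.fib_mono (by omega)
  have hl : 2 ≤ (d + 4).fib := by
    calc 2 ≤ Nat.fib 3 := by decide
      _ ≤ _ := Nat.fib_mono (by omega)
  cases y <;> cases z
  · refine List.IsInfix.trans ?_ he
    rw [hw]
    exact compose_infix N n ((pair_infix_replicate .a hk).trans (List.prefix_append _ _).isInfix)
  · refine List.IsInfix.trans ?_ he
    rw [hw]
    refine compose_infix N n ⟨List.replicate ((d + 4 + 1).fib - 1) .a,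
      List.replicate ((d + 4).fib - 1) .b, ?_⟩
    obtain ⟨k, hk⟩ := Nat.exists_eq_add_of_le' hk
    obtain ⟨l, hl⟩ := Nat.exists_eq_add_of_le' hl
    rw [hk, hl, show k + 2 - 1 = k + 1 by omega, show l + 2 - 1 = l + 1 by omega,
      List.replicate_succ' (n := k + 1), List.replicate_succ (n := l + 1)]
    simp
  · refine List.IsInfix.trans ?_ (word_a_infix_word_succ hN (n + 1) _)
    rw [word_succ_of_odd N hn.add_one, hd]
    refine compose_infix N n (List.IsInfix.trans ⟨[.a], [], rfl⟩
      (aba_prefix_fibPow (d + 3)).isInfix)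
  · refine List.IsInfix.trans ?_ he
    rw [hw]
    exact compose_infix N n ((pair_infix_replicate .b hl).trans (List.suffix_append _ _).isInfix)

theorem le_Delta_succ (hN : StrictMono N) (hodd : ∀ κ : ℕ, Odd κ → N (κ - 1) ≤ Delta N κ)
    {n : ℕ} (hn : Even n) : n ≤ Delta N (n + 1) := by
  have := hodd (n + 1) hn.add_one
  exact (hN.le_apply).trans this

/-- All factors of a given length occur in all superletters of high order. -/
theorem exists_window_infix_all (hN : StrictMono N)
    (hodd : ∀ κ : ℕ, Odd κ → N (κ - 1) ≤ Delta N κ) (m : ℕ) :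
    ∃ n₀, ∀ ξ ∈ sequenceSpace N, ∀ i, ∀ n, n₀ ≤ n → ∀ x, window ξ i m <:+: word N n x := by
  obtain ⟨n₁, hn₁⟩ := exists_le_length_word hN m
  obtain ⟨n, hn, hn5, hnn⟩ : ∃ n, Even n ∧ 5 ≤ n ∧ n₁ ≤ n :=
    ⟨2 * (n₁ + 5), even_two_mul _, by omega, by omega⟩
  refine ⟨n + 3, fun ξ hξ i M hM x => ?_⟩
  refine infix_word_of_le hN (n := n + 2) ?_ hM x
  obtain ⟨w, h⟩ := exists_window_infix_compose hN hξ hn i m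
  rcases infix_flatMap_of_length_le _ w (fun y => by simpa using hn₁ n hnn (some y)) h with
    h | ⟨y, z, h⟩
  · rw [h]; exact List.nil_infix
  · refine h.trans ?_
    simpa using compose_pair_infix hN hn (hn5.trans (le_Delta_succ hN hodd hn)) y z

/-- Every long factor contains a superletter of a given even order. -/
theorem exists_window_eq_word (hN : StrictMono N) {ξ : ℤ → Letter} (hξ : ξ ∈ sequenceSpace N)
    {n : ℕ} (hn : Even n) (i : ℤ) :
    ∃ (k : ℕ) (x : Letter), k ≤ maxLength N n ∧
      window ξ (i + k) (word N n (some x)).length = word N n (some x) := by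
  -- This length exceeds what the two incomplete ends can cover, so a whole superletter lies between
  -- them.
  obtain ⟨s, w, p, h, hs, hp⟩ := exists_window_eq hN hξ hn i (2 * maxLength N n + 1)
  cases w with
  | nil =>
    have := congrArg List.length h
    simp at this
    omega
  | cons x w =>
    refine ⟨s.length, x, hs, window_middle (m := 2 * maxLength N n + 1) (p := compose N n w ++ p) ?_⟩
    rw [h]; simp

/-- Every factor recurs with bounded gaps. -/
theorem exists_recurrence (hN : StrictMono N)
    (hodd : ∀ κ : ℕ, Odd κ → N (κ - 1) ≤ Delta N κ) (m : ℕ) :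
    ∃ D : ℕ, ∀ ξ ∈ sequenceSpace N, ∀ i j : ℤ, ∃ k : ℕ, k ≤ D ∧
      window ξ (j + k) m = window ξ i m := by
  obtain ⟨n₀, hn₀⟩ := exists_window_infix_all hN hodd m
  refine ⟨maxLength N (2 * n₀) + maxLength N (2 * n₀), fun ξ hξ i j => ?_⟩
  obtain ⟨k, x, hk, h⟩ := exists_window_eq_word hN hξ (even_two_mul n₀) j
  have h1 := hn₀ ξ hξ i (2 * n₀) (by omega) (some x)
  rw [← h] at h1
  obtain ⟨l, hl, h2⟩ := exists_window_of_infix h1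
  refine ⟨k + l, ?_, ?_⟩
  · have := length_word_le hN (2 * n₀) (some x)
    omega
  · rw [length_window] at h2
    rw [← h2]; push_cast; rw [add_assoc]

end

/-! ## The end points of the tiles -/

/-- The left end point of the `k`-th tile of `tiling φ 1 ξ t`. -/
noncomputable def point (ξ : ℤ → Letter) (t : ℝ) (k : ℤ) : ℝ :=
  t + tilePosition Real.goldenRatio 1 ξ k

theorem tiling_eq_range (ξ : ℤ → Letter) (t : ℝ) :
    tiling Real.goldenRatio 1 ξ t = Set.range (point ξ t) := rfl

theorem tilePosition_succ (L S : ℝ) (ξ : ℤ → Letter) (k : ℤ) :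
    tilePosition L S ξ (k + 1) = tilePosition L S ξ k + tileLength L S (ξ k) := by
  rcases lt_or_ge k 0 with hk | hk
  · have h1 : Finset.Ico 0 (k + 1) = ∅ := Finset.Ico_eq_empty (by omega)
    have h2 : Finset.Ico 0 k = ∅ := Finset.Ico_eq_empty (by omega)
    have h3 : Finset.Ico k 0 = insert k (Finset.Ico (k + 1) 0) := by ext; simp; omega
    rw [tilePosition, tilePosition, h1, h2, h3, Finset.sum_insert (by simp)]
    simp
  · have h1 : Finset.Ico (k + 1) 0 = ∅ := Finset.Ico_eq_empty (by omega)
    have h2 : Finset.Ico k 0 = ∅ := Finset.Ico_eq_empty (by omega)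
    have h3 : Finset.Ico 0 (k + 1) = insert k (Finset.Ico 0 k) := by ext; simp; omega
    rw [tilePosition, tilePosition, h1, h2, h3, Finset.sum_insert (by simp)]
    simp [add_comm]

theorem point_succ (ξ : ℤ → Letter) (t : ℝ) (k : ℤ) :
    point ξ t (k + 1) = point ξ t k + tileLength Real.goldenRatio 1 (ξ k) := by
  rw [point, point, tilePosition_succ, add_assoc]

theorem point_add (ξ : ℤ → Letter) (t : ℝ) (k : ℤ) (m : ℕ) :
    point ξ t (k + m) = point ξ t k + len (window ξ k m) := by
  induction m generalizing k with
  | zero => simp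
  | succ m ih =>
    rw [window_succ, len_cons, ← add_assoc, ← point_succ, ← ih]
    push_cast; congr 1; ring

theorem point_sub_le {ξ : ℤ → Letter} {t : ℝ} {k l : ℤ} (h : k ≤ l) :
    (l - k : ℝ) ≤ point ξ t l - point ξ t k ∧ point ξ t l - point ξ t k ≤ 2 * (l - k : ℝ) := by
  obtain ⟨m, rfl⟩ := Int.le.dest h
  have h1 := length_le_len (window ξ k m)
  have h2 := len_le_two_mul_length (window ξ k m)
  rw [length_window] at h1 h2
  rw [point_add]
  push_cast
  constructor <;> linarith

theorem abs_sub_le_abs_point_sub (ξ : ℤ → Letter) (t : ℝ) (k l : ℤ) :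
    |(k - l : ℝ)| ≤ |point ξ t k - point ξ t l| := by
  rcases le_total k l with h | h
  · have h1 := (point_sub_le (ξ := ξ) (t := t) h).1
    have h2 : (k : ℝ) ≤ l := by exact_mod_cast h
    rw [abs_sub_comm, abs_sub_comm (point ξ t k), abs_of_nonneg (by linarith)]
    exact h1.trans (le_abs_self _)
  · have h1 := (point_sub_le (ξ := ξ) (t := t) h).1
    have h2 : (l : ℝ) ≤ k := by exact_mod_cast h
    rw [abs_of_nonneg (by linarith)]
    exact h1.trans (le_abs_self _)

theorem exists_point_le (ξ : ℤ → Letter) (t y : ℝ) :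
    ∃ k, point ξ t k ≤ y ∧ y < point ξ t (k + 1) := by
  have hbdd : ∀ k : ℤ, point ξ t k ≤ y → k ≤ max 0 ⌈y - point ξ t 0⌉ := by
    intro k hk
    rcases le_or_gt k 0 with h | h
    · exact h.trans (le_max_left _ _)
    · have h1 := (point_sub_le (ξ := ξ) (t := t) h.le).1
      have h2 : (k : ℝ) ≤ ⌈y - point ξ t 0⌉ := by
        refine le_trans ?_ (Int.le_ceil _)
        push_cast at h1; linarith
      exact (by exact_mod_cast h2 : k ≤ ⌈y - point ξ t 0⌉).trans (le_max_right _ _)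
  have hne : ∃ k : ℤ, point ξ t k ≤ y := by
    refine ⟨min 0 ⌊y - point ξ t 0⌋, ?_⟩
    have h1 := (point_sub_le (ξ := ξ) (t := t) (min_le_left 0 ⌊y - point ξ t 0⌋)).1
    have h2 : ((min 0 ⌊y - point ξ t 0⌋ : ℤ) : ℝ) ≤ y - point ξ t 0 :=
      le_trans (by exact_mod_cast min_le_right _ _) (Int.floor_le _)
    push_cast at h1 h2 ⊢; linarith
  obtain ⟨k, hk, hmax⟩ := Int.exists_greatest_of_bdd ⟨_, hbdd⟩ hne
  refine ⟨k, hk, ?_⟩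
  by_contra! h
  have := hmax _ h
  omega

theorem point_succ_le (ξ : ℤ → Letter) (t : ℝ) (k : ℤ) :
    point ξ t k + 1 ≤ point ξ t (k + 1) ∧ point ξ t (k + 1) ≤ point ξ t k + 2 := by
  rw [point_succ]
  exact ⟨by linarith [one_le_tileLength (ξ k)], by linarith [tileLength_le_two (ξ k)]⟩

/-- Tiles have length at least 1, so a ball of radius R about a point of the tile at position i + r
only meets tiles of the window. The offset δ, at most one tile length, allows centres that are not
end points. -/
theorem patch_subset_of_window_eq {ξ : ℤ → Letter} {t δ R : ℝ} {i j : ℤ} {r : ℕ} (hδ : 0 ≤ δ)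
    (hδ2 : δ ≤ 2) (hr : R + 3 ≤ r) (h : window ξ i (2 * r) = window ξ j (2 * r)) :
    patch (tiling Real.goldenRatio 1 ξ t) (point ξ t (i + r) + δ) R ⊆
      patch (tiling Real.goldenRatio 1 ξ t) (point ξ t (j + r) + δ) R := by
  have key : ∀ k : ℕ, k ≤ 2 * r →
      point ξ t (i + k) - point ξ t i = point ξ t (j + k) - point ξ t j := by
    intro k hk
    obtain ⟨l, hl⟩ := Nat.exists_eq_add_of_le hk
    rw [hl, window_add, window_add] at h
    rw [point_add, point_add, (List.append_inj h (by simp)).1]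
    ring
  rintro v ⟨hv, l, hl⟩
  refine ⟨hv, ?_⟩
  change point ξ t l = _ at hl
  have h1 := abs_sub_le_abs_point_sub ξ t l (i + r)
  have h2 : |point ξ t l - point ξ t (i + r)| ≤ R + 2 := by
    rw [hl, show point ξ t (i + r) + δ + v - point ξ t (i + r) = δ + v by ring]
    exact (abs_add_le _ _).trans (by rw [abs_of_nonneg hδ]; linarith)
  have h3 := abs_le.mp (h1.trans h2)
  push_cast at h3
  have h4 : (i : ℝ) ≤ l := by linarith [h3.1]
  have h5 : (l : ℝ) ≤ i + 2 * r := by linarith [h3.2]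
  have h4' : i ≤ l := by exact_mod_cast h4
  have h5' : l ≤ i + 2 * r := by exact_mod_cast h5
  obtain ⟨k, rfl⟩ := Int.le.dest h4'
  have e1 := key k (by omega)
  have e2 := key r (by omega)
  exact ⟨j + k, by change point ξ t (j + k) = _; linarith⟩

theorem patch_eq_of_window_eq {ξ : ℤ → Letter} {t δ R : ℝ} {i j : ℤ} {r : ℕ} (hδ : 0 ≤ δ)
    (hδ2 : δ ≤ 2) (hr : R + 3 ≤ r) (h : window ξ i (2 * r) = window ξ j (2 * r)) :
    patch (tiling Real.goldenRatio 1 ξ t) (point ξ t (i + r) + δ) R =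
      patch (tiling Real.goldenRatio 1 ξ t) (point ξ t (j + r) + δ) R :=
  (patch_subset_of_window_eq hδ hδ2 hr h).antisymm (patch_subset_of_window_eq hδ hδ2 hr h.symm)

/-! ### Elementary properties of the tilings -/

theorem isDelone_tiling (ξ : ℤ → Letter) (t : ℝ) : IsDelone (tiling Real.goldenRatio 1 ξ t) := by
  refine ⟨⟨tiling Real.goldenRatio 1 ξ t, 1 / 2, by norm_num, ?_, 2, by norm_num, ?_⟩, rfl⟩
  · rintro _ ⟨k, rfl⟩ _ ⟨l, rfl⟩ hne
    change ((1 / 2 : NNReal) : ENNReal) < edist (point ξ t k) (point ξ t l)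
    have hkl : k ≠ l := by rintro rfl; exact hne rfl
    have h1 : (1 : ℝ) ≤ |(k - l : ℝ)| := by
      have : (1 : ℤ) ≤ |k - l| := Int.one_le_abs (sub_ne_zero.mpr hkl)
      exact_mod_cast this
    have h2 := h1.trans (abs_sub_le_abs_point_sub ξ t k l)
    rw [edist_dist, Real.dist_eq, ← ENNReal.ofReal_coe_nnreal]
    refine (ENNReal.ofReal_lt_ofReal_iff (by linarith)).mpr ?_
    push_cast; linarith
  · intro y _
    obtain ⟨k, h1, h2⟩ := exists_point_le ξ t y
    refine ⟨point ξ t k, ⟨k, rfl⟩, ?_⟩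
    change edist y (point ξ t k) ≤ _
    have := (point_succ_le ξ t k).2
    rw [edist_dist, Real.dist_eq, abs_of_nonneg (by linarith), ← ENNReal.ofReal_coe_nnreal]
    exact ENNReal.ofReal_le_ofReal (by push_cast; linarith)

theorem finite_letter : Finite Letter :=
  Finite.of_surjective (fun b : Bool => if b then Letter.a else Letter.b)
    fun x => by cases x <;> simp

theorem hasFLC_tiling (ξ : ℤ → Letter) (t : ℝ) : HasFLC (tiling Real.goldenRatio 1 ξ t) := by
  classical
  intro R _
  have := finite_letter
  obtain ⟨r, hr⟩ := exists_nat_ge (R + 3)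
  -- One patch for each word of length 2r. The choice of an occurrence is immaterial by
  -- `patch_eq_of_window_eq`.
  let F : (Fin (2 * r) → Letter) → Set ℝ := fun u =>
    if h : ∃ i, (fun j : Fin (2 * r) => ξ (i + (j : ℕ))) = u then
      patch (tiling Real.goldenRatio 1 ξ t) (point ξ t (h.choose + r)) R else ∅
  refine (Set.finite_range F).subset ?_
  rintro _ ⟨_, ⟨k, rfl⟩, rfl⟩
  have h : ∃ i, (fun j : Fin (2 * r) => ξ (i + (j : ℕ))) =
      fun j : Fin (2 * r) => ξ (k - r + (j : ℕ)) := ⟨k - r, rfl⟩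
  refine ⟨fun j => ξ (k - r + (j : ℕ)), ?_⟩
  have hw : window ξ h.choose (2 * r) = window ξ (k - r) (2 * r) :=
    congrArg List.ofFn h.choose_spec
  have := patch_eq_of_window_eq (t := t) le_rfl zero_le_two hr hw
  simp only [F, dif_pos h]
  simpa [point] using this

theorem isRepetitive_tiling {N : ℕ → ℕ} (hN : StrictMono N)
    (hodd : ∀ κ : ℕ, Odd κ → N (κ - 1) ≤ Delta N κ) {ξ : ℤ → Letter} (hξ : ξ ∈ sequenceSpace N)
    (t : ℝ) : IsRepetitive (tiling Real.goldenRatio 1 ξ t) := by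
  intro R _
  obtain ⟨r, hr⟩ := exists_nat_ge (R + 3)
  obtain ⟨D, hD⟩ := exists_recurrence hN hodd (2 * r)
  refine ⟨2 * D + 2 * r + 4, fun x y => ?_⟩
  obtain ⟨i, hi1, hi2⟩ := exists_point_le ξ t x
  obtain ⟨j, hj1, hj2⟩ := exists_point_le ξ t y
  obtain ⟨k, hk, hw⟩ := hD ξ hξ (i - r) j
  have hi3 := (point_succ_le ξ t i).2
  have hj3 := (point_succ_le ξ t j).2
  have := patch_eq_of_window_eq (t := t) (δ := x - point ξ t i) (by linarith) (by linarith) hr hw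
  rw [sub_add_cancel, add_sub_cancel] at this
  refine ⟨_, ?_, this⟩
  have h1 := point_sub_le (ξ := ξ) (t := t) (k := j) (l := j + k + r) (by omega)
  push_cast at h1
  have h2 : (k : ℝ) ≤ D := by exact_mod_cast hk
  have h3 : (0 : ℝ) ≤ k := Nat.cast_nonneg k
  have h4 : (0 : ℝ) ≤ r := Nat.cast_nonneg r
  rw [abs_le]
  constructor <;> linarith [h1.1, h1.2]

/-! ### Existence of scrambled Fibonacci sequences -/

/-- Compactness of the full shift: the sequences with a legal window on [-M, M) form a decreasing
family of nonempty closed sets. -/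
theorem nonempty_sequenceSpace {N : ℕ → ℕ} (hN : StrictMono N) : (sequenceSpace N).Nonempty := by
  let _ : TopologicalSpace Letter := ⊥
  have : DiscreteTopology Letter := ⟨rfl⟩
  have := finite_letter
  let legal : List Letter → Prop := fun u =>
    ∃ (n : ℕ) (x : ExtLetter), u.map some <:+: superletter N n x
  have hlegal : ∀ u v, u <:+: v → legal v → legal u := fun u v h ⟨n, x, hv⟩ =>
    ⟨n, x, (h.map some).trans hv⟩
  let C : ℕ → Set (ℤ → Letter) := fun M => {ξ | legal (window ξ (-M) (2 * M))}
  have hsub : ∀ (ξ : ℤ → Letter) (i : ℤ) (m M : ℕ), -(M : ℤ) ≤ i → i + m ≤ M →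
      window ξ i m <:+: window ξ (-M) (2 * M) := by
    intro ξ i m M h1 h2
    obtain ⟨a, ha⟩ := Int.le.dest h1
    have := window_infix ξ (-M) a m (2 * M - (a + m))
    rwa [ha, show a + m + (2 * M - (a + m)) = 2 * M by omega] at this
  have hclosed : ∀ M, IsClosed (C M) := by
    intro M
    have hc : Continuous fun ξ : ℤ → Letter => fun j : Fin (2 * M) => ξ (-M + (j : ℕ)) := by
      fun_prop
    exact (isClosed_discrete {f : Fin (2 * M) → Letter | legal (List.ofFn f)}).preimage hc
  have hne : (⋂ M, C M).Nonempty := by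
    refine IsCompact.nonempty_iInter_of_sequence_nonempty_isCompact_isClosed C ?_ ?_ ?_ ?_
    · intro M ξ hξ
      exact hlegal _ _ (hsub ξ _ _ _ (by push_cast; omega) (by push_cast; omega)) hξ
    · intro M
      obtain ⟨n₀, hn₀⟩ := exists_le_length_word hN (2 * M)
      have hl := hn₀ (n₀ + 1) (by omega) none
      -- A long superletter written from position -M onwards, with an arbitrary letter elsewhere.
      refine ⟨fun k => (word N (n₀ + 1) none).getD (k + M).toNat .a, n₀ + 1, none, ?_⟩
      rw [superletter_eq N _ _ (Or.inl (Nat.succ_ne_zero _))]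
      refine List.IsInfix.map some (List.IsPrefix.isInfix ?_)
      rw [List.prefix_iff_eq_take]
      refine List.ext_getElem (by simpa using hl) fun k h1 h2 => ?_
      have hk : k < 2 * M := by simpa using h1
      simp [window, List.getElem?_eq_getElem (hk.trans_le hl)]
    · exact (hclosed 0).isCompact
    · exact hclosed
  obtain ⟨ξ, hξ⟩ := hne
  refine ⟨ξ, fun i m => ?_⟩
  have h := hlegal _ _ (hsub ξ i m (i.natAbs + m) (by omega) (by omega))
    (Set.mem_iInter.mp hξ (i.natAbs + m))
  obtain ⟨n, x, h⟩ := h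
  refine ⟨n, x, ?_⟩
  rwa [window, List.map_ofFn] at h

/-! ## Rigidity of characters -/

theorem norm_mul_sub_one_le (z w : Circle) :
    ‖((z * w : Circle) : ℂ) - 1‖ ≤ ‖(z : ℂ) - 1‖ + ‖(w : ℂ) - 1‖ := by
  have h : ((z * w : Circle) : ℂ) - 1 = ((z : ℂ) - 1) + z * ((w : ℂ) - 1) := by push_cast; ring
  rw [h]
  refine (norm_add_le _ _).trans ?_
  rw [norm_mul, Circle.norm_coe, one_mul]

theorem norm_inv_sub_one (z : Circle) : ‖((z⁻¹ : Circle) : ℂ) - 1‖ = ‖(z : ℂ) - 1‖ := by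
  have h : (z : ℂ) - 1 = -(z * (((z⁻¹ : Circle) : ℂ) - 1)) := by
    rw [mul_sub, ← Circle.coe_mul, mul_inv_cancel, Circle.coe_one]; ring
  rw [h, norm_neg, norm_mul, Circle.norm_coe, one_mul]

theorem norm_pow_sub_one_le (z : Circle) (n : ℕ) :
    ‖((z ^ n : Circle) : ℂ) - 1‖ ≤ n * ‖(z : ℂ) - 1‖ := by
  induction n with
  | zero => simp
  | succ n ih =>
    rw [pow_succ, Nat.cast_succ]
    refine (norm_mul_sub_one_le _ _).trans ?_
    linarith

theorem norm_mul_sub_mul (z w v : Circle) :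
    ‖((z * w : Circle) : ℂ) - (z * v : Circle)‖ = ‖(w : ℂ) - v‖ := by
  rw [Circle.coe_mul, Circle.coe_mul, ← mul_sub, norm_mul, Circle.norm_coe, one_mul]

/-- On (1, 2] the cosine is below 7/8. This gap cannot be jumped by steps of size at most 1. -/
theorem le_one_of_cos {x : ℝ} (h2 : x ≤ 2) (hc : 7 / 8 ≤ Real.cos x) : x ≤ 1 := by
  by_contra! h
  have := Real.cos_lt_cos_of_nonneg_of_le_pi zero_le_one (h2.trans Real.two_le_pi) h
  linarith [Real.cos_one_le]

theorem seven_eighths_le_cos {x : ℝ} (h : ‖((Circle.exp x : Circle) : ℂ) - 1‖ ≤ 1 / 2) :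
    7 / 8 ≤ Real.cos x := by
  have h1 : ‖((Circle.exp x : Circle) : ℂ) - 1‖ ^ 2 = 2 - 2 * Real.cos x := by
    rw [Circle.coe_exp, Complex.exp_mul_I, ← Complex.ofReal_cos, ← Complex.ofReal_sin,
      Complex.sq_norm, Complex.normSq_apply]
    simp [Complex.cos_ofReal_re, Complex.sin_ofReal_re]
    linarith [Real.sin_sq_add_cos_sq x]
  have h2 : ‖((Circle.exp x : Circle) : ℂ) - 1‖ ^ 2 ≤ (1 / 2) ^ 2 := by gcongr
  linarith

/-- The summands are added one at a time. A step of size at most 1 leads from (-∞, 1] into (-∞, 2],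
and the gap (1, 2] of `le_one_of_cos` keeps the new partial sum at most 1. -/
theorem sum_mul_le_one {θ : ℕ → ℝ} {K : ℕ → ℕ} {M : ℕ}
    (h1 : ∀ m, K m ≠ 0 → θ m ≤ 1)
    (hc : ∀ ρ : ℕ → ℕ, (∀ m, ρ m ≤ K m) →
      7 / 8 ≤ Real.cos (∑ m ∈ Finset.range M, ρ m * θ m)) :
    ∑ m ∈ Finset.range M, K m * θ m ≤ 1 := by
  suffices ∀ (n : ℕ) (ρ : ℕ → ℕ), (∀ m, ρ m ≤ K m) → ∑ m ∈ Finset.range M, ρ m = n →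
      ∑ m ∈ Finset.range M, ρ m * θ m ≤ 1 from this _ K (fun _ => le_rfl) rfl
  intro n
  induction n with
  | zero =>
    intro ρ _ hs
    rw [Finset.sum_eq_zero_iff] at hs
    rw [Finset.sum_eq_zero fun m hm => by rw [hs m hm]; simp]
    exact zero_le_one
  | succ n ih =>
    intro ρ hρ hs
    obtain ⟨m₀, hm₀, hpos⟩ : ∃ m ∈ Finset.range M, ρ m ≠ 0 :=
      Finset.exists_ne_zero_of_sum_ne_zero (by omega)
    obtain ⟨k, hk⟩ := Nat.exists_eq_succ_of_ne_zero hpos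
    let ρ' := Function.update ρ m₀ k
    have hρ' : ∀ m, ρ' m ≤ K m := by
      intro m
      by_cases h : m = m₀
      · subst h; simp only [ρ', Function.update_self]; have := hρ m; omega
      · simpa [ρ', h] using hρ m
    have hk' : ρ' m₀ = k := Function.update_self _ _ _
    have hne : ∀ m ∈ (Finset.range M).erase m₀, ρ' m = ρ m := fun m hm =>
      Function.update_of_ne (Finset.mem_erase.mp hm).1 _ _
    have e1 : ∑ m ∈ Finset.range M, ρ m = ∑ m ∈ Finset.range M, ρ' m + 1 := by
      rw [← Finset.add_sum_erase _ _ hm₀, ← Finset.add_sum_erase _ ρ' hm₀,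
        Finset.sum_congr rfl hne, hk, hk', Nat.succ_eq_add_one]
      ring
    have e2 : ∑ m ∈ Finset.range M, ρ m * θ m = ∑ m ∈ Finset.range M, ρ' m * θ m + θ m₀ := by
      rw [← Finset.add_sum_erase _ _ hm₀, ← Finset.add_sum_erase _ (fun m => ρ' m * θ m) hm₀,
        Finset.sum_congr rfl fun m hm => show (ρ' m * θ m : ℝ) = ρ m * θ m by rw [hne m hm],
        hk, hk']
      push_cast; ring
    have h2 := ih ρ' hρ' (by omega)
    have h3 := h1 m₀ (by have := hρ m₀; omega)
    exact le_one_of_cos (by linarith) (hc ρ hρ)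

/-- If all partial products of a finite family of unit complex numbers are close to `1`, then the
total distance of its members from `1` is bounded. -/
theorem sum_mul_norm_sub_one_le {z : ℕ → Circle} {K : ℕ → ℕ} {M : ℕ}
    (h : ∀ ρ : ℕ → ℕ, (∀ m, ρ m ≤ K m) →
      ‖((∏ m ∈ Finset.range M, z m ^ ρ m : Circle) : ℂ) - 1‖ ≤ 1 / 2) :
    ∑ m ∈ Finset.range M, K m * ‖(z m : ℂ) - 1‖ ≤ 2 := by
  -- Angles beyond the range of the product are not controlled, hence set to 0.
  let θ : ℕ → ℝ := fun m => if m < M then Complex.arg (z m) else 0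
  have hcos : ∀ ρ : ℕ → ℕ, (∀ m, ρ m ≤ K m) →
      7 / 8 ≤ Real.cos (∑ m ∈ Finset.range M, ρ m * θ m) := by
    intro ρ hρ
    refine seven_eighths_le_cos ?_
    have : Circle.exp (∑ m ∈ Finset.range M, ρ m * θ m) = ∏ m ∈ Finset.range M, z m ^ ρ m := by
      have h1 : ∀ s : Finset ℕ, Circle.exp (∑ m ∈ s, ρ m * θ m) = ∏ m ∈ s, Circle.exp (θ m) ^ ρ m := by
        intro s
        induction s using Finset.induction_on with
        | empty => simp
        | insert a s ha ih =>
          rw [Finset.sum_insert ha, Finset.prod_insert ha, Circle.exp_add, ih]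
          congr 1
          induction ρ a with
          | zero => simp
          | succ k ihk => rw [pow_succ, ← ihk, ← Circle.exp_add]; push_cast; congr 1; ring
      rw [h1]
      refine Finset.prod_congr rfl fun m hm => ?_
      simp only [θ, if_pos (Finset.mem_range.mp hm), Circle.exp_arg]
    rw [this]; exact h ρ hρ
  have habs : ∀ m, K m ≠ 0 → |θ m| ≤ 1 := by
    intro m hm
    by_cases hmM : m < M
    · have h1 := hcos (Pi.single m 1) (by
        intro k
        by_cases hk : k = m
        · subst hk; simp; omega
        · simp [hk])
      have h2 : ∑ k ∈ Finset.range M, ((Pi.single m 1 : ℕ → ℕ) k : ℝ) * θ k = θ m := by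
        rw [Finset.sum_eq_single m]
        · simp
        · intro k _ hk; simp [hk]
        · intro hk; exact absurd (Finset.mem_range.mpr hmM) hk
      rw [h2, ← Real.cos_abs] at h1
      by_contra! hlt
      have h3 : |θ m| ≤ Real.pi := by
        simp only [θ, if_pos hmM]; exact Complex.abs_arg_le_pi _
      have := Real.cos_lt_cos_of_nonneg_of_le_pi zero_le_one h3 hlt
      linarith [Real.cos_one_le]
    · simp [θ, hmM]
  -- Positive and negative angles are bounded separately, using exponents that vanish on the other
  -- kind, so that no cancellation can hide a large total.
  have hp : ∑ m ∈ Finset.range M, K m * max (θ m) 0 ≤ 1 := by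
    refine sum_mul_le_one
      (fun m hm => max_le ((le_abs_self _).trans (habs m hm)) zero_le_one) fun ρ hρ => ?_
    convert! hcos (fun m => if 0 ≤ θ m then ρ m else 0) (fun m => by
      split_ifs; exacts [hρ m, Nat.zero_le _]) using 3 with m
    split_ifs with hm
    · rw [max_eq_left hm]
    · rw [max_eq_right (not_le.mp hm).le]; simp
  have hn : ∑ m ∈ Finset.range M, K m * max (-θ m) 0 ≤ 1 := by
    refine sum_mul_le_one
      (fun m hm => max_le ((neg_le_abs _).trans (habs m hm)) zero_le_one) fun ρ hρ => ?_
    have := hcos (fun m => if θ m ≤ 0 then ρ m else 0) (fun m => by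
      split_ifs; exacts [hρ m, Nat.zero_le _])
    rw [← Real.cos_neg, ← Finset.sum_neg_distrib] at this
    convert! this using 3 with m
    split_ifs with hm
    · rw [max_eq_left (by linarith)]; ring
    · rw [max_eq_right (by linarith [not_le.mp hm])]; simp
  calc ∑ m ∈ Finset.range M, K m * ‖(z m : ℂ) - 1‖
      ≤ ∑ m ∈ Finset.range M, (K m * max (θ m) 0 + K m * max (-θ m) 0) := by
        refine Finset.sum_le_sum fun m hm => ?_
        rw [← mul_add]
        refine mul_le_mul_of_nonneg_left ?_ (Nat.cast_nonneg _)
        have h1 : max (θ m) 0 + max (-θ m) 0 = |θ m| := by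
          rcases le_total 0 (θ m) with h | h
          · rw [max_eq_left h, max_eq_right (by linarith), abs_of_nonneg h, add_zero]
          · rw [max_eq_right h, max_eq_left (by linarith), abs_of_nonpos h, zero_add]
        rw [h1]
        have h2 : (z m : ℂ) = Complex.exp (Complex.I * (θ m : ℝ)) := by
          simp only [θ, if_pos (Finset.mem_range.mp hm)]
          rw [mul_comm, ← Circle.coe_exp, Circle.exp_arg]
        rw [h2]
        exact Real.norm_exp_I_mul_ofReal_sub_one_le
    _ ≤ 2 := by rw [Finset.sum_add_distrib]; linarith

-- Return vectors from rearranged superletters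

section

variable {N : ℕ → ℕ}

/-- The number of superletters `S_n(x)` in a row that the superletter `S_{n+1}(e)` contains. -/
def runLength (N : ℕ → ℕ) (x : Letter) (n : ℕ) : ℕ := (fibPow (Delta N (n + 1)) .b).count x

theorem exists_word_none_eq (N : ℕ → ℕ) (n : ℕ) (x : Letter) :
    ∃ p q, word N (n + 1) none = p ++ compose N n (List.replicate (runLength N x n) x) ++ q := by
  rw [word_succ_none, rearrange_eq, compose_append]
  cases x
  · exact ⟨[], compose N n (List.replicate (runLength N .b n) .b), by simp [runLength]⟩
  · exact ⟨compose N n (List.replicate (runLength N .a n) .a), [], by simp [runLength]⟩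

theorem word_infix_word_add_two (N : ℕ → ℕ) {n : ℕ} (hn : Even n)
    (h1 : 2 ≤ Delta N (n + 1)) (h2 : 2 ≤ Delta N (n + 2)) (x y : Letter) :
    word N n (some x) <:+: word N (n + 2) (some y) := by
  have he : word N (n + 1) none <:+: word N (n + 2) (some y) :=
    word_none_infix N (by rw [Nat.not_odd_iff_even]; exact hn.add_one.add_one) y
      (b_mem_fibPow h2 y)
  refine List.IsInfix.trans ?_ he
  rw [word_succ_none]
  refine infix_flatMap_of_mem (fun x => word N n (some x)) ((rearrange_perm _).mem_iff.mpr ?_)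
  cases x
  · exact a_mem_fibPow (by omega) _
  · exact b_mem_fibPow h1 _

/-- The occurrences of a word in the superletters that are obtained by choosing, in each
rearranged superletter on the way, one of the copies of the lower superletter. -/
theorem exists_occurrence (hN : StrictMono N) {n₀ : ℕ} (hn₀ : Even n₀)
    (hΔ : ∀ n, n₀ < n → 2 ≤ Delta N n) (x : Letter) {u : List Letter}
    (hu : u <:+: word N n₀ (some x)) (M : ℕ) :
    ∃ O : ℝ, ∀ ρ : ℕ → ℕ, (∀ m, ρ m ≤ runLength N x (n₀ + 2 * m) - 1) →
      ∃ pre post, word N (n₀ + 2 * M) (some x) = pre ++ u ++ post ∧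
        len pre = O + ∑ m ∈ Finset.range M, ρ m *
          (Real.goldenRatio ^ (N (n₀ + 2 * m) - N 0) * tileLength Real.goldenRatio 1 x) := by
  induction M with
  | zero =>
    obtain ⟨s, t, h⟩ := hu
    exact ⟨len s, fun ρ _ => ⟨s, t, h.symm, by simp⟩⟩
  | succ M ih =>
    obtain ⟨O, hO⟩ := ih
    set n := n₀ + 2 * M with hn
    have hne : ¬ Odd (n + 1 + 1) := by
      rw [Nat.not_odd_iff_even]; exact ((hn₀.add (even_two_mul M)).add_one).add_one
    obtain ⟨s, t, hst⟩ := word_none_infix N hne x (b_mem_fibPow (hΔ _ (by omega)) x)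
    obtain ⟨p, q, hpq⟩ := exists_word_none_eq N n x
    have hK : 1 ≤ runLength N x n := by
      rw [runLength, Nat.one_le_iff_ne_zero, ← Nat.pos_iff_ne_zero, List.count_pos_iff]
      have h2 := hΔ (n + 1) (by omega)
      cases x
      · exact a_mem_fibPow (by omega) _
      · exact b_mem_fibPow h2 _
    refine ⟨len s + len p + O, fun ρ hρ => ?_⟩
    obtain ⟨pre, post, h1, h2⟩ := hO ρ hρ
    obtain ⟨k, hk⟩ := Nat.exists_eq_add_of_le (hρ M)
    rw [← hn] at hk
    have hrep : List.replicate (runLength N x n) x =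
        List.replicate (ρ M) x ++ [x] ++ List.replicate k x := by
      rw [show runLength N x n = ρ M + 1 + k by omega, List.replicate_add, List.replicate_add]; rfl
    refine ⟨s ++ p ++ compose N n (List.replicate (ρ M) x) ++ pre,
      post ++ compose N n (List.replicate k x) ++ q ++ t, ?_, ?_⟩
    · rw [show n₀ + 2 * (M + 1) = n + 1 + 1 by omega, ← hst, hpq, hrep]
      simp [h1, List.append_assoc]
    · simp only [len_append, h2, len_compose hN, Finset.sum_range_succ]
      have : len (List.replicate (ρ M) x) = ρ M * tileLength Real.goldenRatio 1 x := by
        simp [len]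
      rw [this]; ring

theorem fib_le_six_mul {D : ℕ} (hD : 4 ≤ D) : (D + 1).fib ≤ 6 * ((D - 1).fib - 1) := by
  obtain ⟨d, rfl⟩ := Nat.exists_eq_add_of_le' hD
  have h1 : (d + 5).fib = (d + 3).fib + (d + 4).fib := Nat.fib_add_two
  have h2 : (d + 4).fib = (d + 2).fib + (d + 3).fib := Nat.fib_add_two
  have h3 : (d + 2).fib ≤ (d + 3).fib := Nat.fib_mono (by omega)
  have h4 : Nat.fib 3 ≤ (d + 3).fib := Nat.fib_mono (by omega)
  have h5 : Nat.fib 3 = 2 := by decide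
  rw [show d + 4 + 1 = d + 5 by omega, show d + 4 - 1 = d + 3 by omega]
  omega

/-- This is where Δ(n+1) ≥ N(n) enters: the number of free choices in a run dominates the Fibonacci
coefficients that express 1 and φ through the superletter lengths of level n. The factor 6 absorbs
the index shift and the subtracted 1. -/
theorem fib_le_runLength (hN : StrictMono N)
    (hodd : ∀ κ : ℕ, Odd κ → N (κ - 1) ≤ Delta N κ) {n : ℕ} (hn : Even n) (hn4 : 4 ≤ n)
    (x : Letter) : (N n - N 0 + 1).fib ≤ 6 * (runLength N x n - 1) := by
  have h1 : N n ≤ Delta N (n + 1) := hodd (n + 1) hn.add_one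
  have h2 : n ≤ N n := hN.le_apply
  have h3 : (N n - N 0 + 1).fib ≤ (Delta N (n + 1) + 1).fib := Nat.fib_mono (by omega)
  refine h3.trans ((fib_le_six_mul (by omega)).trans ?_)
  obtain ⟨d, hd⟩ : ∃ d, Delta N (n + 1) = d + 1 := ⟨Delta N (n + 1) - 1, by omega⟩
  have h4 : (Delta N (n + 1) - 1).fib ≤ runLength N x n := by
    rw [runLength, hd]
    cases x
    · rw [(count_fibPow d).2.2.1]; exact Nat.fib_mono (by omega)
    · rw [(count_fibPow d).2.2.2]; exact Nat.fib_mono (by omega)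
  omega

/-- The patch at `y` recurs at all positions given by `exists_occurrence`, so ψ is near 1 on all
these sums, and `sum_mul_norm_sub_one_le` bounds the series by 2 uniformly in the number of levels.
-/
theorem tendsto_runLength_mul (hN : StrictMono N)
    (hodd : ∀ κ : ℕ, Odd κ → N (κ - 1) ≤ Delta N κ)
    (hev : ∃ n₁, ∀ n, n₁ ≤ n → Even n → 2 ≤ Delta N n)
    {ξ : ℤ → Letter} (hξ : ξ ∈ sequenceSpace N) {t R y : ℝ} (ψ : AddChar ℝ Circle)
    (hψ : ∀ x, patch (tiling Real.goldenRatio 1 ξ t) x R =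
      patch (tiling Real.goldenRatio 1 ξ t) y R → ‖(ψ (x - y) : ℂ) - 1‖ ≤ 1 / 4) :
    ∃ n₀, Even n₀ ∧ 4 ≤ n₀ ∧ ∀ x : Letter, Tendsto (fun m =>
      ((runLength N x (n₀ + 2 * m) - 1 : ℕ) : ℝ) *
      ‖(ψ (Real.goldenRatio ^ (N (n₀ + 2 * m) - N 0) * tileLength Real.goldenRatio 1 x) : ℂ) - 1‖)
      atTop (𝓝 0) := by
  obtain ⟨k₀, hk1, hk2⟩ := exists_point_le ξ t y
  obtain ⟨r, hr⟩ := exists_nat_ge (R + 3)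
  obtain ⟨n₂, hn₂⟩ := exists_window_infix_all hN hodd (2 * r)
  obtain ⟨n₁, hn₁⟩ := hev
  -- From this level on, all superletters contain the word of the patch, and every later Δ is at
  -- least 2, so each power of σ in use contains both letters.
  have hn₀ : Even (2 * (n₁ + n₂ + 2)) := even_two_mul _
  set n₀ := 2 * (n₁ + n₂ + 2) with hn₀'
  have hΔ : ∀ n, n₀ < n → 2 ≤ Delta N n := by
    intro n hn
    rcases Nat.even_or_odd n with he | ho
    · exact hn₁ n (by omega) he
    · obtain ⟨k, rfl⟩ := ho
      have := le_Delta_succ hN hodd (even_two_mul k)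
      omega
  refine ⟨n₀, hn₀, by omega, fun x => ?_⟩
  have hsum : ∀ M, ∑ m ∈ Finset.range M, ((runLength N x (n₀ + 2 * m) - 1 : ℕ) : ℝ) *
      ‖(ψ (Real.goldenRatio ^ (N (n₀ + 2 * m) - N 0) *
        tileLength Real.goldenRatio 1 x) : ℂ) - 1‖ ≤ 2 := by
    intro M
    obtain ⟨O, hO⟩ := exists_occurrence hN hn₀ hΔ x (hn₂ ξ hξ (k₀ - r) n₀ (by omega) (some x)) M
    have hnM : Even (n₀ + 2 * M) := hn₀.add (even_two_mul M)
    obtain ⟨a, x', -, ha⟩ := exists_window_eq_word hN hξ (n := n₀ + 2 * M + 2)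
      (hnM.add even_two) 0
    have hx := word_infix_word_add_two N hnM (hΔ _ (by omega)) (hΔ _ (by omega)) x x'
    rw [← ha] at hx
    obtain ⟨b, -, hb⟩ := exists_window_of_infix hx
    set i : ℤ := 0 + a + b
    let v : ℕ → ℝ := fun m =>
      Real.goldenRatio ^ (N (n₀ + 2 * m) - N 0) * tileLength Real.goldenRatio 1 x
    -- The displacement from the given occurrence of the patch to the recurrence with all choices ρ
    -- equal to 0.
    let c : ℝ := point ξ t i + O - point ξ t (k₀ - r)
    have h1 : ∀ ρ : ℕ → ℕ, (∀ m, ρ m ≤ runLength N x (n₀ + 2 * m) - 1) →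
        ‖(ψ (c + ∑ m ∈ Finset.range M, ρ m * v m) : ℂ) - 1‖ ≤ 1 / 4 := by
      intro ρ hρ
      obtain ⟨pre, post, h2, h3⟩ := hO ρ hρ
      have h4 := window_middle (hb.trans h2)
      rw [length_window] at h4
      have h5 := (window_split (u := pre) (v := window ξ (k₀ - r) (2 * r) ++ post)
        (hb.trans (by rw [h2, List.append_assoc]))).1
      have h6 := patch_eq_of_window_eq (t := t) (δ := y - point ξ t k₀) (by linarith)
        (by linarith [(point_succ_le ξ t k₀).2]) hr h4
      rw [sub_add_cancel, add_sub_cancel] at h6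
      have h7 := hψ _ h6
      have h8 : point ξ t (i + pre.length + r) + (y - point ξ t k₀) - y =
          c + ∑ m ∈ Finset.range M, ρ m * v m := by
        have h9 : window ξ (i + pre.length) r = window ξ (k₀ - r) r := by
          rw [two_mul, window_add, window_add] at h4
          exact (List.append_inj h4 (by simp)).1
        have h10 := point_add ξ t (k₀ - r) r
        rw [sub_add_cancel] at h10
        rw [point_add, h9, point_add, h5, h3, h10]
        simp only [c, v]; ring
      rwa [h8] at h7
    have h0 : ‖(ψ c : ℂ) - 1‖ ≤ 1 / 4 := by
      simpa using h1 (fun _ => 0) (fun _ => Nat.zero_le _)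
    -- Removing the factor ψ(c), itself within 1/4 of 1, turns the bound 1/4 into 1/2.
    refine sum_mul_norm_sub_one_le fun ρ hρ => ?_
    have h2 := h1 ρ hρ
    have h3 : ∀ s : Finset ℕ, ψ (∑ m ∈ s, ρ m * v m) = ∏ m ∈ s, ψ (v m) ^ ρ m := by
      intro s
      induction s using Finset.induction_on with
      | empty => simp
      | insert a s ha ih =>
        rw [Finset.sum_insert ha, Finset.prod_insert ha, AddChar.map_add_eq_mul, ih,
          ← AddChar.map_nsmul_eq_pow, nsmul_eq_mul]
    change ‖((∏ m ∈ Finset.range M, ψ (v m) ^ ρ m : Circle) : ℂ) - 1‖ ≤ 1 / 2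
    rw [← h3]
    rw [AddChar.map_add_eq_mul] at h2
    have h4 := norm_mul_sub_mul (ψ c) (ψ (∑ m ∈ Finset.range M, ρ m * v m)) 1
    rw [mul_one, Circle.coe_one] at h4
    rw [← h4]
    calc _ = ‖(((ψ c * ψ (∑ m ∈ Finset.range M, ρ m * v m) : Circle) : ℂ) - 1) -
          ((ψ c : ℂ) - 1)‖ := by congr 1; ring
      _ ≤ 1 / 2 := (norm_sub_le _ _).trans (by linarith)
  exact (summable_of_sum_range_le (fun m => by positivity) hsum).tendsto_atTop_zero

/-- A character of the line (as a discrete group) that is close to `1` on the return vectors of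
some patch is trivial on `ℤ[φ]`. -/
theorem char_eq_one (hN : StrictMono N)
    (hodd : ∀ κ : ℕ, Odd κ → N (κ - 1) ≤ Delta N κ)
    (hev : ∃ n₁, ∀ n, n₁ ≤ n → Even n → 2 ≤ Delta N n)
    {ξ : ℤ → Letter} (hξ : ξ ∈ sequenceSpace N) {t R y : ℝ} (ψ : AddChar ℝ Circle)
    (hψ : ∀ x, patch (tiling Real.goldenRatio 1 ξ t) x R =
      patch (tiling Real.goldenRatio 1 ξ t) y R → ‖(ψ (x - y) : ℂ) - 1‖ ≤ 1 / 4) :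
    ψ 1 = 1 ∧ ψ Real.goldenRatio = 1 := by
  obtain ⟨n₀, hn₀, hn4, hlim⟩ := tendsto_runLength_mul hN hodd hev hξ ψ hψ
  have hlim' := ((hlim .a).add (hlim .b)).const_mul 6
  rw [add_zero, mul_zero] at hlim'
  have hcomb : ∀ (x : ℝ) (k l K : ℕ) (A B : ℝ), k ≤ K → l ≤ K → (x = k * A - l * B ∨
      -x = k * A - l * B) → ‖(ψ x : ℂ) - 1‖ ≤ K * ‖(ψ A : ℂ) - 1‖ + K * ‖(ψ B : ℂ) - 1‖ := by
    intro x k l K A B hk hl h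
    have h1 : ‖(ψ (k * A - l * B) : ℂ) - 1‖ ≤ K * ‖(ψ A : ℂ) - 1‖ + K * ‖(ψ B : ℂ) - 1‖ := by
      rw [sub_eq_add_neg ((k : ℝ) * A), AddChar.map_add_eq_mul, AddChar.map_neg_eq_inv, ← nsmul_eq_mul,
        ← nsmul_eq_mul, AddChar.map_nsmul_eq_pow, AddChar.map_nsmul_eq_pow]
      refine (norm_mul_sub_one_le _ _).trans (add_le_add ?_ ?_)
      · exact (norm_pow_sub_one_le _ _).trans (by gcongr)
      · rw [norm_inv_sub_one]; exact (norm_pow_sub_one_le _ _).trans (by gcongr)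
    rcases h with h | h
    · rwa [h]
    · rw [← norm_inv_sub_one, ← AddChar.map_neg_eq_inv, h]; exact h1
  -- A number that is, up to sign, a combination of φ^(e+1) and φ^e with coefficients at most
  -- F_{e+1}, for every e, has ψ-value 1: its distance from 1 is bounded by six times the terms that
  -- tend to 0.
  have hone : ∀ x : ℝ, (∀ e : ℕ, ∃ k l : ℕ, k ≤ (e + 1).fib ∧ l ≤ (e + 1).fib ∧
      (x = k * (Real.goldenRatio ^ e * Real.goldenRatio) - l * (Real.goldenRatio ^ e * 1) ∨
      -x = k * (Real.goldenRatio ^ e * Real.goldenRatio) - l * (Real.goldenRatio ^ e * 1))) →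
      ψ x = 1 := by
    intro x hx
    have hle : ‖(ψ x : ℂ) - 1‖ ≤ 0 := by
      refine ge_of_tendsto' hlim' fun m => ?_
      obtain ⟨k, l, hk, hl, h⟩ := hx (N (n₀ + 2 * m) - N 0)
      have hF := fun y => fib_le_runLength hN hodd (hn₀.add (even_two_mul m)) (by omega) y
      refine (hcomb x k l _ _ _ hk hl h).trans ?_
      rw [mul_add, ← mul_assoc, ← mul_assoc]
      gcongr
      · exact_mod_cast hF .a
      · exact le_rfl
      · exact_mod_cast hF .b
      · exact le_rfl
    have h0 : (ψ x : ℂ) = 1 := by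
      rw [← sub_eq_zero, ← norm_eq_zero]; exact le_antisymm hle (norm_nonneg _)
    exact Circle.ext (by rw [h0, Circle.coe_one])
  -- F_{e+1} - φ F_e is the e-th power of the conjugate of φ, and φ times its conjugate is -1.
  have key : ∀ e : ℕ, Real.goldenRatio ^ e * (e + 1).fib -
      Real.goldenRatio ^ e * Real.goldenRatio * e.fib = (-1) ^ e := by
    intro e
    have h := Real.fib_succ_sub_goldenRatio_mul_fib e
    rw [← Real.goldenRatio_mul_goldenConj, mul_pow, ← h]; ring
  constructor
  · refine hone 1 fun e => ⟨e.fib, (e + 1).fib, Nat.fib_le_fib_succ, le_rfl, ?_⟩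
    have h := key e
    rcases neg_one_pow_eq_or ℝ e with he | he <;> rw [he] at h
    · right; linarith
    · left; linarith
  · refine hone _ fun e => ⟨(e + 1).fib - e.fib, e.fib, Nat.sub_le _ _, Nat.fib_le_fib_succ, ?_⟩
    rw [Nat.cast_sub Nat.fib_le_fib_succ]
    have h : Real.goldenRatio * (-1) ^ e = ((e + 1).fib - e.fib : ℝ) *
        (Real.goldenRatio ^ e * Real.goldenRatio) - e.fib * (Real.goldenRatio ^ e * 1) := by
      rw [← key e]; linear_combination (-(e.fib : ℝ) * Real.goldenRatio ^ e) * Real.goldenRatio_sq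
    rcases neg_one_pow_eq_or ℝ e with he | he <;> rw [he] at h
    · left; linarith
    · right; linarith

end

/-! ## Topological eigenvalues and the Meyer property -/

/-- The continuous character with frequency `β`. -/
noncomputable def expChar (β : ℝ) : AddChar ℝ Circle :=
  Real.fourierChar.compAddMonoidHom (AddMonoidHom.mulLeft β)

theorem expChar_apply (β x : ℝ) :
    (expChar β x : ℂ) = Complex.exp (2 * Real.pi * Complex.I * (β * x : ℝ)) := by
  rw [expChar, AddChar.compAddMonoidHom_apply, AddMonoidHom.coe_mulLeft, Real.fourierChar_apply]
  congr 1; push_cast; ring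

theorem fourierChar_eq_one_iff (x : ℝ) : Real.fourierChar x = 1 ↔ ∃ n : ℤ, x = n := by
  rw [← Circle.coe_inj, Real.fourierChar_apply, Circle.coe_one, Complex.exp_eq_one_iff]
  refine exists_congr fun n => ?_
  have h2 : (2 * Real.pi * Complex.I : ℂ) ≠ 0 := Complex.two_pi_I_ne_zero
  rw [show ((2 * Real.pi * x : ℝ) : ℂ) * Complex.I = (x : ℂ) * (2 * Real.pi * Complex.I) by
    push_cast; ring, mul_left_inj' h2]
  norm_cast

theorem int_eq_zero_of_mul_goldenRatio {n : ℤ} {q : ℚ} (h : n * Real.goldenRatio = q) : n = 0 := by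
  by_contra hn
  have hn' : (n : ℝ) ≠ 0 := by exact_mod_cast hn
  refine Real.goldenRatio_irrational ⟨q / n, ?_⟩
  push_cast
  rw [← h]; field_simp

theorem eventually_near {Λ : Set ℝ} {U : Set (Set ℝ)} (hU : U ∈ 𝓝 Λ) :
    ∃ ε : ℝ, 0 < ε ∧ ∀ Λ', Near ε Λ Λ' → Λ' ∈ U := by
  obtain ⟨V, hV, hVU⟩ := UniformSpace.mem_nhds_iff.mp hU
  obtain ⟨_, ⟨ε, hε, rfl⟩, h⟩ := FilterBasis.mem_filter_iff _ |>.mp hV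
  exact ⟨ε, hε, fun Λ' hn => hVU (h hn)⟩

section

variable {N : ℕ → ℕ}

/-- If the patches of T at 0 and x agree, then T and T - x are close, so f changes little and
exp(2πiβx) is within 1/4 of 1. Thus `char_eq_one` applies, and β and βφ are integers. Continuity is
needed at one tiling only. -/
theorem eigenvalue_eq_zero (hN : StrictMono N)
    (hodd : ∀ κ : ℕ, Odd κ → N (κ - 1) ≤ Delta N κ)
    (hev : ∃ n₁, ∀ n, n₁ ≤ n → Even n → 2 ≤ Delta N n)
    {ξ : ℤ → Letter} (hξ : ξ ∈ sequenceSpace N) {t β : ℝ} {Ω : Set (Set ℝ)} {f : Set ℝ → ℂ}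
    (hf : ContinuousWithinAt f Ω (tiling Real.goldenRatio 1 ξ t))
    (h0 : f (tiling Real.goldenRatio 1 ξ t) ≠ 0)
    (hΩ : ∀ s, translate (tiling Real.goldenRatio 1 ξ t) s ∈ Ω)
    (heq : ∀ s, f (translate (tiling Real.goldenRatio 1 ξ t) s) =
      Complex.exp (2 * Real.pi * Complex.I * (β * s : ℝ)) * f (tiling Real.goldenRatio 1 ξ t)) :
    β = 0 := by
  set T := tiling Real.goldenRatio 1 ξ t
  have h1 := Metric.continuousWithinAt_iff'.mp hf (‖f T‖ / 4) (by positivity)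
  obtain ⟨ε, hε, hnear⟩ := eventually_near (mem_nhdsWithin_iff_eventually.mp h1)
  obtain ⟨e1, e2⟩ := char_eq_one hN hodd hev hξ (t := t) (R := 1 / ε) (y := 0) (expChar β) (by
    intro x hx
    have h2 : Near ε T (translate T x) := by
      refine ⟨0, 0, by simpa using hε, by simpa using hε, ?_⟩
      rw [← hx]
      ext v
      simp [patch, translate, T, add_comm]
    have h3 : dist (f (translate T x)) (f T) < ‖f T‖ / 4 := hnear _ h2 (hΩ x)
    rw [dist_eq_norm, heq, ← expChar_apply, ← sub_one_mul, norm_mul] at h3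
    rw [sub_zero]
    have h4 : 0 < ‖f T‖ := norm_pos_iff.mpr h0
    by_contra! hlt
    nlinarith)
  obtain ⟨n, hn⟩ := (fourierChar_eq_one_iff _).mp e1
  obtain ⟨m, hm⟩ := (fourierChar_eq_one_iff _).mp e2
  simp only [AddMonoidHom.coe_mulLeft, mul_one] at hn hm
  have := int_eq_zero_of_mul_goldenRatio (n := n) (q := m) (by rw [← hn, hm]; norm_cast)
  rw [hn, this, Int.cast_zero]

theorem translate_tiling (ξ : ℤ → Letter) (t s : ℝ) :
    translate (tiling Real.goldenRatio 1 ξ t) s = tiling Real.goldenRatio 1 ξ (t - s) := by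
  ext x
  simp only [translate, tiling, Set.mem_ofPred_eq, Set.mem_range]
  refine exists_congr fun k => ?_
  constructor <;> intro h <;> linarith

theorem isTopologicalEigenvalue_zero {Ω : Set (Set ℝ)} (h : Ω.Nonempty) :
    IsTopologicalEigenvalue Ω 0 := by
  obtain ⟨ω, hω⟩ := h
  exact ⟨fun _ => 1, continuousOn_const, ⟨ω, hω, one_ne_zero⟩, fun _ _ t => by simp⟩

theorem isTopologicalEigenvalue_tilingSpace_iff (hN : StrictMono N)
    (hodd : ∀ κ : ℕ, Odd κ → N (κ - 1) ≤ Delta N κ)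
    (hev : ∃ n₁, ∀ n, n₁ ≤ n → Even n → 2 ≤ Delta N n) (β : ℝ) :
    IsTopologicalEigenvalue (tilingSpace N Real.goldenRatio 1) β ↔ β = 0 := by
  constructor
  · rintro ⟨f, hf, ⟨_, ⟨ξ, hξ, t, rfl⟩, h0⟩, heq⟩
    have hT : ∀ t, tiling Real.goldenRatio 1 ξ t ∈ tilingSpace N Real.goldenRatio 1 :=
      fun t => ⟨ξ, hξ, t, rfl⟩
    exact eigenvalue_eq_zero hN hodd hev hξ (hf _ (hT t)) h0
      (fun s => translate_tiling ξ t s ▸ hT _) (heq _ (hT t))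
  · rintro rfl
    obtain ⟨ξ, hξ⟩ := nonempty_sequenceSpace hN
    exact isTopologicalEigenvalue_zero ⟨_, ξ, hξ, 0, rfl⟩

theorem isTopologicalEigenvalue_hull_iff (hN : StrictMono N)
    (hodd : ∀ κ : ℕ, Odd κ → N (κ - 1) ≤ Delta N κ)
    (hev : ∃ n₁, ∀ n, n₁ ≤ n → Even n → 2 ≤ Delta N n)
    {ξ : ℤ → Letter} (hξ : ξ ∈ sequenceSpace N) (t β : ℝ) :
    IsTopologicalEigenvalue (hull (tiling Real.goldenRatio 1 ξ t)) β ↔ β = 0 := by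
  set T := tiling Real.goldenRatio 1 ξ t with hTdef
  have hmem : ∀ s, translate T s ∈ hull T := fun s => subset_closure ⟨s, rfl⟩
  have hT0 : translate T 0 = T := by ext x; simp [translate]
  have hT : T ∈ hull T := by simpa only [hT0] using hmem 0
  constructor
  · rintro ⟨f, hf, ⟨ω, hω, h0⟩, heq⟩
    -- An eigenfunction that vanishes at T vanishes on its orbit, and then by continuity on the
    -- whole hull.
    refine eigenvalue_eq_zero hN hodd hev hξ (hf _ hT) (fun hz => h0 ?_) hmem (heq _ hT)
    have h1 := ((hf ω hω).mono subset_closure).mem_closure_image hω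
    have h2 : f '' Set.range (translate T) ⊆ {0} := by
      rintro _ ⟨_, ⟨s, rfl⟩, rfl⟩
      rw [Set.mem_singleton_iff, heq _ hT, hz, mul_zero]
    simpa using closure_minimal h2 isClosed_singleton h1
  · rintro rfl
    exact isTopologicalEigenvalue_zero ⟨T, hT⟩

/-- Supplies the character exp(2πi l(x)) of the discrete line, which is 1 at 1 and -1 at φ. No
continuous character agrees with it on ℤ[φ]. -/
theorem exists_linearMap_goldenRatio :
    ∃ l : ℝ →ₗ[ℚ] ℚ, l 1 = 0 ∧ l Real.goldenRatio = 1 / 2 := by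
  have h : Real.goldenRatio ∉ Submodule.span ℚ {(1 : ℝ)} := by
    rw [Submodule.mem_span_singleton]
    rintro ⟨q, hq⟩
    exact Real.goldenRatio_irrational ⟨q, by rw [← hq, Rat.smul_one_eq_cast]⟩
  obtain ⟨f, hf, hker⟩ := Submodule.exists_le_ker_of_notMem h
  have h1 : f 1 = 0 := hker (Submodule.mem_span_singleton_self 1)
  exact ⟨(1 / (2 * f Real.goldenRatio)) • f, by simp [h1], by
    rw [LinearMap.smul_apply, smul_eq_mul]; field_simp⟩

/-- Local derivability turns the return vectors of a patch of T about a point of Λ into differences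
of points of Λ. There the quotient ψ of χ by its approximating continuous character is near 1, so ψ
is trivial on ℤ[φ], which would make χ continuous there. -/
theorem not_isMeyerTiling_tiling (hN : StrictMono N)
    (hodd : ∀ κ : ℕ, Odd κ → N (κ - 1) ≤ Delta N κ)
    (hev : ∃ n₁, ∀ n, n₁ ≤ n → Even n → 2 ≤ Delta N n)
    {ξ : ℤ → Letter} (hξ : ξ ∈ sequenceSpace N) (t : ℝ) :
    ¬ IsMeyerTiling (tiling Real.goldenRatio 1 ξ t) := by
  rintro ⟨Λ, ⟨⟨r, hdense⟩, hharm⟩, ⟨R, -, hder⟩, -⟩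
  obtain ⟨y, hy, -⟩ := hdense 0
  obtain ⟨l, hl1, hlφ⟩ := exists_linearMap_goldenRatio
  let χ : AddChar ℝ Circle := Real.fourierChar.compAddMonoidHom
    ((Rat.castHom ℝ).toAddMonoidHom.comp l.toAddMonoidHom)
  -- The tolerance 1/8 doubles to the 1/4 required by `char_eq_one` when differences of points are
  -- formed.
  obtain ⟨β, hβ⟩ := hharm (χ.compAddMonoidHom (AddSubgroup.closure Λ).subtype) (1 / 8)
    (by norm_num)
  let ψ : AddChar ℝ Circle := χ * (expChar β)⁻¹
  have hψ : ∀ x, ψ x = χ x * (expChar β x)⁻¹ := fun x => by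
    rw [AddChar.mul_apply, AddChar.inv_apply']
  have hΛ : ∀ a ∈ Λ, ‖(ψ a : ℂ) - 1‖ ≤ 1 / 8 := by
    intro a ha
    have h1 := hβ a ha
    rw [← expChar_apply] at h1
    change ‖(χ a : ℂ) - (expChar β a : ℂ)‖ < 1 / 8 at h1
    have h2 := norm_mul_sub_mul (expChar β a) (ψ a) 1
    rw [mul_one, Circle.coe_one, hψ, mul_comm, inv_mul_cancel_right] at h2
    rw [hψ, ← h2]
    exact h1.le
  obtain ⟨e1, e2⟩ := char_eq_one hN hodd hev hξ (t := t) (R := R) (y := y) ψ (by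
    intro x hx
    have hxΛ : x ∈ Λ := (hder x y hx).mpr hy
    rw [sub_eq_add_neg x, AddChar.map_add_eq_mul, AddChar.map_neg_eq_inv]
    refine (norm_mul_sub_one_le _ _).trans ?_
    rw [norm_inv_sub_one]
    linarith [hΛ x hxΛ, hΛ y hy])
  have hψ' : ∀ x, ψ x = Real.fourierChar ((l x : ℝ) - β * x) := by
    intro x
    rw [hψ, ← AddChar.map_neg_eq_inv, sub_eq_add_neg, AddChar.map_add_eq_mul]
    congr 1
    simp [expChar]
  rw [hψ', fourierChar_eq_one_iff] at e1 e2
  obtain ⟨n, hn⟩ := e1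
  obtain ⟨m, hm⟩ := e2
  rw [hl1] at hn
  rw [hlφ] at hm
  push_cast at hn hm
  have h1 : n * Real.goldenRatio = ((m - 1 / 2 : ℚ) : ℝ) := by
    push_cast; rw [← hm, ← hn]; ring
  have hn0 := int_eq_zero_of_mul_goldenRatio h1
  rw [hn0] at h1
  have h2 : (2 * m : ℝ) = 1 := by push_cast at h1; linarith
  have h3 : 2 * m = 1 := by exact_mod_cast h2
  omega

theorem not_isMeyerSet_tiling (hN : StrictMono N)
    (hodd : ∀ κ : ℕ, Odd κ → N (κ - 1) ≤ Delta N κ)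
    (hev : ∃ n₁, ∀ n, n₁ ≤ n → Even n → 2 ≤ Delta N n)
    {ξ : ℤ → Letter} (hξ : ξ ∈ sequenceSpace N) (t : ℝ) :
    ¬ IsMeyerSet (tiling Real.goldenRatio 1 ξ t) := by
  intro h
  have hd : ∀ Λ : Set ℝ, IsLocallyDerivable Λ Λ := by
    refine fun Λ => ⟨1, one_pos, fun x y hxy => ?_⟩
    have h0 := Set.ext_iff.mp hxy 0
    simpa [patch] using h0
  exact not_isMeyerTiling_tiling hN hodd hev hξ t ⟨_, h, hd _, hd _⟩

end

/-! ## Bochner's theorem for limits of characteristic functions -/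

/-- A pointwise limit of characteristic functions of finite measures that is continuous at `0` is
the characteristic function of a finite measure. -/
theorem exists_charFun_eq_of_tendsto {μ : ℕ → Measure ℝ} [∀ n, IsFiniteMeasure (μ n)] {G : ℝ → ℂ}
    (hG : ContinuousAt G 0) (h : ∀ t, Tendsto (fun n => charFun (μ n) t) atTop (𝓝 (G t))) :
    ∃ ν : Measure ℝ, IsFiniteMeasure ν ∧ ∀ t, charFun ν t = G t := by
  have hmass : Tendsto (fun n => (μ n).real Set.univ) atTop (𝓝 ‖G 0‖) := by
    have := (h 0).norm
    simpa [charFun_zero, abs_of_nonneg measureReal_nonneg] using this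
  have hG0 : G 0 = (‖G 0‖ : ℝ) := by
    have h1 : Tendsto (fun n => (((μ n).real Set.univ : ℝ) : ℂ)) atTop (𝓝 ((‖G 0‖ : ℝ) : ℂ)) :=
      (Complex.continuous_ofReal.tendsto _).comp hmass
    refine tendsto_nhds_unique (h 0) ?_
    simpa [charFun_zero] using h1
  -- If the masses tend to 0, so do the characteristic functions, and the zero measure works.
  -- Otherwise the measures are eventually nonzero and can be normalised.
  rcases eq_or_ne (G 0) 0 with h0 | h0
  · refine ⟨0, inferInstance, fun t => ?_⟩
    rw [h0, norm_zero] at hmass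
    have : ‖G t‖ ≤ 0 := le_of_tendsto_of_tendsto' (h t).norm hmass fun n => norm_charFun_le t
    rw [norm_le_zero_iff.mp this]
    simp [charFun_apply]
  have hpos : 0 < ‖G 0‖ := norm_pos_iff.mpr h0
  obtain ⟨n₀, hn₀⟩ := eventually_atTop.mp (hmass.eventually_const_lt hpos)
  let P : ℕ → ProbabilityMeasure ℝ := fun n =>
    ⟨((μ (n₀ + n)) Set.univ)⁻¹ • μ (n₀ + n), by
      have hne : (μ (n₀ + n)) Set.univ ≠ 0 := by
        intro hz
        have := hn₀ (n₀ + n) (by omega)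
        simp [Measure.real, hz] at this
      exact ⟨by rw [Measure.smul_apply, smul_eq_mul,
        ENNReal.inv_mul_cancel hne (measure_ne_top _ _)]⟩⟩
  have hP : ∀ t, Tendsto (fun n => charFun (P n : Measure ℝ) t) atTop
      (𝓝 (((‖G 0‖ : ℝ) : ℂ)⁻¹ * G t)) := by
    intro t
    have h1 : ∀ n, charFun (P n : Measure ℝ) t =
        (((μ (n₀ + n)).real Set.univ : ℝ) : ℂ)⁻¹ * charFun (μ (n₀ + n)) t := by
      intro n
      simp only [P, ProbabilityMeasure.coe_mk, charFun_apply, integral_smul_measure]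
      simp [Measure.real]
    simp_rw [h1]
    have hshift : Tendsto (fun n => n₀ + n) atTop atTop := by
      simpa [add_comm] using tendsto_add_atTop_nat n₀
    refine Tendsto.mul (Tendsto.inv₀ ?_ (by exact_mod_cast hpos.ne')) ((h t).comp hshift)
    exact (Complex.continuous_ofReal.tendsto _).comp (hmass.comp hshift)
  -- Continuity of the limit at 0 prevents mass from escaping. A cluster point exists by Prokhorov's
  -- theorem, and its characteristic function must be the given limit.
  have htight : IsTightMeasureSet (Set.range fun n => (P n : Measure ℝ)) :=
    isTightMeasureSet_of_tendsto_charFun (hG.const_mul _) hP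
  have hcompact : IsCompact (closure (Set.range P)) := by
    refine isCompact_closure_of_isTightMeasureSet ?_
    convert! htight using 1
    ext m; simp
  obtain ⟨Q, -, hQ⟩ := hcompact.exists_mapClusterPt (f := atTop) (u := P)
    (tendsto_principal.mpr (Eventually.of_forall fun n => subset_closure (Set.mem_range_self n)))
  have hQt : ∀ t, charFun (Q : Measure ℝ) t = ((‖G 0‖ : ℝ) : ℂ)⁻¹ * G t := by
    intro t
    have hcont : Continuous fun Q : ProbabilityMeasure ℝ => charFun (Q : Measure ℝ) t := by
      rw [continuous_iff_continuousAt]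
      intro Q
      have := (ProbabilityMeasure.tendsto_iff_forall_integral_rclike_tendsto ℂ).mp
        (tendsto_id (x := 𝓝 Q)) (BoundedContinuousFunction.innerProbChar t)
      simp_rw [ContinuousAt, charFun_eq_integral_innerProbChar]
      exact this
    have hcl := hQ.continuousAt_comp (f := fun Q : ProbabilityMeasure ℝ => charFun (Q : Measure ℝ) t)
      hcont.continuousAt
    exact eq_of_nhds_neBot (hcl.clusterPt.mono (hP t))
  refine ⟨ENNReal.ofReal ‖G 0‖ • (Q : Measure ℝ), ?_, fun t => ?_⟩
  · exact Measure.smul_finite _ ENNReal.ofReal_ne_top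
  · have : charFun (ENNReal.ofReal ‖G 0‖ • (Q : Measure ℝ)) t =
        ((‖G 0‖ : ℝ) : ℂ) * charFun (Q : Measure ℝ) t := by
      simp [charFun_apply, integral_smul_measure]
    rw [this, hQt, mul_inv_cancel_left₀ (by exact_mod_cast hpos.ne')]

/-! ## The exponential kernel -/

/-- The Fourier transform of `exp (-|x|)`. -/
noncomputable def kernel (k : ℝ) : ℝ := 2 / (1 + 4 * Real.pi ^ 2 * k ^ 2)

theorem kernel_pos (k : ℝ) : 0 < kernel k := by unfold kernel; positivity

theorem continuous_kernel : Continuous kernel := by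
  unfold kernel
  exact continuous_const.div (by fun_prop) fun k => by positivity

theorem integrable_kernel : Integrable kernel := by
  have h := (integrable_inv_one_add_sq.comp_mul_left' (g := fun x : ℝ => (1 + x ^ 2)⁻¹)
    (R := 2 * Real.pi) (by positivity)).const_mul 2
  refine h.congr (Eventually.of_forall fun k => ?_)
  simp only [kernel]
  rw [div_eq_mul_inv]; congr 2; ring

theorem integrable_exp_mul_abs {c : ℝ} (hc : c < 0) :
    Integrable fun x : ℝ => Real.exp (c * |x|) := by
  rw [← integrableOn_univ, ← Set.Iic_union_Ioi (a := (0 : ℝ))]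
  refine IntegrableOn.union ?_ ?_
  · refine (integrableOn_exp_mul_Iic (neg_pos.mpr hc) 0).congr_fun (fun x hx => ?_)
      measurableSet_Iic
    simp only [abs_of_nonpos (Set.mem_Iic.mp hx)]; congr 1; ring
  · refine (integrableOn_exp_mul_Ioi hc 0).congr_fun (fun x hx => ?_) measurableSet_Ioi
    simp only [abs_of_pos (Set.mem_Ioi.mp hx)]

theorem fourier_exp_neg_abs :
    𝓕 (fun x : ℝ => (Real.exp (-1 * |x|) : ℂ)) = fun k => (kernel k : ℂ) := by
  ext k
  have hint : Integrable fun v : ℝ =>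
      Complex.exp (↑(-2 * Real.pi * v * k) * Complex.I) • (Real.exp (-1 * |v|) : ℂ) := by
    refine (integrable_exp_mul_abs (c := -1) (by norm_num)).ofReal.bdd_mul (c := 1)
      (Continuous.aestronglyMeasurable (by fun_prop)) (Eventually.of_forall fun v => ?_)
    rw [Complex.norm_exp_ofReal_mul_I]
  have h1 : ∫ v in Set.Iic (0 : ℝ),
      Complex.exp (↑(-2 * Real.pi * v * k) * Complex.I) • (Real.exp (-1 * |v|) : ℂ) =
      1 / (1 - 2 * Real.pi * k * Complex.I) := by
    have := integral_exp_mul_complex_Iic (a := 1 - 2 * Real.pi * k * Complex.I) (by simp) 0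
    rw [Complex.ofReal_zero, mul_zero, Complex.exp_zero] at this
    rw [← this]
    refine setIntegral_congr_fun measurableSet_Iic fun v hv => ?_
    simp only [abs_of_nonpos (Set.mem_Iic.mp hv), smul_eq_mul, Complex.ofReal_exp]
    rw [← Complex.exp_add]; congr 1; push_cast; ring
  have h2 : ∫ v in Set.Ioi (0 : ℝ),
      Complex.exp (↑(-2 * Real.pi * v * k) * Complex.I) • (Real.exp (-1 * |v|) : ℂ) =
      1 / (1 + 2 * Real.pi * k * Complex.I) := by
    have := integral_exp_mul_complex_Ioi (a := -(1 + 2 * Real.pi * k * Complex.I)) (by simp) 0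
    rw [Complex.ofReal_zero, mul_zero, Complex.exp_zero, neg_div_neg_eq] at this
    rw [← this]
    refine setIntegral_congr_fun measurableSet_Ioi fun v hv => ?_
    simp only [abs_of_pos (Set.mem_Ioi.mp hv), smul_eq_mul, Complex.ofReal_exp]
    rw [← Complex.exp_add]; congr 1; push_cast; ring
  rw [Real.fourier_real_eq_integral_exp_smul, ← intervalIntegral.integral_Iic_add_Ioi
    hint.integrableOn hint.integrableOn, h1, h2]
  have h3 : (1 - 2 * Real.pi * k * Complex.I : ℂ) ≠ 0 := fun h => by
    have := congrArg Complex.re h; simp at this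
  have h4 : (1 + 2 * Real.pi * k * Complex.I : ℂ) ≠ 0 := fun h => by
    have := congrArg Complex.re h; simp at this
  have h5 : (1 - 2 * Real.pi * k * Complex.I : ℂ) * (1 + 2 * Real.pi * k * Complex.I) =
      1 + 4 * Real.pi ^ 2 * k ^ 2 := by
    linear_combination (-4 * (Real.pi : ℂ) ^ 2 * k ^ 2) * Complex.I_sq
  rw [div_add_div _ _ h3 h4, h5, kernel]
  push_cast; congr 1; ring

theorem integral_fourierChar_mul_kernel (t : ℝ) :
    ∫ k, (Real.fourierChar (k * t) : ℂ) * (kernel k : ℂ) = (Real.exp (-1 * |t|) : ℂ) := by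
  have hc : Continuous fun x : ℝ => (Real.exp (-1 * |x|) : ℂ) := by fun_prop
  have h := congrFun (hc.fourierInv_fourier_eq
    (integrable_exp_mul_abs (c := -1) (by norm_num)).ofReal
    (by rw [fourier_exp_neg_abs]; exact integrable_kernel.ofReal)) t
  rw [fourier_exp_neg_abs, Real.fourierInv_eq] at h
  rw [← h]
  refine integral_congr_ae (Eventually.of_forall fun k => ?_)
  simp [Circle.smul_def, mul_comm]

/-! ## Measures whose Fourier transform is almost periodic along the powers of `φ` -/

/-- The frequencies `k` for which `k φ ^ j` approaches the integers. -/
def pisotFrequencies : Set ℝ :=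
  {k | Tendsto (fun j : ℕ => k * Real.goldenRatio ^ j - round (k * Real.goldenRatio ^ j))
    atTop (𝓝 0)}

/-- The numbers kφ^j satisfy the Fibonacci recurrence. Their nearest integers satisfy it up to an
integer error which tends to 0, hence is eventually 0. -/
theorem exists_round_recurrence {k : ℝ} (hk : k ∈ pisotFrequencies) :
    ∃ J : ℕ, ∀ j, J ≤ j → round (k * Real.goldenRatio ^ (j + 2)) =
      round (k * Real.goldenRatio ^ (j + 1)) + round (k * Real.goldenRatio ^ j) := by
  have h0 : Tendsto (fun j : ℕ => k * Real.goldenRatio ^ j - round (k * Real.goldenRatio ^ j))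
    atTop (𝓝 0) := hk
  have h1 := h0.comp (tendsto_add_atTop_nat 1)
  have h2 := h0.comp (tendsto_add_atTop_nat 2)
  have h3 := (h2.sub h1).sub h0
  rw [sub_zero, sub_zero] at h3
  obtain ⟨J, hJ⟩ := eventually_atTop.mp (Metric.tendsto_nhds.mp h3 1 one_pos)
  refine ⟨J, fun j hj => ?_⟩
  have h4 := hJ j hj
  rw [dist_zero_right, Real.norm_eq_abs] at h4
  simp only [Function.comp] at h4
  have h5 : k * Real.goldenRatio ^ (j + 2) =
      k * Real.goldenRatio ^ (j + 1) + k * Real.goldenRatio ^ j := by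
    linear_combination (k * Real.goldenRatio ^ j) * Real.goldenRatio_sq
  rw [show k * Real.goldenRatio ^ (j + 2) - round (k * Real.goldenRatio ^ (j + 2)) -
      (k * Real.goldenRatio ^ (j + 1) - round (k * Real.goldenRatio ^ (j + 1))) -
      (k * Real.goldenRatio ^ j - round (k * Real.goldenRatio ^ j)) =
      ((round (k * Real.goldenRatio ^ (j + 1)) + round (k * Real.goldenRatio ^ j) -
        round (k * Real.goldenRatio ^ (j + 2)) : ℤ) : ℝ) by push_cast; linarith] at h4
  have h6 : |round (k * Real.goldenRatio ^ (j + 1)) + round (k * Real.goldenRatio ^ j) -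
        round (k * Real.goldenRatio ^ (j + 2))| < 1 := by exact_mod_cast h4
  have := Int.abs_lt_one_iff.mp h6
  omega

/-- The starting index of the recurrence and two integers determine all later nearest integers.
These determine k: if k and l share them, then |k - l| φ^j ≤ 1 for all large j. -/
theorem countable_pisotFrequencies : pisotFrequencies.Countable := by
  classical
  choose! J hJ using fun k (hk : k ∈ pisotFrequencies) => exists_round_recurrence hk
  refine Set.MapsTo.countable_of_injOn (t := Set.univ)
    (f := fun k => (J k, round (k * Real.goldenRatio ^ J k),
      round (k * Real.goldenRatio ^ (J k + 1)))) (fun _ _ => Set.mem_univ _) ?_ Set.countable_univ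
  intro k hk l hl hkl
  simp only [Prod.mk.injEq] at hkl
  obtain ⟨e0, e1, e2⟩ := hkl
  have hl' := hJ l hl
  rw [← e0] at e1 e2 hl'
  have heq : ∀ i, round (k * Real.goldenRatio ^ (J k + i)) =
      round (l * Real.goldenRatio ^ (J k + i)) ∧
      round (k * Real.goldenRatio ^ (J k + i + 1)) =
      round (l * Real.goldenRatio ^ (J k + i + 1)) := by
    intro i
    induction i with
    | zero => exact ⟨e1, e2⟩
    | succ i ih =>
      refine ⟨ih.2, ?_⟩
      have a1 := hJ k hk (J k + i) (by omega)
      have a2 := hl' (J k + i) (by omega)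
      rw [show J k + (i + 1) + 1 = J k + i + 2 by ring, a1, a2, ih.1, ih.2]
  by_contra hne
  have hpos : 0 < |k - l| := abs_pos.mpr (sub_ne_zero.mpr hne)
  obtain ⟨i, hi⟩ := pow_unbounded_of_one_lt (1 / |k - l|) Real.one_lt_goldenRatio
  have hi' : 1 / |k - l| < Real.goldenRatio ^ (J k + i) :=
    hi.trans_le (pow_le_pow_right₀ Real.one_lt_goldenRatio.le (by omega))
  rw [div_lt_iff₀ hpos] at hi'
  have b1 := abs_sub_round (k * Real.goldenRatio ^ (J k + i))
  have b2 := abs_sub_round (l * Real.goldenRatio ^ (J k + i))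
  rw [(heq i).1] at b1
  have b3 : |k - l| * Real.goldenRatio ^ (J k + i) ≤ 1 := by
    rw [← abs_of_pos (pow_pos Real.goldenRatio_pos (J k + i)), ← abs_mul,
      show (k - l) * Real.goldenRatio ^ (J k + i) =
        (k * Real.goldenRatio ^ (J k + i) - round (l * Real.goldenRatio ^ (J k + i))) -
        (l * Real.goldenRatio ^ (J k + i) - round (l * Real.goldenRatio ^ (J k + i))) by ring]
    exact (abs_sub _ _).trans (by linarith)
  linarith

/-- The right side is sin²(πx), and sin(πd) ≥ 2d for the distance d ≤ 1/2 of x from the nearest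
integer. -/
theorem normSq_one_add_fourierChar (x : ℝ) :
    4 * (x - round x) ^ 2 ≤ 1 - ‖(1 + (Real.fourierChar x : ℂ)) / 2‖ ^ 2 := by
  have h1 : 1 - ‖(1 + (Real.fourierChar x : ℂ)) / 2‖ ^ 2 = Real.sin (Real.pi * x) ^ 2 := by
    have e1 := Real.cos_sq' (Real.pi * x)
    have e2 := Real.cos_two_mul (Real.pi * x)
    have e3 := Real.sin_sq_add_cos_sq (2 * (Real.pi * x))
    rw [← mul_assoc] at e2 e3
    rw [Real.fourierChar_apply, Complex.exp_mul_I, ← Complex.ofReal_cos, ← Complex.ofReal_sin,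
      norm_div, div_pow, Complex.sq_norm, Complex.normSq_apply]
    generalize Real.cos (2 * Real.pi * x) = c at *
    generalize Real.sin (2 * Real.pi * x) = s at *
    simp only [Complex.add_re, Complex.add_im, Complex.mul_re, Complex.mul_im, Complex.ofReal_re,
      Complex.ofReal_im, Complex.I_re, Complex.I_im, Complex.one_re, Complex.one_im,
      Complex.norm_ofNat]
    linear_combination (-1 / 4) * e3 - (1 / 2) * e2 - e1
  have h2 : Real.sin (Real.pi * x) ^ 2 = Real.sin (Real.pi * |x - round x|) ^ 2 := by
    have e1 : Real.sin (Real.pi * |x - round x|) ^ 2 = Real.sin (Real.pi * (x - round x)) ^ 2 := by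
      rcases abs_choice (x - round x) with h | h <;> rw [h]
      rw [mul_neg, Real.sin_neg, neg_sq]
    rw [e1, mul_sub, mul_comm Real.pi (round x : ℝ), Real.sin_sub_int_mul_pi, mul_pow]
    rcases Int.even_or_odd (round x) with h | h
    · rw [h.neg_one_zpow]; ring
    · rw [h.neg_one_zpow]; ring
  have h3 := abs_sub_round x
  have h4 := Real.mul_le_sin (x := Real.pi * |x - round x|) (by positivity)
    (by nlinarith [Real.pi_pos])
  have h5 : 2 / Real.pi * (Real.pi * |x - round x|) = 2 * |x - round x| := by
    field_simp [Real.pi_pos.ne']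
  rw [h5] at h4
  rw [h1, h2]
  have h6 : (2 * |x - round x|) ^ 2 ≤ Real.sin (Real.pi * |x - round x|) ^ 2 := by gcongr
  rw [mul_pow, sq_abs] at h6
  linarith

theorem prod_one_add_fourierChar (k : ℝ) (s : Finset ℕ) (c : ℕ → ℝ) :
    ∏ j ∈ s, (1 + (Real.fourierChar (k * c j) : ℂ)) / 2 =
      ((2 : ℂ) ^ s.card)⁻¹ *
        ∑ A ∈ s.powerset, (Real.fourierChar (k * ∑ j ∈ A, c j) : ℂ) := by
  have h : ∀ A : Finset ℕ, (Real.fourierChar (k * ∑ j ∈ A, c j) : ℂ) =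
      ∏ j ∈ A, (Real.fourierChar (k * c j) : ℂ) := by
    intro A
    classical
    induction A using Finset.induction_on with
    | empty => simp
    | insert j A hj ih =>
      rw [Finset.sum_insert hj, Finset.prod_insert hj, mul_add, AddChar.map_add_eq_mul,
        Circle.coe_mul, ih]
  rw [Finset.prod_div_distrib, Finset.prod_const, Finset.prod_one_add, div_eq_inv_mul]
  simp_rw [h]

theorem norm_one_add_fourierChar_le (x : ℝ) :
    ‖(1 + (Real.fourierChar x : ℂ)) / 2‖ ≤ 1 := by
  rw [norm_div, Complex.norm_ofNat, div_le_one two_pos]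
  refine (norm_add_le _ _).trans ?_
  simp [Circle.norm_coe]; norm_num

/-- A product of factors of modulus at most 1 is no larger than any one of them; then 1 - u² ≤ 2(1 -
u). -/
theorem sq_sub_round_le_of_mem (k : ℝ) {s : Finset ℕ} (c : ℕ → ℝ) {j : ℕ} (hj : j ∈ s) :
    2 * (k * c j - round (k * c j)) ^ 2 ≤
      1 - (∏ j ∈ s, (1 + (Real.fourierChar (k * c j) : ℂ)) / 2).re := by
  have h1 := normSq_one_add_fourierChar (k * c j)
  have h2 := norm_one_add_fourierChar_le (k * c j)
  have h3 : ‖∏ j ∈ s, (1 + (Real.fourierChar (k * c j) : ℂ)) / 2‖ ≤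
      ‖(1 + (Real.fourierChar (k * c j) : ℂ)) / 2‖ := by
    rw [← Finset.mul_prod_erase s _ hj, norm_mul]
    refine mul_le_of_le_one_right (norm_nonneg _) ?_
    rw [norm_prod]
    exact Finset.prod_le_one (fun _ _ => norm_nonneg _) fun i _ => norm_one_add_fourierChar_le _
  have h4 := Complex.re_le_norm (∏ j ∈ s, (1 + (Real.fourierChar (k * c j) : ℂ)) / 2)
  nlinarith [norm_nonneg ((1 + (Real.fourierChar (k * c j) : ℂ)) / 2)]

/-- A finite measure whose Fourier transform is close to its value at `0` along all subset sums of
blocks of powers of `φ` is concentrated on the countable set `pisotFrequencies`. -/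
theorem measure_compl_pisotFrequencies_eq_zero {μ : Measure ℝ} [IsFiniteMeasure μ]
    {I : ℕ → Finset ℕ} {ε : ℕ → ℝ} (hε : Summable ε) (hI : ∀ᶠ j in atTop, ∃ n, j ∈ I n)
    (h : ∀ n, ∀ A ⊆ I n,
      ∫ k, (1 - (Real.fourierChar (k * ∑ j ∈ A, Real.goldenRatio ^ j) : ℂ).re) ∂μ ≤ ε n) :
    μ pisotFrequenciesᶜ = 0 := by
  set c : ℕ → ℝ := fun j => Real.goldenRatio ^ j with hc
  -- Expanding the product shows that `a n` is the average over all subsets A of the n-th block of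
  -- the functions in `h`, so its integral is at most `ε n`.
  let a : ℕ → ℝ → ℝ := fun n k => 1 - (∏ j ∈ I n, (1 + (Real.fourierChar (k * c j) : ℂ)) / 2).re
  have hint : ∀ s : ℝ, Integrable (fun k => 1 - (Real.fourierChar (k * s) : ℂ).re) μ := by
    intro s
    refine (integrable_const (2 : ℝ)).mono' (Continuous.aestronglyMeasurable (by fun_prop))
      (Eventually.of_forall fun k => ?_)
    have := Complex.abs_re_le_norm (Real.fourierChar (k * s) : ℂ)
    rw [Circle.norm_coe, abs_le] at this
    rw [Real.norm_eq_abs, abs_le]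
    constructor <;> linarith
  have ha : ∀ n k, a n k = ((2 : ℝ) ^ (I n).card)⁻¹ * ∑ A ∈ (I n).powerset,
      (1 - (Real.fourierChar (k * ∑ j ∈ A, c j) : ℂ).re) := by
    intro n k
    have h2 : ((2 : ℂ) ^ (I n).card)⁻¹ = ((((2 : ℝ) ^ (I n).card)⁻¹ : ℝ) : ℂ) := by push_cast; rfl
    simp only [a, prod_one_add_fourierChar]
    rw [h2, Complex.re_ofReal_mul, Complex.re_sum, Finset.sum_sub_distrib, Finset.sum_const,
      Finset.card_powerset, mul_sub, nsmul_one]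
    push_cast
    rw [inv_mul_cancel₀ (by positivity)]
  have ha0 : ∀ n k, 0 ≤ a n k := by
    intro n k
    have := Complex.re_le_norm (∏ j ∈ I n, (1 + (Real.fourierChar (k * c j) : ℂ)) / 2)
    have h2 : ‖∏ j ∈ I n, (1 + (Real.fourierChar (k * c j) : ℂ)) / 2‖ ≤ 1 := by
      rw [norm_prod]
      exact Finset.prod_le_one (fun _ _ => norm_nonneg _) fun i _ => norm_one_add_fourierChar_le _
    simp only [a]; linarith
  have haint : ∀ n, Integrable (a n) μ := by
    intro n
    rw [show a n = _ from funext (ha n)]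
    exact (integrable_finsetSum _ fun A _ => hint _).const_mul _
  have hale : ∀ n, ∫ k, a n k ∂μ ≤ ε n := by
    intro n
    simp_rw [ha]
    rw [integral_const_mul, integral_finsetSum _ fun A _ => hint _, inv_mul_le_iff₀ (by positivity)]
    refine (Finset.sum_le_card_nsmul _ _ (ε n) fun A hA => h n A (Finset.mem_powerset.mp hA)).trans ?_
    rw [Finset.card_powerset, nsmul_eq_mul]; push_cast; rfl
  -- The integrals are summable, so for almost every k the series of the `a n k` converges and its
  -- terms tend to 0.
  have hsum : ∫⁻ k, ∑' n, ENNReal.ofReal (a n k) ∂μ ≠ ⊤ := by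
    rw [lintegral_tsum fun n => (haint n).aestronglyMeasurable.aemeasurable.ennreal_ofReal]
    refine ne_top_of_le_ne_top hε.tsum_ofReal_ne_top (ENNReal.tsum_le_tsum fun n => ?_)
    rw [← ofReal_integral_eq_lintegral_ofReal (haint n) (Eventually.of_forall (ha0 n))]
    exact ENNReal.ofReal_le_ofReal (hale n)
  have hae : ∀ᵐ k ∂μ, ∑' n, ENNReal.ofReal (a n k) < ⊤ :=
    ae_lt_top' (AEMeasurable.tsum fun n =>
      (haint n).aestronglyMeasurable.aemeasurable.ennreal_ofReal) hsum
  refine measure_mono_null ?_ (ae_iff.mp hae)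
  intro k hk hfin
  refine hk ?_
  have ht := ENNReal.tendsto_cofinite_zero_of_tsum_ne_top hfin.ne
  change Tendsto (fun j : ℕ => k * c j - round (k * c j)) atTop (𝓝 0)
  rw [Metric.tendsto_nhds]
  intro δ hδ
  have hev : ∀ᶠ n in cofinite, ENNReal.ofReal (a n k) < ENNReal.ofReal (2 * δ ^ 2) :=
    ht.eventually_lt_const (by positivity)
  have hfinB : {n | ¬ ENNReal.ofReal (a n k) < ENNReal.ofReal (2 * δ ^ 2)}.Finite := hev
  -- Only finitely many blocks have a large `a n k`; beyond all their elements, j lies in a good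
  -- block.
  filter_upwards [hI, eventually_gt_atTop (hfinB.toFinset.sup fun n => (I n).sup id)]
    with j ⟨n, hn⟩ hj
  have hlt : a n k < 2 * δ ^ 2 := by
    by_contra hcon
    refine absurd hj (not_lt.mpr ?_)
    refine (Finset.le_sup (f := id) hn).trans
      (Finset.le_sup (f := fun n => (I n).sup id) (hfinB.mem_toFinset.mpr ?_))
    exact fun h' => hcon ((ENNReal.ofReal_lt_ofReal_iff (by positivity)).mp h')
  have hle : 2 * (k * c j - round (k * c j)) ^ 2 ≤ a n k := sq_sub_round_le_of_mem k c hn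
  rw [dist_zero_right, Real.norm_eq_abs]
  exact abs_lt_of_sq_lt_sq (by linarith) hδ.le

/-! ## Sums over separated sets -/

/-- A weight with summable values on the integers. -/
noncomputable def weight (x : ℝ) : ℝ := ((1 + |x|) ^ 2)⁻¹

theorem weight_pos (x : ℝ) : 0 < weight x := by unfold weight; positivity

theorem weight_neg (x : ℝ) : weight (-x) = weight x := by simp [weight]

theorem continuous_weight : Continuous weight := by
  unfold weight
  exact Continuous.inv₀ (by fun_prop) fun x => by positivity

/-- The constant comes from cubing 1 + |x|/3 ≤ exp(|x|/3). The decay beyond that of the weight is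
what `tendsto_pairSum_of_decay` uses to cut off tails. -/
theorem exp_neg_abs_le (x : ℝ) : Real.exp (-1 * |x|) ≤ 27 * (1 + |x|)⁻¹ * weight x := by
  have h := Real.add_one_le_exp (|x| / 3)
  have h1 : (1 + |x|) ^ 3 ≤ 27 * Real.exp |x| := by
    have h2 : 1 + |x| ≤ 3 * Real.exp (|x| / 3) := by linarith [abs_nonneg x]
    calc (1 + |x|) ^ 3 ≤ (3 * Real.exp (|x| / 3)) ^ 3 := by gcongr
      _ = 27 * Real.exp |x| := by rw [mul_pow, ← Real.exp_nat_mul]; norm_num; ring_nf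
  have h3 : 27 * (1 + |x|)⁻¹ * weight x = 27 / (1 + |x|) ^ 3 := by
    unfold weight; field_simp
  rw [h3, neg_one_mul, Real.exp_neg, le_div_iff₀ (by positivity), inv_mul_le_iff₀ (Real.exp_pos _)]
  linarith

theorem exp_neg_abs_le_weight (x : ℝ) : Real.exp (-1 * |x|) ≤ 27 * weight x := by
  refine (exp_neg_abs_le x).trans (mul_le_mul_of_nonneg_right ?_ (weight_pos x).le)
  exact mul_le_of_le_one_right (by norm_num) (inv_le_one_of_one_le₀ (by linarith [abs_nonneg x]))

theorem weight_le_floor (x : ℝ) : weight x ≤ 4 * ((1 + |(⌊x⌋ : ℝ)|) ^ 2)⁻¹ := by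
  have h1 : |(⌊x⌋ : ℝ)| ≤ |x| + 1 := by
    have := Int.floor_le x
    have := Int.lt_floor_add_one x
    rw [abs_le]
    constructor <;> cases abs_cases x <;> linarith
  have h2 : (1 + |(⌊x⌋ : ℝ)|) ^ 2 ≤ (2 * (1 + |x|)) ^ 2 := by gcongr; linarith [abs_nonneg x]
  unfold weight
  rw [← div_eq_mul_inv, le_div_iff₀ (by positivity), inv_mul_le_iff₀ (by positivity)]
  linarith

theorem summable_int_weight : Summable fun n : ℤ => 4 * ((1 + |(n : ℝ)|) ^ 2)⁻¹ := by
  refine Summable.mul_left _ ?_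
  have h : Summable fun n : ℕ => ((1 + (n : ℝ)) ^ 2)⁻¹ := by
    have := (summable_nat_add_iff 1).mpr (Real.summable_one_div_nat_pow.mpr one_lt_two)
    refine this.congr fun n => ?_
    push_cast; rw [one_div, add_comm]
  exact Summable.of_nat_of_neg (by simpa using h) (by simpa using h)

/-- The points of `F` have mutual distances at least `1`. -/
def Separated (F : Set ℝ) : Prop := ∀ p ∈ F, ∀ q ∈ F, p ≠ q → 1 ≤ |p - q|

theorem Separated.injOn_floor {F : Set ℝ} (hF : Separated F) (x : ℝ) :
    Set.InjOn (fun p => ⌊p - x⌋) F := by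
  intro p hp q hq hpq
  by_contra hne
  have h := Int.abs_sub_lt_one_of_floor_eq_floor hpq
  rw [sub_sub_sub_cancel_right] at h
  exact absurd h (not_lt.mpr (hF p hp q hq hne))

/-- A bound for the sums of the weight over separated sets. -/
noncomputable def weightBound : ℝ := ∑' n : ℤ, 4 * ((1 + |(n : ℝ)|) ^ 2)⁻¹

theorem weightBound_nonneg : 0 ≤ weightBound := tsum_nonneg fun n => by positivity

/-- Points at mutual distance at least 1 have different integer parts after subtracting x, so the
sum is dominated by one over distinct integers. -/
theorem sum_weight_le {F : Finset ℝ} (hF : Separated F) (x : ℝ) :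
    ∑ p ∈ F, weight (p - x) ≤ weightBound := by
  classical
  calc ∑ p ∈ F, weight (p - x) ≤ ∑ p ∈ F, 4 * ((1 + |(⌊p - x⌋ : ℝ)|) ^ 2)⁻¹ :=
        Finset.sum_le_sum fun p _ => weight_le_floor _
    _ = ∑ n ∈ F.image fun p => ⌊p - x⌋, 4 * ((1 + |(n : ℝ)|) ^ 2)⁻¹ :=
        (Finset.sum_image (f := fun n : ℤ => 4 * ((1 + |(n : ℝ)|) ^ 2)⁻¹)
          (hF.injOn_floor x)).symm
    _ ≤ weightBound := summable_int_weight.sum_le_tsum _ fun n _ => by positivity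

theorem card_le_of_separated {F : Finset ℝ} (hF : Separated F) {R : ℝ} (hR : 1 ≤ R)
    (h : (F : Set ℝ) ⊆ Set.Icc (-R) R) : (F.card : ℝ) ≤ 4 * R := by
  classical
  have h1 : F.card ≤ (Finset.Icc ⌊-R⌋ ⌊R⌋).card := by
    refine Finset.card_le_card_of_injOn (fun p => ⌊p - 0⌋) (fun p hp => ?_) (hF.injOn_floor 0)
    have := h hp
    simp only [sub_zero, Finset.coe_Icc, Set.mem_Icc]
    exact ⟨Int.floor_mono this.1, Int.floor_mono this.2⟩
  rw [Int.card_Icc] at h1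
  have h2 : (F.card : ℤ) ≤ ⌊R⌋ + 1 - ⌊-R⌋ := by
    have : ⌊-R⌋ ≤ ⌊R⌋ := Int.floor_mono (by linarith)
    omega
  have h3 : (F.card : ℝ) ≤ ⌊R⌋ + 1 - ⌊-R⌋ := by exact_mod_cast h2
  have h4 := Int.floor_le R
  have h5 := Int.lt_floor_add_one (-R)
  linarith

/-- The sum of `g` over the differences of the points of `F`. -/
def pairSum (F : Finset ℝ) (g : ℝ → ℝ) : ℝ := ∑ p ∈ F, ∑ q ∈ F, g (p - q)

theorem pairSum_weight_le {F : Finset ℝ} (hF : Separated F) {R : ℝ} (hR : 1 ≤ R)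
    (h : (F : Set ℝ) ⊆ Set.Icc (-R) R) (x : ℝ) :
    (2 * R)⁻¹ * pairSum F (fun y => weight (y - x)) ≤ 2 * weightBound := by
  have h1 : pairSum F (fun y => weight (y - x)) ≤ F.card * weightBound := by
    unfold pairSum
    rw [← nsmul_eq_mul]
    refine Finset.sum_le_card_nsmul _ _ _ fun p _ => ?_
    refine le_trans (le_of_eq ?_) (sum_weight_le hF (p - x))
    refine Finset.sum_congr rfl fun q _ => ?_
    change weight (p - q - x) = _
    rw [← weight_neg (p - q - x)]; congr 1; ring
  rw [inv_mul_le_iff₀ (by positivity)]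
  refine h1.trans ?_
  have := mul_le_mul_of_nonneg_right (card_le_of_separated hF hR h) weightBound_nonneg
  linarith

theorem abs_pairSum_le {F : Finset ℝ} {g h : ℝ → ℝ} (hgh : ∀ x, |g x| ≤ h x) :
    |pairSum F g| ≤ pairSum F h := by
  unfold pairSum
  refine (Finset.abs_sum_le_sum_abs _ _).trans (Finset.sum_le_sum fun p _ => ?_)
  exact (Finset.abs_sum_le_sum_abs _ _).trans (Finset.sum_le_sum fun q _ => hgh _)

theorem pairSum_sub (F : Finset ℝ) (g h : ℝ → ℝ) :
    pairSum F (fun x => g x - h x) = pairSum F g - pairSum F h := by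
  simp [pairSum, Finset.sum_sub_distrib]

theorem pairSum_const_mul (F : Finset ℝ) (c : ℝ) (g : ℝ → ℝ) :
    pairSum F (fun x => c * g x) = c * pairSum F g := by
  simp [pairSum, Finset.mul_sum]

theorem pairSum_add (F : Finset ℝ) (g h : ℝ → ℝ) :
    pairSum F (fun x => g x + h x) = pairSum F g + pairSum F h := by
  simp [pairSum, Finset.sum_add_distrib]

/-! ## The autocorrelation measure -/

/-- A continuous function with values in `[0, 1]` that is `1` on `[-M, M]` and `0` off
`[-(M + 1), M + 1]`. -/
noncomputable def cutoff (M x : ℝ) : ℝ := max 0 (min 1 (M + 1 - |x|))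

theorem continuous_cutoff (M : ℝ) : Continuous (cutoff M) := by unfold cutoff; fun_prop

theorem cutoff_nonneg (M x : ℝ) : 0 ≤ cutoff M x := le_max_left _ _

theorem cutoff_le_one (M x : ℝ) : cutoff M x ≤ 1 := max_le zero_le_one (min_le_left _ _)

theorem cutoff_of_le {M x : ℝ} (h : |x| ≤ M) : cutoff M x = 1 := by
  unfold cutoff
  rw [min_eq_left (by linarith), max_eq_right zero_le_one]

theorem cutoff_of_ge {M x : ℝ} (h : M + 1 ≤ |x|) : cutoff M x = 0 := by
  unfold cutoff
  rw [max_eq_left]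
  exact (min_le_right _ _).trans (by linarith)

theorem hasCompactSupport_cutoff (M : ℝ) : HasCompactSupport (cutoff M) := by
  refine HasCompactSupport.intro (K := Set.Icc (-(M + 1)) (M + 1)) isCompact_Icc fun x hx => ?_
  refine cutoff_of_ge ?_
  by_contra h
  exact hx (abs_le.mp (not_le.mp h).le)

theorem cutoff_one_le_weight (x : ℝ) : cutoff 1 x ≤ 9 * weight x := by
  rcases le_total 2 |x| with h | h
  · rw [cutoff_of_ge (by linarith)]
    have := weight_pos x
    positivity
  · refine (cutoff_le_one _ _).trans ?_
    unfold weight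
    rw [← div_eq_mul_inv, le_div_iff₀ (by positivity)]
    nlinarith [abs_nonneg x]

theorem integrable_weight_of_measure_Icc_le {γ : Measure ℝ} {C : ENNReal} (hC : C ≠ ⊤)
    (h : ∀ n : ℤ, γ (Set.Icc (n : ℝ) (n + 1)) ≤ C) : Integrable weight γ := by
  refine ⟨continuous_weight.aestronglyMeasurable, ?_⟩
  rw [hasFiniteIntegral_iff_ofReal (Eventually.of_forall fun x => (weight_pos x).le),
    ← setLIntegral_univ, ← iUnion_Ico_intCast (α := ℝ),
    lintegral_iUnion (fun n => measurableSet_Ico) (Set.pairwise_disjoint_Ico_intCast ℝ)]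
  have h1 : ∀ n : ℤ, ∫⁻ x in Set.Ico (n : ℝ) (n + 1), ENNReal.ofReal (weight x) ∂γ ≤
      ENNReal.ofReal (4 * ((1 + |(n : ℝ)|) ^ 2)⁻¹) * C := by
    intro n
    calc ∫⁻ x in Set.Ico (n : ℝ) (n + 1), ENNReal.ofReal (weight x) ∂γ
        ≤ ∫⁻ x in Set.Ico (n : ℝ) (n + 1), ENNReal.ofReal (4 * ((1 + |(n : ℝ)|) ^ 2)⁻¹) ∂γ := by
          refine setLIntegral_mono measurable_const fun x hx => ?_
          refine ENNReal.ofReal_le_ofReal ?_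
          have := weight_le_floor x
          rwa [Int.floor_eq_iff.mpr ⟨hx.1, hx.2⟩] at this
      _ = ENNReal.ofReal (4 * ((1 + |(n : ℝ)|) ^ 2)⁻¹) * γ (Set.Ico (n : ℝ) (n + 1)) := by
          rw [setLIntegral_const]
      _ ≤ _ := by
          gcongr
          exact (measure_mono Set.Ico_subset_Icc_self).trans (h n)
  refine lt_of_le_of_lt (ENNReal.tsum_le_tsum h1) ?_
  rw [ENNReal.tsum_mul_right]
  exact ENNReal.mul_lt_top summable_int_weight.tsum_ofReal_lt_top hC.lt_top

/-- The limits form a positive linear functional, which the Riesz–Markov–Kakutani theorem represents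
by a measure. The uniform bound on pair sums of shifted weights bounds the masses of all intervals
[n, n + 1], so the weight is integrable. -/
theorem exists_autocorrelation {S : ℝ → Finset ℝ} (hsep : ∀ R, Separated (S R))
    (hsub : ∀ R, (S R : Set ℝ) ⊆ Set.Icc (-R) R)
    (hlim : ∀ g : ℝ → ℝ, Continuous g → HasCompactSupport g →
      ∃ L, Tendsto (fun R => (2 * R)⁻¹ * pairSum (S R) g) atTop (𝓝 L)) :
    ∃ γ : Measure ℝ, IsLocallyFiniteMeasure γ ∧ Integrable weight γ ∧
      ∀ g : ℝ → ℝ, Continuous g → HasCompactSupport g →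
        Tendsto (fun R => (2 * R)⁻¹ * pairSum (S R) g) atTop (𝓝 (∫ x, g x ∂γ)) := by
  choose! L hL using hlim
  have hL' : ∀ g : CompactlySupportedContinuousMap ℝ ℝ,
      Tendsto (fun R => (2 * R)⁻¹ * pairSum (S R) g) atTop (𝓝 (L g)) :=
    fun g => hL g g.continuous g.hasCompactSupport
  let Λ₀ : CompactlySupportedContinuousMap ℝ ℝ →ₗ[ℝ] ℝ :=
    { toFun := fun g => L g
      map_add' := fun g h => by
        refine tendsto_nhds_unique (hL' (g + h)) (((hL' g).add (hL' h)).congr fun R => ?_)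
        rw [← mul_add, ← pairSum_add]; rfl
      map_smul' := fun c g => by
        refine tendsto_nhds_unique (hL' (c • g)) (((hL' g).const_mul c).congr fun R => ?_)
        rw [mul_left_comm, ← pairSum_const_mul]; rfl }
  let Λ := PositiveLinearMap.mk₀ Λ₀ fun g hg => by
    refine ge_of_tendsto (hL' g) ?_
    filter_upwards [eventually_ge_atTop 0] with R hR
    exact mul_nonneg (by positivity)
      (Finset.sum_nonneg fun p _ => Finset.sum_nonneg fun q _ => hg _)
  have hγ : ∀ g : CompactlySupportedContinuousMap ℝ ℝ,
      ∫ x, g x ∂(RealRMK.rieszMeasure Λ) = L g := fun g => RealRMK.integral_rieszMeasure Λ g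
  refine ⟨RealRMK.rieszMeasure Λ, inferInstance, ?_, fun g hg hg' => ?_⟩
  · refine integrable_weight_of_measure_Icc_le (C := ENNReal.ofReal (9 * (2 * weightBound)))
      ENNReal.ofReal_ne_top fun n => ?_
    let f : CompactlySupportedContinuousMap ℝ ℝ :=
      { toFun := fun x => cutoff 1 (x - n)
        continuous_toFun := (continuous_cutoff 1).comp (by fun_prop)
        hasCompactSupport' :=
          (hasCompactSupport_cutoff 1).comp_homeomorph (Homeomorph.subRight (n : ℝ)) }
    refine (RealRMK.rieszMeasure_le_of_eq_one Λ (f := f) (fun x => cutoff_nonneg _ _)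
      isCompact_Icc fun x hx => ?_).trans (ENNReal.ofReal_le_ofReal ?_)
    · refine cutoff_of_le (abs_le.mpr ⟨?_, ?_⟩) <;> linarith [hx.1, hx.2]
    · refine le_of_tendsto (hL' f) ?_
      filter_upwards [eventually_ge_atTop 1] with R hR
      refine le_trans ?_ (mul_le_mul_of_nonneg_left (pairSum_weight_le (hsep R) hR (hsub R) n)
        (by norm_num : (0 : ℝ) ≤ 9))
      rw [mul_left_comm, ← pairSum_const_mul (S R) 9]
      refine mul_le_mul_of_nonneg_left ((le_abs_self _).trans (abs_pairSum_le fun x => ?_))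
        (by positivity)
      change |cutoff 1 (x - n)| ≤ _
      rw [abs_of_nonneg (cutoff_nonneg _ _)]
      exact cutoff_one_le_weight _
  · have h1 : ∫ x, g x ∂(RealRMK.rieszMeasure Λ) = L g := hγ ⟨⟨g, hg⟩, hg'⟩
    rw [h1]
    exact hL g hg hg'

/-- The limits defining the autocorrelation exist for all functions of sufficient decay. -/
theorem tendsto_pairSum_of_decay {S : ℝ → Finset ℝ} (hsep : ∀ R, Separated (S R))
    (hsub : ∀ R, (S R : Set ℝ) ⊆ Set.Icc (-R) R) {γ : Measure ℝ} (hγ : Integrable weight γ)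
    (hlim : ∀ g : ℝ → ℝ, Continuous g → HasCompactSupport g →
        Tendsto (fun R => (2 * R)⁻¹ * pairSum (S R) g) atTop (𝓝 (∫ x, g x ∂γ)))
    {g : ℝ → ℝ} (hg : Continuous g) {B : ℝ} (hB : ∀ x, |g x| ≤ B * (1 + |x|)⁻¹ * weight x) :
    Tendsto (fun R => (2 * R)⁻¹ * pairSum (S R) g) atTop (𝓝 (∫ x, g x ∂γ)) := by
  have hB0 : 0 ≤ B := by
    have := (abs_nonneg _).trans (hB 0)
    simpa [weight] using this
  have hint : Integrable g γ := by
    refine (hγ.const_mul B).mono' hg.aestronglyMeasurable (Eventually.of_forall fun x => ?_)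
    refine (hB x).trans (mul_le_mul_of_nonneg_right ?_ (weight_pos x).le)
    exact mul_le_of_le_one_right hB0 (inv_le_one_of_one_le₀ (by linarith [abs_nonneg x]))
  have hdiff : ∀ M : ℝ, 0 ≤ M → ∀ x, |g x - g x * cutoff M x| ≤ B / (1 + M) * weight x := by
    intro M hM x
    have e : g x - g x * cutoff M x = g x * (1 - cutoff M x) := by ring
    rcases le_total |x| M with h | h
    · rw [e, cutoff_of_le h, sub_self, mul_zero, abs_zero]
      have := weight_pos x
      positivity
    · have h0 := cutoff_nonneg M x
      have h1 := cutoff_le_one M x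
      rw [e, abs_mul, abs_of_nonneg (by linarith : 0 ≤ 1 - cutoff M x)]
      refine (mul_le_of_le_one_right (abs_nonneg _) (by linarith)).trans ((hB x).trans ?_)
      rw [div_eq_mul_inv]
      have := (weight_pos x).le
      gcongr
  set J := ∫ x, weight x ∂γ
  have hJ : 0 ≤ J := integral_nonneg fun x => (weight_pos x).le
  rw [Metric.tendsto_nhds]
  intro δ hδ
  -- M is chosen so that the tails of the pair sum and of the integral together cost at most δ/2.
  obtain ⟨M, hM0, hM1⟩ : ∃ M : ℝ, 0 ≤ M ∧ B / (1 + M) * (2 * weightBound + J) ≤ δ / 2 := by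
    have hw := weightBound_nonneg
    refine ⟨B * (2 * weightBound + J) / (δ / 2), by positivity, ?_⟩
    rw [div_mul_eq_mul_div, div_le_iff₀ (by positivity)]
    have : δ / 2 * (B * (2 * weightBound + J) / (δ / 2)) = B * (2 * weightBound + J) := by
      field_simp
    linarith
  have hcut := hlim (fun x => g x * cutoff M x) (hg.mul (continuous_cutoff M))
    ((hasCompactSupport_cutoff M).mul_left)
  filter_upwards [Metric.tendsto_nhds.mp hcut (δ / 2) (by positivity), eventually_ge_atTop 1]
    with R hR hR1
  rw [Real.dist_eq] at hR ⊢
  have h1 : |(2 * R)⁻¹ * pairSum (S R) g - (2 * R)⁻¹ * pairSum (S R) (fun x => g x * cutoff M x)|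
      ≤ B / (1 + M) * (2 * weightBound) := by
    rw [← mul_sub, ← pairSum_sub, abs_mul, abs_of_nonneg (by positivity : 0 ≤ (2 * R)⁻¹)]
    refine (mul_le_mul_of_nonneg_left (abs_pairSum_le (hdiff M hM0)) (by positivity)).trans ?_
    rw [pairSum_const_mul, mul_left_comm]
    have := pairSum_weight_le (hsep R) hR1 (hsub R) 0
    simp only [sub_zero] at this
    gcongr
  have h2 : |∫ x, g x ∂γ - ∫ x, g x * cutoff M x ∂γ| ≤ B / (1 + M) * J := by
    have hint' : Integrable (fun x => g x * cutoff M x) γ :=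
      hint.mul_bdd (c := 1) (continuous_cutoff M).aestronglyMeasurable
        (Eventually.of_forall fun x => by
          rw [Real.norm_eq_abs, abs_of_nonneg (cutoff_nonneg _ _)]; exact cutoff_le_one _ _)
    rw [← integral_sub hint hint']
    refine (norm_integral_le_of_norm_le (hγ.const_mul (B / (1 + M)))
      (Eventually.of_forall fun x => (Real.norm_eq_abs _).trans_le (hdiff M hM0 x))).trans ?_
    rw [integral_const_mul]
  rw [mul_add] at hM1
  rw [abs_sub_comm] at h2
  have h3 := abs_sub_le ((2 * R)⁻¹ * pairSum (S R) g)
    ((2 * R)⁻¹ * pairSum (S R) (fun x => g x * cutoff M x)) (∫ x, g x ∂γ)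
  have h4 := abs_sub_le ((2 * R)⁻¹ * pairSum (S R) (fun x => g x * cutoff M x))
    (∫ x, g x * cutoff M x ∂γ) (∫ x, g x ∂γ)
  linarith

-- The smoothed autocorrelation and its Fourier transform

theorem exp_neg_abs_add_le (t x : ℝ) :
    Real.exp (-1 * |t + x|) ≤ Real.exp |t| * Real.exp (-1 * |x|) := by
  rw [← Real.exp_add]
  refine Real.exp_le_exp.mpr ?_
  have := abs_sub_abs_le_abs_sub x (-t)
  rw [abs_neg, sub_neg_eq_add, add_comm x t] at this
  linarith

theorem abs_exp_neg_abs_add_le (t x : ℝ) : |Real.exp (-1 * |t + x|)| ≤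
    (27 * Real.exp |t|) * (1 + |x|)⁻¹ * weight x := by
  rw [abs_of_pos (Real.exp_pos _)]
  refine (exp_neg_abs_add_le t x).trans ?_
  have := mul_le_mul_of_nonneg_left (exp_neg_abs_le x) (Real.exp_pos |t|).le
  linarith

theorem integrable_exp_neg_abs_add {γ : Measure ℝ} (hγ : Integrable weight γ) (t : ℝ) :
    Integrable (fun x => Real.exp (-1 * |t + x|)) γ := by
  refine (hγ.const_mul (27 * Real.exp |t|)).mono' (Continuous.aestronglyMeasurable (by fun_prop))
    (Eventually.of_forall fun x => (abs_exp_neg_abs_add_le t x).trans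
      (mul_le_mul_of_nonneg_right ?_ (weight_pos x).le))
  exact mul_le_of_le_one_right (by positivity) (inv_le_one_of_one_le₀ (by linarith [abs_nonneg x]))

/-- The convolution of a measure with `exp (-|x|)`, up to reflection. -/
noncomputable def smoothed (γ : Measure ℝ) (t : ℝ) : ℝ := ∫ x, Real.exp (-1 * |t + x|) ∂γ

theorem smoothed_add_le {γ : Measure ℝ} (hγ : Integrable weight γ) (s t : ℝ) :
    smoothed γ (s + t) ≤ Real.exp |s| * smoothed γ t := by
  unfold smoothed
  rw [← integral_const_mul]
  refine integral_mono (integrable_exp_neg_abs_add hγ _)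
    ((integrable_exp_neg_abs_add hγ t).const_mul _) fun x => ?_
  simpa only [add_assoc] using exp_neg_abs_add_le s (t + x)

/-- A shift by s changes the value by a factor between exp(-|s|) and exp(|s|). -/
theorem continuous_smoothed {γ : Measure ℝ} (hγ : Integrable weight γ) :
    Continuous (smoothed γ) := by
  rw [continuous_iff_continuousAt]
  intro t
  have h1 : Tendsto (fun s => Real.exp (-|s - t|) * smoothed γ t) (𝓝 t) (𝓝 (smoothed γ t)) := by
    have : Continuous fun s => Real.exp (-|s - t|) * smoothed γ t := by fun_prop
    simpa using this.tendsto t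
  have h2 : Tendsto (fun s => Real.exp |s - t| * smoothed γ t) (𝓝 t) (𝓝 (smoothed γ t)) := by
    have : Continuous fun s => Real.exp |s - t| * smoothed γ t := by fun_prop
    simpa using this.tendsto t
  refine tendsto_of_tendsto_of_tendsto_of_le_of_le h1 h2 (fun s => ?_) fun s => ?_
  · have := smoothed_add_le hγ (t - s) s
    rw [sub_add_cancel, abs_sub_comm] at this
    change Real.exp (-|s - t|) * smoothed γ t ≤ smoothed γ s
    rw [Real.exp_neg, inv_mul_le_iff₀ (Real.exp_pos _)]
    exact this
  · simpa using smoothed_add_le hγ (s - t) t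

/-- The density of the smoothed diffraction of the finite set `F`. -/
noncomputable def periodogram (F : Finset ℝ) (k : ℝ) : ℝ :=
  kernel k * ‖∑ p ∈ F, (Real.fourierChar (k * p) : ℂ)‖ ^ 2

theorem periodogram_nonneg (F : Finset ℝ) (k : ℝ) : 0 ≤ periodogram F k :=
  mul_nonneg (kernel_pos k).le (sq_nonneg _)

theorem continuous_periodogram (F : Finset ℝ) : Continuous (periodogram F) :=
  continuous_kernel.mul (by fun_prop)

theorem ofReal_periodogram (F : Finset ℝ) (k : ℝ) : (periodogram F k : ℂ) =
    ∑ p ∈ F, ∑ q ∈ F, (Real.fourierChar (k * (p - q)) : ℂ) * (kernel k : ℂ) := by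
  have h : ((‖∑ p ∈ F, (Real.fourierChar (k * p) : ℂ)‖ ^ 2 : ℝ) : ℂ) =
      ∑ p ∈ F, ∑ q ∈ F, (Real.fourierChar (k * (p - q)) : ℂ) := by
    rw [Complex.ofReal_pow, ← Complex.mul_conj', map_sum, Finset.sum_mul_sum]
    refine Finset.sum_congr rfl fun p _ => Finset.sum_congr rfl fun q _ => ?_
    rw [mul_sub, sub_eq_add_neg, AddChar.map_add_eq_mul, AddChar.map_neg_eq_inv, Circle.coe_mul,
      Circle.coe_inv_eq_conj]
  rw [periodogram, Complex.ofReal_mul, h, Finset.mul_sum]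
  refine Finset.sum_congr rfl fun p _ => ?_
  rw [Finset.mul_sum]
  exact Finset.sum_congr rfl fun q _ => mul_comm _ _

theorem integrable_fourierChar_mul_kernel (t : ℝ) :
    Integrable fun k => (Real.fourierChar (k * t) : ℂ) * (kernel k : ℂ) :=
  integrable_kernel.ofReal.bdd_mul (c := 1) (Continuous.aestronglyMeasurable (by fun_prop))
    (Eventually.of_forall fun k => by rw [Circle.norm_coe])

theorem integrable_periodogram (F : Finset ℝ) : Integrable (periodogram F) := by
  have h : Integrable fun k => (periodogram F k : ℂ) := by
    simp_rw [ofReal_periodogram]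
    exact integrable_finsetSum _ fun p _ => integrable_finsetSum _ fun q _ =>
      integrable_fourierChar_mul_kernel _
  simpa using h.re

theorem integral_fourierChar_mul_periodogram (F : Finset ℝ) (t : ℝ) :
    ∫ k, (Real.fourierChar (k * t) : ℂ) * (periodogram F k : ℂ) =
      (pairSum F (fun x => Real.exp (-1 * |t + x|)) : ℂ) := by
  have h : ∀ k, (Real.fourierChar (k * t) : ℂ) * (periodogram F k : ℂ) =
      ∑ p ∈ F, ∑ q ∈ F, (Real.fourierChar (k * (t + (p - q))) : ℂ) * (kernel k : ℂ) := by
    intro k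
    rw [ofReal_periodogram, Finset.mul_sum]
    refine Finset.sum_congr rfl fun p _ => ?_
    rw [Finset.mul_sum]
    refine Finset.sum_congr rfl fun q _ => ?_
    rw [mul_add k t, AddChar.map_add_eq_mul, Circle.coe_mul, mul_assoc]
  simp_rw [h]
  rw [integral_finsetSum _ fun p _ => integrable_finsetSum _ fun q _ =>
    integrable_fourierChar_mul_kernel _, pairSum, Complex.ofReal_sum]
  refine Finset.sum_congr rfl fun p _ => ?_
  rw [integral_finsetSum _ fun q _ => integrable_fourierChar_mul_kernel _, Complex.ofReal_sum]
  exact Finset.sum_congr rfl fun q _ => integral_fourierChar_mul_kernel _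

/-- The smoothed autocorrelation is the Fourier transform of a finite measure. -/
theorem exists_fourier_eq_smoothed {S : ℝ → Finset ℝ} (hsep : ∀ R, Separated (S R))
    (hsub : ∀ R, (S R : Set ℝ) ⊆ Set.Icc (-R) R) {γ : Measure ℝ} (hγ : Integrable weight γ)
    (hlim : ∀ g : ℝ → ℝ, Continuous g → HasCompactSupport g →
        Tendsto (fun R => (2 * R)⁻¹ * pairSum (S R) g) atTop (𝓝 (∫ x, g x ∂γ))) :
    ∃ ν : Measure ℝ, IsFiniteMeasure ν ∧
      ∀ t : ℝ, ∫ k, (Real.fourierChar (k * t) : ℂ) ∂ν = (smoothed γ t : ℂ) := by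
  let d : ℕ → ℝ → ℝ := fun n k => (2 * (n : ℝ))⁻¹ * periodogram (S n) k
  have hd : ∀ n k, 0 ≤ d n k := fun n k => mul_nonneg (by positivity) (periodogram_nonneg _ _)
  have hdi : ∀ n, Integrable (d n) := fun n => (integrable_periodogram _).const_mul _
  have hdm : ∀ n, Measurable fun k => ENNReal.ofReal (d n k) := fun n =>
    ((continuous_periodogram _).const_mul _).measurable.ennreal_ofReal
  let μ : ℕ → Measure ℝ := fun n => volume.withDensity fun k => ENNReal.ofReal (d n k)
  have hμ : ∀ n, IsFiniteMeasure (μ n) := fun n =>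
    isFiniteMeasure_withDensity_ofReal (hdi n).hasFiniteIntegral
  -- Characteristic functions carry no 2π in the exponent, hence the argument τ / 2π.
  have hchar : ∀ n τ, charFun (μ n) τ = (((2 * (n : ℝ))⁻¹ *
      pairSum (S n) (fun x => Real.exp (-1 * |τ / (2 * Real.pi) + x|)) : ℝ) : ℂ) := by
    intro n τ
    rw [charFun_apply_real, integral_withDensity_eq_integral_toReal_smul (hdm n)
      (Eventually.of_forall fun k => ENNReal.ofReal_lt_top), Complex.ofReal_mul,
      ← integral_fourierChar_mul_periodogram, ← integral_const_mul]
    refine integral_congr_ae (Eventually.of_forall fun k => ?_)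
    have e : (Real.fourierChar (k * (τ / (2 * Real.pi))) : ℂ) = Complex.exp (τ * k * Complex.I) := by
      rw [Real.fourierChar_apply,
        show 2 * Real.pi * (k * (τ / (2 * Real.pi))) = τ * k by field_simp, Complex.ofReal_mul]
    simp only [ENNReal.toReal_ofReal (hd n k), d, Complex.real_smul, Complex.ofReal_mul, e]
    ring
  obtain ⟨ν, hν, h⟩ := exists_charFun_eq_of_tendsto (μ := μ)
    (G := fun τ => (smoothed γ (τ / (2 * Real.pi)) : ℂ))
    (Complex.continuous_ofReal.comp ((continuous_smoothed hγ).comp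
      (by fun_prop))).continuousAt fun τ => by
      simp_rw [hchar]
      exact (Complex.continuous_ofReal.tendsto _).comp
        ((tendsto_pairSum_of_decay hsep hsub hγ hlim (by fun_prop)
          (abs_exp_neg_abs_add_le _)).comp tendsto_natCast_atTop_atTop)
  refine ⟨ν, hν, fun t => ?_⟩
  have := h (2 * Real.pi * t)
  rw [charFun_apply_real, mul_div_cancel_left₀ _ (by positivity)] at this
  rw [← this]
  refine integral_congr_ae (Eventually.of_forall fun k => ?_)
  simp only [Real.fourierChar_apply]
  push_cast; congr 1; ring

/-- Substituting p - s for p in the second sum cancels every term of the first with p - s in F. Each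
remaining p contributes at most `27 * weightBound` over all q. As many points leave F under
translation by -s as under translation by s. -/
theorem pairSum_sub_shift_le {F : Finset ℝ} (hF : Separated F) (s : ℝ) :
    pairSum F (fun x => Real.exp (-1 * |x|)) - pairSum F (fun x => Real.exp (-1 * |s + x|)) ≤
      27 * weightBound * (F.filter fun p => p + s ∉ F).card := by
  classical
  have hcard : (F.filter fun p => p - s ∉ F).card = (F.filter fun p => p + s ∉ F).card := by
    have h1 := Finset.card_filter_add_card_filter_not (s := F) (fun p => p + s ∈ F)
    have h2 := Finset.card_filter_add_card_filter_not (s := F) (fun p => p - s ∈ F)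
    have h3 : (F.filter fun p => p + s ∈ F).card = (F.filter fun p => p - s ∈ F).card := by
      refine Finset.card_bij (fun p _ => p + s) ?_ ?_ ?_
      · intro p hp
        simp only [Finset.mem_filter, add_sub_cancel_right] at hp ⊢
        exact ⟨hp.2, hp.1⟩
      · intro p _ q _ h
        exact add_right_cancel h
      · intro p hp
        simp only [Finset.mem_filter] at hp ⊢
        exact ⟨p - s, ⟨hp.2, by simpa using hp.1⟩, by ring⟩
    omega
  have hmain : ∀ q ∈ F, ∑ p ∈ F, Real.exp (-1 * |p - q|) -
      ∑ p ∈ F, Real.exp (-1 * |s + (p - q)|) ≤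
        ∑ p ∈ F with p - s ∉ F, 27 * weight (p - q) := by
    intro q _
    have h1 : ∑ p ∈ F with p - s ∈ F, Real.exp (-1 * |p - q|) ≤
        ∑ p ∈ F, Real.exp (-1 * |s + (p - q)|) := by
      calc ∑ p ∈ F with p - s ∈ F, Real.exp (-1 * |p - q|)
          = ∑ p ∈ F with p + s ∈ F, Real.exp (-1 * |s + (p - q)|) := by
            refine Finset.sum_bij' (fun p _ => p - s) (fun p _ => p + s) ?_ ?_ ?_ ?_ ?_
            · intro p hp
              simp only [Finset.mem_filter, sub_add_cancel] at hp ⊢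
              exact ⟨hp.2, hp.1⟩
            · intro p hp
              simp only [Finset.mem_filter, add_sub_cancel_right] at hp ⊢
              exact ⟨hp.2, hp.1⟩
            · intros; ring
            · intros; ring
            · intro p _
              congr 3; ring
        _ ≤ _ := Finset.sum_le_sum_of_subset_of_nonneg (Finset.filter_subset _ _)
            fun _ _ _ => (Real.exp_pos _).le
    have h2 := Finset.sum_filter_add_sum_filter_not F (fun p => p - s ∈ F)
      fun p => Real.exp (-1 * |p - q|)
    have h3 : ∑ p ∈ F with p - s ∉ F, Real.exp (-1 * |p - q|) ≤
        ∑ p ∈ F with p - s ∉ F, 27 * weight (p - q) := Finset.sum_le_sum fun p _ => exp_neg_abs_le_weight _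
    linarith
  unfold pairSum
  rw [Finset.sum_comm, Finset.sum_comm (f := fun p q => Real.exp (-1 * |s + (p - q)|)),
    ← Finset.sum_sub_distrib]
  refine (Finset.sum_le_sum hmain).trans ?_
  rw [Finset.sum_comm, ← hcard, mul_comm, ← nsmul_eq_mul]
  refine Finset.sum_le_card_nsmul _ _ _ fun p _ => ?_
  rw [← Finset.mul_sum]
  refine mul_le_mul_of_nonneg_left (le_trans (le_of_eq ?_) (sum_weight_le hF p)) (by norm_num)
  refine Finset.sum_congr rfl fun q _ => ?_
  rw [← weight_neg, neg_sub]

/-- Passes to the limit in `pairSum_sub_shift_le`; the boundary term C disappears after division by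
2R. -/
theorem smoothed_sub_le {S : ℝ → Finset ℝ} (hsep : ∀ R, Separated (S R))
    (hsub : ∀ R, (S R : Set ℝ) ⊆ Set.Icc (-R) R) {γ : Measure ℝ} (hγ : Integrable weight γ)
    (hlim : ∀ g : ℝ → ℝ, Continuous g → HasCompactSupport g →
        Tendsto (fun R => (2 * R)⁻¹ * pairSum (S R) g) atTop (𝓝 (∫ x, g x ∂γ)))
    {s ε C : ℝ}
    (h : ∀ᶠ R in atTop, (((S R).filter fun p => p + s ∉ S R).card : ℝ) ≤ 2 * R * ε + C) :
    smoothed γ 0 - smoothed γ s ≤ 27 * weightBound * ε := by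
  have h0 := tendsto_pairSum_of_decay hsep hsub hγ hlim (by fun_prop)
          (abs_exp_neg_abs_add_le 0)
  have h1 := tendsto_pairSum_of_decay hsep hsub hγ hlim (by fun_prop)
          (abs_exp_neg_abs_add_le s)
  have h2 : Tendsto (fun R : ℝ => 27 * weightBound * (ε + (2 * R)⁻¹ * C)) atTop
      (𝓝 (27 * weightBound * (ε + 0 * C))) := by
    refine (((tendsto_inv_atTop_zero.comp
      (tendsto_id.const_mul_atTop two_pos)).mul_const C).const_add ε).const_mul _
  rw [zero_mul, add_zero] at h2
  refine le_of_tendsto_of_tendsto (h0.sub h1) h2 ?_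
  filter_upwards [h, eventually_gt_atTop 0] with R hR hR0
  have h3 := pairSum_sub_shift_le (hsep R) s
  simp only [zero_add]
  rw [← mul_sub]
  have hw := weightBound_nonneg
  calc (2 * R)⁻¹ * (pairSum (S R) (fun x => Real.exp (-1 * |x|)) -
        pairSum (S R) (fun x => Real.exp (-1 * |s + x|)))
      ≤ (2 * R)⁻¹ * (27 * weightBound * (2 * R * ε + C)) := by
        gcongr
        exact h3.trans (by gcongr)
    _ = _ := by field_simp

-- Undoing the smoothing

theorem kernel_inv_eq (k : ℝ) : (kernel k)⁻¹ = (1 + 4 * Real.pi ^ 2 * k ^ 2) * 2⁻¹ := by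
  rw [kernel, inv_div, div_eq_mul_inv]

theorem hasTemperateGrowth_kernel_inv :
    Function.HasTemperateGrowth fun k : ℝ => (((kernel k)⁻¹ : ℝ) : ℂ) := by
  simp_rw [kernel_inv_eq]
  fun_prop

/-- The Schwartz function `f / kernel`. -/
noncomputable def divKernel (f : SchwartzMap ℝ ℂ) : SchwartzMap ℝ ℂ :=
  SchwartzMap.smulLeftCLM ℂ (fun k : ℝ => (((kernel k)⁻¹ : ℝ) : ℂ)) f

theorem divKernel_apply (f : SchwartzMap ℝ ℂ) (k : ℝ) :
    divKernel f k = ((kernel k)⁻¹ : ℝ) • f k := by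
  rw [divKernel, SchwartzMap.smulLeftCLM_apply_apply hasTemperateGrowth_kernel_inv]
  simp

theorem hasTemperateGrowth_of_integrable_weight {γ : Measure ℝ} (hγ : Integrable weight γ) :
    γ.HasTemperateGrowth := by
  refine ⟨2, hγ.congr (Eventually.of_forall fun x => ?_)⟩
  simp only [weight, Real.norm_eq_abs]
  rw [← Real.rpow_natCast, ← Real.rpow_neg (by positivity)]

theorem divKernel_eq_integral (f : SchwartzMap ℝ ℂ) (k : ℝ) :
    divKernel f k = ∫ x, (Real.fourierChar (k * x) : ℂ) * 𝓕 (divKernel f) x := by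
  have h : (FourierTransformInv.fourierInv (𝓕 (divKernel f)) : SchwartzMap ℝ ℂ) k =
      divKernel f k := by
    rw [FourierTransform.fourierInv_fourier_eq]
  rw [SchwartzMap.fourierInv_coe, Real.fourierInv_eq] at h
  rw [← h]
  refine integral_congr_ae (Eventually.of_forall fun x => ?_)
  simp [Circle.smul_def]

/-- Since f is the kernel times `divKernel f`, its transform is the convolution of the transform of
`divKernel f` with exp(-|x|). -/
theorem fourier_eq_integral_exp (f : SchwartzMap ℝ ℂ) (y : ℝ) :
    𝓕 (f : ℝ → ℂ) y = ∫ x, 𝓕 (divKernel f) x * (Real.exp (-1 * |x - y|) : ℂ) := by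
  have hf : ∀ k, f k = (kernel k : ℂ) * divKernel f k := by
    intro k
    rw [divKernel_apply, Complex.real_smul, ← mul_assoc, ← Complex.ofReal_mul,
      mul_inv_cancel₀ (kernel_pos k).ne', Complex.ofReal_one, one_mul]
  have h1 : 𝓕 (f : ℝ → ℂ) y = ∫ k, ∫ x, (Real.fourierChar (k * (x - y)) : ℂ) *
      ((kernel k : ℂ) * 𝓕 (divKernel f) x) := by
    rw [Real.fourier_eq]
    refine integral_congr_ae (Eventually.of_forall fun k => ?_)
    simp only
    rw [hf k, divKernel_eq_integral, Circle.smul_def, smul_eq_mul, ← mul_assoc, ← integral_const_mul]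
    refine integral_congr_ae (Eventually.of_forall fun x => ?_)
    have e : (Real.fourierChar (k * (x - y)) : ℂ) =
        (Real.fourierChar (-(inner ℝ k y)) : ℂ) * (Real.fourierChar (k * x) : ℂ) := by
      rw [← Circle.coe_mul, ← AddChar.map_add_eq_mul]
      congr 2
      simp; ring
    simp only [e]
    ring
  rw [h1, integral_integral_swap]
  · refine integral_congr_ae (Eventually.of_forall fun x => ?_)
    simp only
    rw [← integral_fourierChar_mul_kernel, ← integral_const_mul]
    refine integral_congr_ae (Eventually.of_forall fun k => ?_)
    simp only
    ring
  · refine Integrable.bdd_mul (c := 1)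
      (integrable_kernel.ofReal.mul_prod (SchwartzMap.integrable (𝓕 (divKernel f))))
      (Continuous.aestronglyMeasurable (by fun_prop)) (Eventually.of_forall fun k => ?_)
    rw [Circle.norm_coe]

theorem smoothed_neg {γ ν : Measure ℝ}
    (hν : ∀ t : ℝ, ∫ k, (Real.fourierChar (k * t) : ℂ) ∂ν = (smoothed γ t : ℂ)) (t : ℝ) :
    smoothed γ (-t) = smoothed γ t := by
  have h : (smoothed γ (-t) : ℂ) = (starRingEnd ℂ) (smoothed γ t : ℂ) := by
    rw [← hν, ← hν, ← integral_conj]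
    refine integral_congr_ae (Eventually.of_forall fun k => ?_)
    simp only
    rw [mul_neg, AddChar.map_neg_eq_inv, Circle.coe_inv_eq_conj]
  rw [Complex.conj_ofReal] at h
  exact_mod_cast h

/-- Both integrals equal the integral of the transform of `divKernel f` against the smoothed
autocorrelation, by Fubini on either side. The reflection that appears for γ is harmless, since the
smoothed autocorrelation is real and therefore even. -/
theorem isFourierTransformOf_withDensity {γ ν : Measure ℝ} [IsFiniteMeasure ν] [SFinite γ]
    (hγ : Integrable weight γ)
    (hν : ∀ t : ℝ, ∫ k, (Real.fourierChar (k * t) : ℂ) ∂ν = (smoothed γ t : ℂ)) :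
    IsFourierTransformOf (ν.withDensity fun k => ENNReal.ofReal (kernel k)⁻¹) γ := by
  intro f
  have hm : Measurable fun k => ENNReal.ofReal (kernel k)⁻¹ :=
    continuous_kernel.measurable.inv.ennreal_ofReal
  have hfin : ∀ᵐ k ∂ν, ENNReal.ofReal (kernel k)⁻¹ < ⊤ :=
    Eventually.of_forall fun k => ENNReal.ofReal_lt_top
  have hdiv : ∀ k, (ENNReal.ofReal (kernel k)⁻¹).toReal • f k = divKernel f k := by
    intro k
    rw [ENNReal.toReal_ofReal (inv_nonneg.mpr (kernel_pos k).le), divKernel_apply]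
  have := hasTemperateGrowth_of_integrable_weight hγ
  refine ⟨?_, ?_, ?_⟩
  · rw [← SchwartzMap.fourier_coe]
    exact SchwartzMap.integrable _
  · rw [integrable_withDensity_iff_integrable_smul' hm hfin]
    simp_rw [hdiv]
    exact SchwartzMap.integrable _
  rw [integral_withDensity_eq_integral_toReal_smul hm hfin]
  simp_rw [hdiv]
  have hwi : Integrable (𝓕 (divKernel f) : SchwartzMap ℝ ℂ) := SchwartzMap.integrable _
  have hbound : ∀ t, ‖(smoothed γ t : ℂ)‖ ≤ ν.real Set.univ := by
    intro t
    rw [← hν]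
    refine (norm_integral_le_of_norm_le_const (C := 1) (Eventually.of_forall fun k => ?_)).trans ?_
    · rw [Circle.norm_coe]
    · rw [one_mul]
  have h1 : ∫ k, divKernel f k ∂ν = ∫ x, 𝓕 (divKernel f) x * (smoothed γ x : ℂ) := by
    simp_rw [divKernel_eq_integral f]
    rw [integral_integral_swap]
    · refine integral_congr_ae (Eventually.of_forall fun x => ?_)
      simp only
      rw [integral_mul_const, hν, mul_comm]
    · refine Integrable.bdd_mul (c := 1) (hwi.comp_snd ν)
        (Continuous.aestronglyMeasurable (by fun_prop)) (Eventually.of_forall fun k => ?_)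
      rw [Circle.norm_coe]
  have h2 : ∫ y, 𝓕 (f : ℝ → ℂ) y ∂γ = ∫ x, 𝓕 (divKernel f) x * (smoothed γ (-x) : ℂ) := by
    simp_rw [fourier_eq_integral_exp f]
    rw [integral_integral_swap]
    · refine integral_congr_ae (Eventually.of_forall fun x => ?_)
      simp only
      rw [integral_const_mul, integral_complex_ofReal, smoothed]
      congr 2
      refine integral_congr_ae (Eventually.of_forall fun y => ?_)
      simp only
      rw [← abs_neg (x - y)]; congr 3; ring
    · have hc : Continuous (Function.uncurry fun y x : ℝ =>
          𝓕 (divKernel f) x * (Real.exp (-1 * |x - y|) : ℂ)) :=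
        ((𝓕 (divKernel f) : SchwartzMap ℝ ℂ).continuous.comp continuous_snd).mul (by fun_prop)
      have hexp : ∀ x y : ℝ, Real.exp (-1 * |x - y|) = Real.exp (-1 * |-x + y|) := by
        intro x y
        rw [← abs_neg (x - y)]; congr 3; ring
      refine (integrable_prod_iff' hc.aestronglyMeasurable).mpr
        ⟨Eventually.of_forall fun x => ?_, ?_⟩
      · simp only [Function.uncurry_apply_pair, hexp]
        exact (integrable_exp_neg_abs_add hγ (-x)).ofReal.const_mul _
      · have h3 : ∀ x, ∫ y, ‖(Function.uncurry fun y x : ℝ =>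
            𝓕 (divKernel f) x * (Real.exp (-1 * |x - y|) : ℂ)) (y, x)‖ ∂γ =
            ‖𝓕 (divKernel f) x‖ * smoothed γ (-x) := by
          intro x
          rw [smoothed, ← integral_const_mul]
          refine integral_congr_ae (Eventually.of_forall fun y => ?_)
          simp only [Function.uncurry_apply_pair, norm_mul, Complex.norm_real, Real.norm_eq_abs,
            Real.abs_exp, hexp]
        simp_rw [h3]
        refine hwi.norm.mul_bdd (c := ν.real Set.univ)
          ((continuous_smoothed hγ).comp continuous_neg).aestronglyMeasurable
          (Eventually.of_forall fun x => ?_)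
        simpa using hbound (-x)
  rw [h1, h2]
  simp_rw [smoothed_neg hν]

/-- A criterion for pure point diffractivity: the autocorrelation exists, and translating by
subset sums of blocks of powers of `φ` matches the set with itself up to summable densities. -/
theorem isPurePointDiffractive_of_blocks {T : Set ℝ} (hT : Separated T) {S : ℝ → Finset ℝ}
    (hS : ∀ R, (S R : Set ℝ) = T ∩ Set.Icc (-R) R)
    (hlim : ∀ g : ℝ → ℝ, Continuous g → HasCompactSupport g →
      ∃ L, Tendsto (fun R => (2 * R)⁻¹ * pairSum (S R) g) atTop (𝓝 L))
    {I : ℕ → Finset ℕ} {ε : ℕ → ℝ} (hε : Summable ε) (hI : ∀ᶠ j in atTop, ∃ n, j ∈ I n)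
    (h : ∀ n, ∀ A ⊆ I n, ∃ C : ℝ, ∀ᶠ R in atTop,
      (((S R).filter fun p => p + ∑ j ∈ A, Real.goldenRatio ^ j ∉ S R).card : ℝ) ≤
        2 * R * ε n + C) :
    IsPurePointDiffractive T := by
  have hsep : ∀ R, Separated (S R) := fun R p hp q hq => by
    rw [hS] at hp hq
    exact hT p hp.1 q hq.1
  have hsub : ∀ R, (S R : Set ℝ) ⊆ Set.Icc (-R) R := fun R => by
    rw [hS]; exact Set.inter_subset_right
  obtain ⟨γ, hγ, hγw, hγlim⟩ := exists_autocorrelation hsep hsub hlim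
  obtain ⟨ν, hν, hνγ⟩ := exists_fourier_eq_smoothed hsep hsub hγw hγlim
  refine ⟨γ, _, ⟨hγ, fun g hg hg' => ?_⟩, isFourierTransformOf_withDensity hγw hνγ,
    pisotFrequencies, countable_pisotFrequencies, ?_⟩
  · refine (hγlim g hg hg').congr fun R => ?_
    rw [← hS, ← Finset.coe_product, finsum_mem_coe_finset, Finset.sum_product]
    rfl
  -- The diffraction measure has a density with respect to ν, so it inherits the null set.
  · refine withDensity_absolutelyContinuous _ _ ?_
    refine measure_compl_pisotFrequencies_eq_zero (hε.mul_left (27 * weightBound)) hI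
      fun n A hA => ?_
    obtain ⟨C, hC⟩ := h n A hA
    refine le_trans (le_of_eq ?_) (smoothed_sub_le hsep hsub hγw hγlim hC)
    have hint : ∀ s : ℝ, Integrable (fun k => (Real.fourierChar (k * s) : ℂ)) ν := fun s =>
      (integrable_const (1 : ℝ)).mono' (Continuous.aestronglyMeasurable (by fun_prop))
        (Eventually.of_forall fun k => by rw [Circle.norm_coe])
    have hre : ∀ s : ℝ, ∫ k, (Real.fourierChar (k * s) : ℂ).re ∂ν = smoothed γ s := fun s => by
      have := integral_re (hint s)
      rw [hνγ s] at this
      simpa using this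
    have hint' : Integrable (fun k => (Real.fourierChar
        (k * ∑ j ∈ A, Real.goldenRatio ^ j) : ℂ).re) ν := (hint _).re
    rw [integral_sub (integrable_const 1) hint', hre, ← hre 0]
    simp

/-! ## End points of words -/

/-- The left end points of the tiles of the word `w` if the first tile starts at `t`. -/
noncomputable def ends (t : ℝ) : List Letter → Finset ℝ
  | [] => ∅
  | x :: w => insert t (ends (t + tileLength Real.goldenRatio 1 x) w)

@[simp] theorem ends_nil (t : ℝ) : ends t [] = ∅ := rfl

theorem ends_cons (t : ℝ) (x : Letter) (w : List Letter) :
    ends t (x :: w) = insert t (ends (t + tileLength Real.goldenRatio 1 x) w) := rfl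

theorem ends_append (t : ℝ) (u w : List Letter) :
    ends t (u ++ w) = ends t u ∪ ends (t + len u) w := by
  induction u generalizing t with
  | nil => simp
  | cons x u ih =>
    rw [List.cons_append, ends_cons, ih, ends_cons, Finset.insert_union, len_cons, add_assoc]

theorem le_of_mem_ends {t p : ℝ} {w : List Letter} (h : p ∈ ends t w) :
    t ≤ p ∧ p + 1 ≤ t + len w := by
  induction w generalizing t with
  | nil => simp at h
  | cons x w ih =>
    have hx := one_le_tileLength x
    rw [ends_cons, Finset.mem_insert] at h
    rw [len_cons]
    rcases h with rfl | h
    · constructor <;> linarith [len_nonneg w]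
    · have := ih h
      constructor <;> linarith

theorem ends_add (s t : ℝ) (w : List Letter) :
    ends (s + t) w = (ends t w).map (addLeftEmbedding s) := by
  induction w generalizing t with
  | nil => simp
  | cons x w ih => rw [ends_cons, ends_cons, Finset.map_insert, ← ih, add_assoc]; rfl

theorem ends_eq_map (t : ℝ) (w : List Letter) :
    ends t w = (ends 0 w).map (addLeftEmbedding t) := by rw [← ends_add, add_zero]

theorem disjoint_ends (t : ℝ) (u w : List Letter) :
    Disjoint (ends t u) (ends (t + len u) w) := by
  rw [Finset.disjoint_left]
  intro p h1 h2
  linarith [(le_of_mem_ends h1).2, (le_of_mem_ends h2).1]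

theorem card_ends (t : ℝ) (w : List Letter) : (ends t w).card = w.length := by
  induction w generalizing t with
  | nil => simp
  | cons x w ih =>
    rw [ends_cons, Finset.card_insert_of_notMem, ih, List.length_cons]
    intro h
    linarith [(le_of_mem_ends h).1, one_le_tileLength x]

theorem separated_ends (t : ℝ) (w : List Letter) : Separated (ends t w) := by
  induction w generalizing t with
  | nil => intro p hp; simp at hp
  | cons x w ih =>
    intro p hp q hq hne
    have hx := one_le_tileLength x
    rw [Finset.mem_coe, ends_cons, Finset.mem_insert] at hp hq
    rcases hp with rfl | hp <;> rcases hq with rfl | hq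
    · exact absurd rfl hne
    · have := (le_of_mem_ends hq).1
      rw [abs_sub_comm]
      exact le_trans (by linarith) (le_abs_self _)
    · have := (le_of_mem_ends hp).1
      exact le_trans (by linarith) (le_abs_self _)
    · exact ih _ p hp q hq hne

theorem pairSum_map (F : Finset ℝ) (s : ℝ) (g : ℝ → ℝ) :
    pairSum (F.map (addLeftEmbedding s)) g = pairSum F g := by
  simp [pairSum, Finset.sum_map]

/-! ## Almost additive functions of words -/

/-- `X` is additive under concatenation up to a bounded error. -/
def AlmostAdditive (X : List Letter → ℝ) (C : ℝ) : Prop :=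
  X [] = 0 ∧ ∀ u w, |X (u ++ w) - (X u + X w)| ≤ C

/-- The error counts pairs on opposite sides of the junction. There |p - q| is the sum of the
distances of p and q to the junction, so an exponential bound for g factors into two bounded sums
over separated sets. -/
theorem almostAdditive_pairSum {g : ℝ → ℝ} (hg : Continuous g) (hg' : HasCompactSupport g) :
    ∃ C, AlmostAdditive (fun w => pairSum (ends 0 w) g) C := by
  obtain ⟨B, hB⟩ := (hg'.mul_right (f' := fun x => Real.exp |x|)).exists_bound_of_continuous
    (hg.mul (by fun_prop))
  have hB' : ∀ x, |g x| ≤ B * Real.exp (-1 * |x|) := by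
    intro x
    have := hB x
    rw [Real.norm_eq_abs, Pi.mul_apply, abs_mul, Real.abs_exp] at this
    rw [neg_one_mul, Real.exp_neg, ← div_eq_mul_inv, le_div_iff₀ (Real.exp_pos _)]
    exact this
  have hB0 : 0 ≤ B := (norm_nonneg _).trans (hB 0)
  have hone : ∀ {F : Finset ℝ}, Separated F → ∀ b, ∑ p ∈ F, Real.exp (-1 * |p - b|) ≤
      27 * weightBound := by
    intro F hF b
    refine (Finset.sum_le_sum fun p _ => exp_neg_abs_le_weight (p - b)).trans ?_
    rw [← Finset.mul_sum]
    exact mul_le_mul_of_nonneg_left (sum_weight_le hF b) (by norm_num)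
  refine ⟨2 * (B * (27 * weightBound) ^ 2), by simp [pairSum], fun u w => ?_⟩
  set U := ends 0 u
  set W := ends (len u) w
  have hW : pairSum (ends 0 w) g = pairSum W g := by
    rw [show W = _ from ends_eq_map (len u) w, pairSum_map]
  have hd : Disjoint U W := by simpa using disjoint_ends 0 u w
  have hU : ends 0 (u ++ w) = U ∪ W := by rw [ends_append, zero_add]
  have hcross : ∀ h : ℝ → ℝ, (∀ x, |h x| ≤ B * Real.exp (-1 * |x|)) →
      |∑ p ∈ U, ∑ q ∈ W, h (p - q)| ≤ B * (27 * weightBound) ^ 2 := by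
    intro h hh
    calc |∑ p ∈ U, ∑ q ∈ W, h (p - q)|
        ≤ ∑ p ∈ U, ∑ q ∈ W, |h (p - q)| := (Finset.abs_sum_le_sum_abs _ _).trans
          (Finset.sum_le_sum fun p _ => Finset.abs_sum_le_sum_abs _ _)
      _ ≤ ∑ p ∈ U, ∑ q ∈ W,
          B * (Real.exp (-1 * |p - len u|) * Real.exp (-1 * |q - len u|)) := by
          refine Finset.sum_le_sum fun p hp => Finset.sum_le_sum fun q hq => ?_
          refine (hh _).trans_eq ?_
          have h1 := (le_of_mem_ends hp).2
          have h2 := (le_of_mem_ends hq).1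
          rw [← Real.exp_add, abs_of_nonpos (by linarith), abs_of_nonpos (by linarith),
            abs_of_nonneg (by linarith)]
          congr 2; ring
      _ = B * ((∑ p ∈ U, Real.exp (-1 * |p - len u|)) *
          ∑ q ∈ W, Real.exp (-1 * |q - len u|)) := by
          rw [Finset.sum_mul_sum, Finset.mul_sum]
          exact Finset.sum_congr rfl fun p _ => by rw [Finset.mul_sum]
      _ ≤ B * (27 * weightBound) ^ 2 := by
          rw [sq]
          have := weightBound_nonneg
          refine mul_le_mul_of_nonneg_left (mul_le_mul (hone (separated_ends _ _) _)
            (hone (separated_ends _ _) _)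
            (Finset.sum_nonneg fun _ _ => (Real.exp_pos _).le) (by positivity)) hB0
  have h1 := hcross g hB'
  have h2 := hcross (fun x => g (-x)) fun x => by simpa using hB' (-x)
  have h3 : pairSum (U ∪ W) g - (pairSum U g + pairSum W g) =
      ∑ p ∈ U, ∑ q ∈ W, g (p - q) + ∑ p ∈ U, ∑ q ∈ W, g (-(p - q)) := by
    unfold pairSum
    rw [Finset.sum_union hd, Finset.sum_congr rfl fun p _ => Finset.sum_union hd,
      Finset.sum_congr (s₁ := W) rfl fun p _ => Finset.sum_union hd, Finset.sum_add_distrib,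
      Finset.sum_add_distrib, Finset.sum_comm (s := W) (t := U)]
    simp only [neg_sub]
    ring
  simp only
  rw [hU, hW, h3]
  refine (abs_add_le _ _).trans ?_
  linarith

theorem AlmostAdditive.nonneg {X : List Letter → ℝ} {C : ℝ} (h : AlmostAdditive X C) : 0 ≤ C :=
  (abs_nonneg _).trans (h.2 [] [])

theorem AlmostAdditive.flatMap {X : List Letter → ℝ} {C : ℝ} (h : AlmostAdditive X C)
    (f : Letter → List Letter) (v : List Letter) :
    |X (v.flatMap f) - (v.count .a * X (f .a) + v.count .b * X (f .b))| ≤ C * v.length := by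
  induction v with
  | nil => simp [h.1]
  | cons x v ih =>
    have h1 := h.2 (f x) (v.flatMap f)
    rw [List.flatMap_cons, List.length_cons]
    have e : ((x :: v).count .a : ℝ) * X (f .a) + (x :: v).count .b * X (f .b) =
        X (f x) + (v.count .a * X (f .a) + v.count .b * X (f .b)) := by
      cases x <;> simp <;> ring
    rw [e]
    rw [abs_le] at *
    push_cast
    constructor <;> linarith [ih.1, ih.2, h1.1, h1.2]

theorem AlmostAdditive.exists_abs_le {X : List Letter → ℝ} {C : ℝ} (h : AlmostAdditive X C) :
    ∃ B, 0 ≤ B ∧ ∀ w, |X w| ≤ B * w.length := by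
  have hC := h.nonneg
  refine ⟨C + |X [.a]| + |X [.b]|, by positivity, fun w => ?_⟩
  induction w with
  | nil => simp [h.1]
  | cons x w ih =>
    have h1 := h.2 [x] w
    have h2 : |X [x]| ≤ |X [.a]| + |X [.b]| := by
      cases x <;> simp
    rw [List.singleton_append] at h1
    rw [List.length_cons]
    push_cast
    have h3 := abs_add_le (X (x :: w) - (X [x] + X w)) (X [x] + X w)
    have h4 := abs_add_le (X [x]) (X w)
    rw [sub_add_cancel] at h3
    linarith

/-! ## Means of almost additive functions -/

/-- By irrationality of φ, a length determines both letter counts. Hence scrambling and rearranging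
are invisible to everything that depends on counts only. -/
theorem count_eq_of_len_eq {u w : List Letter} (h : len u = len w) (x : Letter) :
    u.count x = w.count x := by
  rw [len_eq_count, len_eq_count] at h
  have ha : u.count .a = w.count .a := by
    by_contra hne
    have hne' : ((u.count .a : ℤ) - w.count .a : ℤ) ≠ 0 := by omega
    have hne'' : ((u.count .a : ℝ) - w.count .a) ≠ 0 := by exact_mod_cast hne'
    refine Real.goldenRatio_irrational
      ⟨((w.count .b : ℤ) - u.count .b : ℤ) / ((u.count .a : ℤ) - w.count .a : ℤ), ?_⟩
    push_cast
    rw [div_eq_iff hne'']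
    linarith
  rw [ha] at h
  cases x
  · exact ha
  · have : (u.count .b : ℝ) = w.count .b := by linarith
    exact_mod_cast this

theorem tendsto_fib_div_pow :
    Tendsto (fun k : ℕ => (k.fib : ℝ) / Real.goldenRatio ^ k) atTop (𝓝 (1 / √5)) := by
  have h1 : ∀ k : ℕ, (k.fib : ℝ) / Real.goldenRatio ^ k =
      (1 - (Real.goldenConj / Real.goldenRatio) ^ k) / √5 := by
    intro k
    have := Real.goldenRatio_pos
    rw [Real.coe_fib_eq, div_pow Real.goldenConj]
    generalize Real.goldenRatio = g at *
    generalize Real.goldenConj = c at *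
    field_simp
  simp_rw [h1]
  have h2 : |Real.goldenConj / Real.goldenRatio| < 1 := by
    rw [abs_div, abs_of_neg Real.goldenConj_neg, abs_of_pos Real.goldenRatio_pos,
      div_lt_one Real.goldenRatio_pos]
    linarith [Real.neg_one_lt_goldenConj, Real.one_lt_goldenRatio]
  simpa using ((tendsto_pow_atTop_nhds_zero_of_abs_lt_one h2).const_sub 1).div_const √5

/-- Binet's formula. The limit is a product of the two tile lengths; the factor belonging to x makes
densities proportional to length in the end. -/
theorem tendsto_count_fibPow (x y : Letter) :
    Tendsto (fun k : ℕ => ((fibPow k x).count y : ℝ) / Real.goldenRatio ^ k) atTop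
      (𝓝 (tileLength Real.goldenRatio 1 x * tileLength Real.goldenRatio 1 y /
        (Real.goldenRatio * √5))) := by
  have hφ := Real.goldenRatio_pos
  have h5 : (0 : ℝ) < √5 := by positivity
  have h0 := tendsto_fib_div_pow
  have h1 : Tendsto (fun k : ℕ => ((k + 1).fib : ℝ) / Real.goldenRatio ^ k) atTop
      (𝓝 (Real.goldenRatio * (1 / √5))) := by
    refine ((h0.comp (tendsto_add_atTop_nat 1)).const_mul Real.goldenRatio).congr fun k => ?_
    simp only [Function.comp]
    generalize Real.goldenRatio = g at *
    field_simp
    ring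
  cases x
  · cases y
    · simp_rw [(count_fibPow _).1]
      convert! h1 using 2
      simp only [tileLength]; field_simp
    · simp_rw [(count_fibPow _).2.1]
      convert! h0 using 2
      simp only [tileLength]; field_simp
  · refine (tendsto_add_atTop_iff_nat 1).mp ?_
    cases y
    · simp_rw [(count_fibPow _).2.2.1]
      convert! h0.comp (tendsto_add_atTop_nat 1) using 2
      simp only [tileLength]; field_simp
    · simp_rw [(count_fibPow _).2.2.2]
      refine ((h0.const_mul (1 / Real.goldenRatio)).congr fun k => ?_).trans_eq ?_
      · generalize Real.goldenRatio = g at *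
        field_simp
        ring
      · congr 1
        simp only [tileLength]; field_simp

theorem tendsto_sub_zero {N : ℕ → ℕ} (hN : StrictMono N) (n : ℕ) :
    Tendsto (fun m => (N m - N 0) - (N n - N 0)) atTop atTop := by
  refine tendsto_atTop_mono (fun m => ?_) (tendsto_sub_atTop_nat (N n - N 0))
  have := le_sub_zero hN m
  omega

theorem sub_zero_mono {N : ℕ → ℕ} (hN : StrictMono N) {n m : ℕ} (h : n ≤ m) :
    N n - N 0 ≤ N m - N 0 := by
  have := hN.monotone h
  omega

/-- The value of `X` on superletters, per unit of length. -/
noncomputable def density (N : ℕ → ℕ) (X : List Letter → ℝ) (n : ℕ) (x : Letter) : ℝ :=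
  X (word N n (some x)) / Real.goldenRatio ^ (N n - N 0)

/-- S_m(x) is composed of superletters of level n whose numbers are those of a and b in σ^k(x),
because the lengths agree. There are at most 2φ^k junctions, each costing C. -/
theorem AlmostAdditive.density_sub_le {N : ℕ → ℕ} (hN : StrictMono N) {X : List Letter → ℝ}
    {C : ℝ} (hX : AlmostAdditive X C) {n m : ℕ} (hn : Even n) (hm : n + 1 ≤ m) (x : Letter) :
    let k := (N m - N 0) - (N n - N 0)
    |density N X m x - (((fibPow k x).count .a : ℝ) / Real.goldenRatio ^ k * density N X n .a +
      ((fibPow k x).count .b : ℝ) / Real.goldenRatio ^ k * density N X n .b)| ≤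
      2 * C / Real.goldenRatio ^ (N n - N 0) := by
  intro k
  have hφ := Real.goldenRatio_pos
  obtain ⟨v, hv⟩ := exists_compose_eq_word N hn hm (some x)
  have hk : N m - N 0 = k + (N n - N 0) := by
    have := sub_zero_mono hN (by omega : n ≤ m)
    omega
  have hlen : len v = len (fibPow k x) := by
    have h1 := len_word hN m (some x)
    rw [hv, len_compose hN, hk, pow_add, toLetter_some] at h1
    rw [len_fibPow]
    have : Real.goldenRatio ^ (N n - N 0) ≠ 0 := by positivity
    apply mul_left_cancel₀ this
    rw [h1]; ring
  have hvl : (v.length : ℝ) ≤ 2 * Real.goldenRatio ^ k := by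
    refine (length_le_len v).trans ?_
    rw [hlen, len_fibPow, mul_comm]
    exact mul_le_mul_of_nonneg_right (tileLength_le_two x) (by positivity)
  have h2 := hX.flatMap (fun y => word N n (some y)) v
  change |X (compose N n v) - _| ≤ _ at h2
  rw [← hv, count_eq_of_len_eq hlen .a, count_eq_of_len_eq hlen .b] at h2
  have h3 : density N X m x - (((fibPow k x).count .a : ℝ) / Real.goldenRatio ^ k *
      density N X n .a + ((fibPow k x).count .b : ℝ) / Real.goldenRatio ^ k * density N X n .b) =
      (X (word N m (some x)) - ((fibPow k x).count .a * X (word N n (some .a)) +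
        (fibPow k x).count .b * X (word N n (some .b)))) /
        (Real.goldenRatio ^ k * Real.goldenRatio ^ (N n - N 0)) := by
    simp only [density, hk, pow_add]
    field_simp
  rw [h3, abs_div, abs_of_pos (by positivity :
    0 < Real.goldenRatio ^ k * Real.goldenRatio ^ (N n - N 0)),
    div_le_div_iff₀ (by positivity) (by positivity)]
  have h4 := mul_le_mul_of_nonneg_left hvl hX.nonneg
  calc _ ≤ C * (2 * Real.goldenRatio ^ k) * Real.goldenRatio ^ (N n - N 0) :=
        mul_le_mul_of_nonneg_right (h2.trans h4) (by positivity)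
    _ = _ := by ring

theorem AlmostAdditive.eventually_density_sub_le {N : ℕ → ℕ} (hN : StrictMono N)
    {X : List Letter → ℝ} {C : ℝ} (hX : AlmostAdditive X C) {n : ℕ} (hn : Even n) :
    ∃ Q : ℝ, ∀ x, ∀ᶠ m in atTop, |density N X m x - Q * tileLength Real.goldenRatio 1 x| ≤
      (2 * C + 1) / Real.goldenRatio ^ (N n - N 0) := by
  have hφ := Real.goldenRatio_pos
  refine ⟨(Real.goldenRatio * density N X n .a + density N X n .b) / (Real.goldenRatio * √5),
    fun x => ?_⟩
  have h1 := (((tendsto_count_fibPow x .a).mul_const (density N X n .a)).add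
    ((tendsto_count_fibPow x .b).mul_const (density N X n .b))).comp (tendsto_sub_zero hN n)
  have h2 : 0 < 1 / Real.goldenRatio ^ (N n - N 0) := by positivity
  filter_upwards [Metric.tendsto_nhds.mp h1 _ h2, eventually_ge_atTop (n + 1)] with m h3 h4
  have h5 := hX.density_sub_le hN hn h4 x
  rw [Real.dist_eq] at h3
  simp only [Function.comp] at h3 h5
  have h6 := abs_sub_le (density N X m x) _
    ((Real.goldenRatio * density N X n .a + density N X n .b) / (Real.goldenRatio * √5) *
      tileLength Real.goldenRatio 1 x) |>.trans (add_le_add h5 (le_trans (le_of_eq ?_) h3.le))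
  · rw [add_div (2 * C)]; exact h6
  · congr 2
    simp only [tileLength]; ring

theorem tendsto_inv_pow_sub_zero {N : ℕ → ℕ} (hN : StrictMono N) (D : ℝ) :
    Tendsto (fun n => D / Real.goldenRatio ^ (N n - N 0)) atTop (𝓝 0) := by
  have h1 : Tendsto (fun n => N n - N 0) atTop atTop :=
    tendsto_atTop_mono (le_sub_zero hN) tendsto_id
  exact ((tendsto_pow_atTop_atTop_of_one_lt Real.one_lt_goldenRatio).comp h1).const_div_atTop D

/-- At each even level n the densities eventually lie within O(φ^(-N(n))) of a constant Q_n times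
the tile length. This makes the density at b Cauchy, and the same limit serves for a. -/
theorem AlmostAdditive.exists_mean {N : ℕ → ℕ} (hN : StrictMono N) {X : List Letter → ℝ} {C : ℝ}
    (hX : AlmostAdditive X C) : ∃ Z : ℝ, ∀ x,
      Tendsto (fun m => density N X m x) atTop (𝓝 (Z * tileLength Real.goldenRatio 1 x)) := by
  choose! Q hQ using fun n hn => hX.eventually_density_sub_le hN (n := n) hn
  have hsmall : ∀ ε : ℝ, 0 < ε → ∃ n, Even n ∧
      (2 * C + 1) / Real.goldenRatio ^ (N n - N 0) < ε := by
    intro ε hε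
    obtain ⟨n, hn⟩ := eventually_atTop.mp
      ((tendsto_inv_pow_sub_zero hN (2 * C + 1)).eventually_lt_const hε)
    exact ⟨2 * n, even_two_mul n, hn _ (by omega)⟩
  have hcauchy : CauchySeq fun m => density N X m .b := by
    refine Metric.cauchySeq_iff'.mpr fun ε hε => ?_
    obtain ⟨n, hn, hlt⟩ := hsmall (ε / 2) (by positivity)
    obtain ⟨M, hM⟩ := eventually_atTop.mp (hQ n hn .b)
    refine ⟨M, fun m hm => ?_⟩
    have h1 := hM m hm
    have h2 := hM M le_rfl
    rw [abs_sub_comm] at h2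
    rw [Real.dist_eq]
    exact (abs_sub_le _ _ _).trans_lt (by linarith)
  obtain ⟨Z, hZ⟩ := cauchySeq_tendsto_of_complete hcauchy
  refine ⟨Z, fun x => ?_⟩
  rw [Metric.tendsto_nhds]
  intro ε hε
  obtain ⟨n, hn, hlt⟩ := hsmall (ε / 4) (by positivity)
  have h1 : |Z - Q n| ≤ (2 * C + 1) / Real.goldenRatio ^ (N n - N 0) := by
    refine le_of_tendsto ((hZ.sub_const (Q n)).abs) ((hQ n hn .b).mono fun m hm => ?_)
    simpa [tileLength] using hm
  filter_upwards [hQ n hn x] with m hm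
  have h2 : |Q n * tileLength Real.goldenRatio 1 x - Z * tileLength Real.goldenRatio 1 x| ≤
      ((2 * C + 1) / Real.goldenRatio ^ (N n - N 0)) * 2 := by
    rw [← sub_mul, abs_mul, abs_sub_comm,
      abs_of_pos (zero_lt_one.trans_le (one_le_tileLength x))]
    exact mul_le_mul h1 (tileLength_le_two x) (zero_le_one.trans (one_le_tileLength x))
      ((abs_nonneg _).trans h1)
  rw [Real.dist_eq]
  exact (abs_sub_le _ _ _).trans_lt (by linarith)

/-- A window is cut into superletters of a fixed even level so high that the deviation of their
densities and the junction errors each cost ε/2 per unit length. The two incomplete ends go into C',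
uniformly in the window. -/
theorem AlmostAdditive.exists_window_mean {N : ℕ → ℕ} (hN : StrictMono N) {ξ : ℤ → Letter}
    (hξ : ξ ∈ sequenceSpace N) {X : List Letter → ℝ} {C : ℝ} (hX : AlmostAdditive X C) :
    ∃ Z : ℝ, ∀ ε : ℝ, 0 < ε → ∃ C' : ℝ, ∀ i m,
      |X (window ξ i m) - Z * len (window ξ i m)| ≤ ε * len (window ξ i m) + C' := by
  obtain ⟨Z, hZ⟩ := hX.exists_mean hN
  obtain ⟨B, hB0, hB⟩ := hX.exists_abs_le
  have hC := hX.nonneg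
  refine ⟨Z, fun ε hε => ?_⟩
  have hev := fun x => (Metric.tendsto_nhds.mp (hZ x) (ε / 2) (by positivity))
  obtain ⟨n, ⟨hna, hnb⟩, hnC⟩ := eventually_atTop.mp (((hev .a).and (hev .b)).and
    ((tendsto_inv_pow_sub_zero hN C).eventually_lt_const (by positivity : 0 < ε / 2))) |>.imp
      fun n hn => hn (2 * n) (by omega)
  have hφ : 0 < Real.goldenRatio ^ (N (2 * n) - N 0) := pow_pos Real.goldenRatio_pos _
  have hx : ∀ x, |X (word N (2 * n) (some x)) - Z * (Real.goldenRatio ^ (N (2 * n) - N 0) *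
      tileLength Real.goldenRatio 1 x)| ≤ ε / 2 * (Real.goldenRatio ^ (N (2 * n) - N 0) *
      tileLength Real.goldenRatio 1 x) := by
    intro x
    have h : dist (density N X (2 * n) x) (Z * tileLength Real.goldenRatio 1 x) < ε / 2 := by
      cases x <;> assumption
    rw [Real.dist_eq, density, div_sub' hφ.ne', abs_div, abs_of_pos hφ, div_lt_iff₀ hφ] at h
    have e : Z * (Real.goldenRatio ^ (N (2 * n) - N 0) * tileLength Real.goldenRatio 1 x) =
      Real.goldenRatio ^ (N (2 * n) - N 0) * (Z * tileLength Real.goldenRatio 1 x) := by ring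
    rw [e]
    refine h.le.trans ?_
    have := mul_le_mul_of_nonneg_left (one_le_tileLength x)
      (by positivity : 0 ≤ ε / 2 * Real.goldenRatio ^ (N (2 * n) - N 0))
    linarith
  obtain ⟨L, hL⟩ : ∃ L : ℝ, L = ((maxLength N (2 * n) : ℕ) : ℝ) := ⟨_, rfl⟩
  refine ⟨2 * C + 2 * B * L + 4 * |Z| * L, fun i m => ?_⟩
  obtain ⟨s, w, p, h, hs, hp⟩ := exists_window_eq hN hξ (even_two_mul n) i m
  have hs' : (s.length : ℝ) ≤ L := by rw [hL]; exact_mod_cast hs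
  have hp' : (p.length : ℝ) ≤ L := by rw [hL]; exact_mod_cast hp
  have hw : |X (compose N (2 * n) w) - Z * len (compose N (2 * n) w)| ≤
      ε * len (compose N (2 * n) w) := by
    have h1 := hX.flatMap (fun y => word N (2 * n) (some y)) w
    change |X (compose N (2 * n) w) - _| ≤ _ at h1
    have h2 : C * w.length ≤ ε / 2 * len (compose N (2 * n) w) := by
      rw [len_compose hN]
      rw [div_lt_iff₀ hφ] at hnC
      have := mul_le_mul hnC.le (length_le_len w) (Nat.cast_nonneg _) (by positivity)
      linarith
    have ha := mul_le_mul_of_nonneg_left (hx .a) (Nat.cast_nonneg (α := ℝ) (w.count .a))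
    have hb := mul_le_mul_of_nonneg_left (hx .b) (Nat.cast_nonneg (α := ℝ) (w.count .b))
    rw [← abs_of_nonneg (Nat.cast_nonneg (α := ℝ) (w.count .a)), ← abs_mul,
      abs_of_nonneg (Nat.cast_nonneg (α := ℝ) (w.count .a))] at ha
    rw [← abs_of_nonneg (Nat.cast_nonneg (α := ℝ) (w.count .b)), ← abs_mul,
      abs_of_nonneg (Nat.cast_nonneg (α := ℝ) (w.count .b))] at hb
    have e := len_compose hN (2 * n) w
    rw [len_eq_count w] at e
    simp only [tileLength] at ha hb
    rw [e] at h2 ⊢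
    rw [abs_le] at *
    constructor <;> linarith [h1.1, h1.2, ha.1, ha.2, hb.1, hb.2]
  rw [h]
  have a1 := hX.2 (s ++ compose N (2 * n) w) p
  have a2 := hX.2 s (compose N (2 * n) w)
  have a3 := hB s
  have a4 := hB p
  have a5 := len_le_two_mul_length s
  have a6 := len_le_two_mul_length p
  have a7 := len_nonneg s
  have a8 := len_nonneg p
  have b1 : |Z * len s| ≤ 2 * |Z| * L := by
    rw [abs_mul, abs_of_nonneg a7]
    nlinarith [abs_nonneg Z]
  have b2 : |Z * len p| ≤ 2 * |Z| * L := by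
    rw [abs_mul, abs_of_nonneg a8]
    nlinarith [abs_nonneg Z]
  have b3 : B * s.length ≤ B * L := by gcongr
  have b4 : B * p.length ≤ B * L := by gcongr
  have b5 : 0 ≤ ε * len s := by positivity
  have b6 : 0 ≤ ε * len p := by positivity
  rw [len_append, len_append]
  rw [abs_le] at *
  constructor <;> linarith [a1.1, a1.2, a2.1, a2.2, a3.1, a3.2, a4.1, a4.2, hw.1, hw.2, b1.1,
    b1.2, b2.1, b2.2]

/-! ## Comparing words -/

/-- The number of points of `F` that a translation by `s` moves out of `F`. -/
noncomputable def mismatch (F : Finset ℝ) (s : ℝ) : ℕ := (F.filter fun p => p + s ∉ F).card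

theorem mismatch_map (F : Finset ℝ) (t s : ℝ) :
    mismatch (F.map (addLeftEmbedding t)) s = mismatch F s := by
  unfold mismatch
  rw [Finset.filter_map, Finset.card_map]
  congr 1
  refine Finset.filter_congr fun p _ => ?_
  simp [add_assoc]

theorem mismatch_zero (F : Finset ℝ) : mismatch F 0 = 0 := by
  simp [mismatch, Finset.filter_eq_empty_iff]

theorem mismatch_add (F : Finset ℝ) (s t : ℝ) :
    mismatch F (s + t) ≤ mismatch F s + mismatch F t := by
  unfold mismatch
  have h : (F.filter fun p => p + (s + t) ∉ F) ⊆ (F.filter fun p => p + s ∉ F) ∪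
      ((F.filter fun p => p + t ∉ F).image fun p => p - s) := by
    intro p hp
    simp only [Finset.mem_filter, Finset.mem_union, Finset.mem_image] at hp ⊢
    by_cases h1 : p + s ∈ F
    · exact Or.inr ⟨p + s, ⟨h1, by rw [add_assoc]; exact hp.2⟩, by ring⟩
    · exact Or.inl ⟨hp.1, h1⟩
  exact (Finset.card_le_card h).trans
    ((Finset.card_union_le _ _).trans (Nat.add_le_add_left Finset.card_image_le _))

theorem mismatch_sum (F : Finset ℝ) (A : Finset ℕ) (c : ℕ → ℝ) :
    mismatch F (∑ j ∈ A, c j) ≤ ∑ j ∈ A, mismatch F (c j) := by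
  induction A using Finset.induction_on with
  | empty => simp [mismatch_zero]
  | insert j A hj ih =>
    rw [Finset.sum_insert hj, Finset.sum_insert hj]
    exact (mismatch_add _ _ _).trans (Nat.add_le_add_left ih _)

theorem mismatch_le (F G : Finset ℝ) (s : ℝ) :
    mismatch F s ≤ mismatch G s + (F \ G).card + (G \ F).card := by
  unfold mismatch
  have h : (F.filter fun p => p + s ∉ F) ⊆ (G.filter fun p => p + s ∉ G) ∪ (F \ G) ∪
      ((G \ F).image fun p => p - s) := by
    intro p hp
    simp only [Finset.mem_filter, Finset.mem_union, Finset.mem_image, Finset.mem_sdiff] at hp ⊢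
    by_cases h1 : p ∈ G
    · by_cases h2 : p + s ∈ G
      · exact Or.inr ⟨p + s, ⟨h2, hp.2⟩, by ring⟩
      · exact Or.inl (Or.inl ⟨h1, h2⟩)
    · exact Or.inl (Or.inr ⟨hp.1, h1⟩)
  refine (Finset.card_le_card h).trans ((Finset.card_union_le _ _).trans ?_)
  exact Nat.add_le_add (Finset.card_union_le _ _) Finset.card_image_le

/-- The number of end points of `u` that are not end points of `w`. -/
noncomputable def diff (u w : List Letter) : ℕ := (ends 0 u \ ends 0 w).card

theorem card_ends_sdiff (t : ℝ) (u w : List Letter) :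
    (ends t u \ ends t w).card = diff u w := by
  rw [ends_eq_map, ends_eq_map t w, ← Finset.map_sdiff, Finset.card_map, diff]

@[simp] theorem diff_self (u : List Letter) : diff u u = 0 := by simp [diff]

theorem diff_le_length (u w : List Letter) : diff u w ≤ u.length := by
  rw [← card_ends 0 u]
  exact Finset.card_le_card Finset.sdiff_subset

theorem diff_triangle (u v w : List Letter) : diff u w ≤ diff u v + diff v w := by
  refine (Finset.card_le_card (fun p hp => ?_)).trans (Finset.card_union_le _ _)
  simp only [Finset.mem_sdiff, Finset.mem_union] at hp ⊢
  by_cases h : p ∈ ends 0 v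
  · exact Or.inr ⟨h, hp.2⟩
  · exact Or.inl ⟨hp.1, h⟩

/-- Equal lengths of the first parts align the second parts, so that they can be compared on their
own. -/
theorem diff_append {u u' : List Letter} (h : len u = len u') (w w' : List Letter) :
    diff (u ++ w) (u' ++ w') ≤ diff u u' + diff w w' := by
  rw [← card_ends_sdiff (0 + len u) w w', diff, diff, ends_append, ends_append, ← h]
  refine (Finset.card_le_card (fun p hp => ?_)).trans (Finset.card_union_le _ _)
  simp only [Finset.mem_sdiff, Finset.mem_union, not_or] at hp ⊢
  rcases hp.1 with h1 | h1
  · exact Or.inl ⟨h1, hp.2.1⟩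
  · exact Or.inr ⟨h1, hp.2.2⟩

theorem diff_append_left (c u w : List Letter) : diff (c ++ u) (c ++ w) ≤ diff u w := by
  simpa using diff_append (u := c) rfl u w

theorem diff_append_right {u w : List Letter} (h : len u = len w) (c : List Letter) :
    diff (u ++ c) (w ++ c) ≤ diff u w := by
  simpa using diff_append h c c

theorem diff_flatMap {f g : Letter → List Letter} (h : ∀ x, len (f x) = len (g x)) {d : ℕ}
    (hd : ∀ x, diff (f x) (g x) ≤ d) (w : List Letter) :
    diff (w.flatMap f) (w.flatMap g) ≤ w.length * d := by
  induction w with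
  | nil => simp
  | cons x w ih =>
    rw [List.flatMap_cons, List.flatMap_cons, List.length_cons, add_mul, one_mul]
    have := diff_append (h x) (w.flatMap f) (w.flatMap g)
    have := hd x
    omega

/-- Moving `f a` through a product of copies of `f a` and `f b`. -/
theorem diff_flatMap_rotate (f : Letter → List Letter) (w : List Letter) :
    diff (f .a ++ w.flatMap f) (w.flatMap f ++ f .a) ≤
      w.length * diff (f .a ++ f .b) (f .b ++ f .a) := by
  induction w with
  | nil => simp
  | cons x w ih =>
    rw [List.flatMap_cons, List.length_cons, add_mul, one_mul]
    cases x
    · have := diff_append_left (f .a) (f .a ++ w.flatMap f) (w.flatMap f ++ f .a)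
      rw [List.append_assoc]
      omega
    · have h1 := diff_triangle (f .a ++ (f .b ++ w.flatMap f)) (f .b ++ (f .a ++ w.flatMap f))
        (f .b ++ (w.flatMap f ++ f .a))
      have h2 := diff_append_right (u := f .a ++ f .b) (w := f .b ++ f .a)
        (by simp [add_comm]) (w.flatMap f)
      have h3 := diff_append_left (f .b) (f .a ++ w.flatMap f) (w.flatMap f ++ f .a)
      rw [List.append_assoc, List.append_assoc] at h2
      rw [List.append_assoc]
      omega

/-- Translating by the length of f(a) is prepending f(a). Rotating it to the far end costs one
exchange of f(a) and f(b) per letter b at most, and there it adds at most its own end points. -/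
theorem mismatch_flatMap (f : Letter → List Letter) (w : List Letter) :
    mismatch (ends 0 (w.flatMap f)) (len (f .a)) ≤
      w.length * diff (f .a ++ f .b) (f .b ++ f .a) + (f .a).length := by
  have h1 : mismatch (ends 0 (w.flatMap f)) (len (f .a)) ≤
      diff (f .a ++ w.flatMap f) (w.flatMap f) := by
    unfold mismatch diff
    refine Finset.card_le_card_of_injOn (fun p => p + len (f .a)) (fun p hp => ?_)
      fun p _ q _ h => add_right_cancel h
    simp only [Finset.coe_filter, Set.mem_ofPred_eq] at hp
    simp only [Finset.coe_sdiff, Set.mem_sdiff, Finset.mem_coe, ends_append, Finset.mem_union]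
    refine ⟨Or.inr ?_, hp.2⟩
    rw [zero_add, ends_eq_map, Finset.mem_map]
    exact ⟨p, hp.1, add_comm _ _⟩
  have h2 := diff_triangle (f .a ++ w.flatMap f) (w.flatMap f ++ f .a) (w.flatMap f)
  have h3 := diff_flatMap_rotate f w
  have h4 : diff (w.flatMap f ++ f .a) (w.flatMap f) ≤ (f .a).length := by
    have := diff_append_left (w.flatMap f) (f .a) []
    rw [List.append_nil] at this
    exact this.trans (diff_le_length _ _)
  omega

/-- `σ ^ k (ab)` and `σ ^ k (ba)` differ at most in their last two letters. -/
theorem exists_fibPow_append (k : ℕ) : ∃ c x y, fibPow k .a ++ fibPow k .b = c ++ [x, y] ∧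
    fibPow k .b ++ fibPow k .a = c ++ [y, x] ∧ (x = .a ∧ y = .b ∨ x = .b ∧ y = .a) := by
  induction k with
  | zero => exact ⟨[], .a, .b, rfl, rfl, Or.inl ⟨rfl, rfl⟩⟩
  | succ k ih =>
    obtain ⟨c, x, y, h1, h2, h3⟩ := ih
    refine ⟨fibPow k .a ++ c, y, x, ?_, ?_, h3.symm.imp And.symm And.symm⟩
    · rw [fibPow_succ_a, fibPow_succ_b, List.append_assoc, h2, List.append_assoc]
    · rw [fibPow_succ_a, fibPow_succ_b, h1, List.append_assoc]

/-- Only the last two letters of σ^k(ab) and σ^k(ba) differ, so the cost of the exchange does not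
grow with k. -/
theorem diff_flatMap_fibPow (f : Letter → List Letter) (k : ℕ) :
    diff ((fibPow k .a).flatMap f ++ (fibPow k .b).flatMap f)
      ((fibPow k .b).flatMap f ++ (fibPow k .a).flatMap f) ≤
      diff (f .a ++ f .b) (f .b ++ f .a) + diff (f .b ++ f .a) (f .a ++ f .b) := by
  obtain ⟨c, x, y, h1, h2, h3⟩ := exists_fibPow_append k
  rw [← List.flatMap_append, ← List.flatMap_append, h1, h2, List.flatMap_append,
    List.flatMap_append]
  refine (diff_append_left _ _ _).trans ?_
  rcases h3 with ⟨rfl, rfl⟩ | ⟨rfl, rfl⟩ <;> simp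

/-! ## Unscrambling -/

theorem length_word_le_floor {N : ℕ → ℕ} (hN : StrictMono N) (n : ℕ) {x : ExtLetter}
    (hx : toLetter x = .b) : (word N n x).length ≤ ⌊Real.goldenRatio ^ (N n - N 0)⌋₊ := by
  refine Nat.le_floor ((length_le_len _).trans_eq ?_)
  rw [len_word hN, hx, tileLength, mul_one]

theorem compose_flatMap (N : ℕ → ℕ) (n : ℕ) (w : List Letter) (g : Letter → List Letter) :
    compose N n (w.flatMap g) = w.flatMap fun x => compose N n (g x) :=
  List.flatMap_assoc

theorem compose_succ_of_odd (N : ℕ → ℕ) {n : ℕ} (hn : Odd (n + 1)) (w : List Letter) :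
    compose N (n + 1) w = compose N n (w.flatMap (fibPow (Delta N (n + 1)))) := by
  rw [compose_flatMap]
  exact congrArg (fun f => w.flatMap f) (funext fun x => word_succ_of_odd N hn x)

theorem len_word_succ {N : ℕ → ℕ} (hN : StrictMono N) (n : ℕ) (x : Letter) :
    len (word N (n + 1) (some x)) = len (compose N n (fibPow (Delta N (n + 1)) x)) := by
  rw [len_word hN, len_compose hN, len_fibPow, sub_add_Delta hN, pow_add, toLetter_some]
  ring

/-- An even step replaces a single S_n(b) by S_n(e), which is equally long. Only end points inside
this one superletter change. -/
theorem diff_word_succ {N : ℕ → ℕ} (hN : StrictMono N) {n : ℕ} (hn : ¬ Odd (n + 1)) (x : Letter) :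
    diff (word N (n + 1) (some x)) (compose N n (fibPow (Delta N (n + 1)) x)) ≤
      ⌊Real.goldenRatio ^ (N n - N 0)⌋₊ ∧
    diff (compose N n (fibPow (Delta N (n + 1)) x)) (word N (n + 1) (some x)) ≤
      ⌊Real.goldenRatio ^ (N n - N 0)⌋₊ := by
  by_cases hb : Letter.b ∈ fibPow (Delta N (n + 1)) x
  · obtain ⟨p, q, h1, h2⟩ := word_succ_of_even N hn x hb
    have hlen : len (word N n none) = len (word N n (some .b)) := by
      rw [len_word hN, len_word hN]; rfl
    rw [h1, h2, compose_append, compose_cons]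
    constructor
    · exact (diff_append_left _ _ _).trans ((diff_append_right hlen _).trans
        ((diff_le_length _ _).trans (length_word_le_floor hN n rfl)))
    · exact (diff_append_left _ _ _).trans ((diff_append_right hlen.symm _).trans
        ((diff_le_length _ _).trans (length_word_le_floor hN n rfl)))
  · rw [word_succ_of_even_of_notMem N hn x hb]
    simp

theorem diff_compose_succ {N : ℕ → ℕ} (hN : StrictMono N) {n : ℕ} (hn : ¬ Odd (n + 1))
    (w : List Letter) :
    diff (compose N (n + 1) w) (compose N n (w.flatMap (fibPow (Delta N (n + 1))))) ≤
      w.length * ⌊Real.goldenRatio ^ (N n - N 0)⌋₊ ∧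
    diff (compose N n (w.flatMap (fibPow (Delta N (n + 1))))) (compose N (n + 1) w) ≤
      w.length * ⌊Real.goldenRatio ^ (N n - N 0)⌋₊ := by
  rw [compose_flatMap]
  exact ⟨diff_flatMap (len_word_succ hN n) (fun x => (diff_word_succ hN hn x).1) w,
    diff_flatMap (fun x => (len_word_succ hN n x).symm) (fun x => (diff_word_succ hN hn x).2) w⟩

/-- Unscrambling each of the two products costs 2 units of φ^(N(n)-N(0)), one per factor. The
unscrambled products differ in two superletters of level n, of total length (φ + 1) units, less than
3. -/
theorem diff_word_rotate {N : ℕ → ℕ} (hN : StrictMono N) {n : ℕ} (hn : ¬ Odd (n + 1))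
    {x y : Letter} (hxy : x = .a ∧ y = .b ∨ x = .b ∧ y = .a) :
    (diff (word N (n + 1) (some x) ++ word N (n + 1) (some y))
      (word N (n + 1) (some y) ++ word N (n + 1) (some x)) : ℝ) ≤
      7 * Real.goldenRatio ^ (N n - N 0) := by
  have hφ : 0 < Real.goldenRatio ^ (N n - N 0) := pow_pos Real.goldenRatio_pos _
  have h1 := (diff_compose_succ hN hn [x, y]).1
  have h2 := (diff_compose_succ hN hn [y, x]).2
  have h3 : (diff (compose N n ([x, y].flatMap (fibPow (Delta N (n + 1)))))
      (compose N n ([y, x].flatMap (fibPow (Delta N (n + 1))))) : ℝ) ≤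
      3 * Real.goldenRatio ^ (N n - N 0) := by
    obtain ⟨c, u, v, e1, e2, huv⟩ := exists_fibPow_append (Delta N (n + 1))
    have key : ∀ u v : Letter, (u = .a ∧ v = .b ∨ u = .b ∧ v = .a) →
        (diff (compose N n (c ++ [u, v])) (compose N n (c ++ [v, u])) : ℝ) ≤
        3 * Real.goldenRatio ^ (N n - N 0) := by
      intro u v huv
      rw [compose_append, compose_append]
      have h4 : (diff (compose N n c ++ compose N n [u, v])
          (compose N n c ++ compose N n [v, u]) : ℝ) ≤ (compose N n [u, v]).length := by
        exact_mod_cast (diff_append_left _ _ _).trans (diff_le_length _ _)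
      refine h4.trans ((length_le_len _).trans ?_)
      rw [len_compose hN, mul_comm]
      refine mul_le_mul_of_nonneg_right ?_ hφ.le
      rcases huv with ⟨rfl, rfl⟩ | ⟨rfl, rfl⟩ <;> simp [tileLength] <;>
        linarith [Real.goldenRatio_lt_two]
    rcases hxy with ⟨rfl, rfl⟩ | ⟨rfl, rfl⟩
    · simp only [List.flatMap_cons, List.flatMap_nil, List.append_nil]
      rw [e1, e2]
      exact key u v huv
    · simp only [List.flatMap_cons, List.flatMap_nil, List.append_nil]
      rw [e1, e2]
      exact key v u (huv.symm.imp And.symm And.symm)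
  have h4 := diff_triangle (compose N (n + 1) [x, y])
    (compose N n ([x, y].flatMap (fibPow (Delta N (n + 1))))) (compose N (n + 1) [y, x])
  have h5 := diff_triangle (compose N n ([x, y].flatMap (fibPow (Delta N (n + 1)))))
    (compose N n ([y, x].flatMap (fibPow (Delta N (n + 1))))) (compose N (n + 1) [y, x])
  have h6 := Nat.floor_le hφ.le
  have e : ∀ u v, compose N (n + 1) [u, v] =
      word N (n + 1) (some u) ++ word N (n + 1) (some v) := fun u v => by simp
  rw [e x y, e y x] at *
  simp only [List.length_cons, List.length_nil] at h1 h2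
  have h7 : (diff (word N (n + 1) (some x) ++ word N (n + 1) (some y))
      (word N (n + 1) (some y) ++ word N (n + 1) (some x)) : ℝ) ≤
      2 * (⌊Real.goldenRatio ^ (N n - N 0)⌋₊ : ℝ) +
      diff (compose N n ([x, y].flatMap (fibPow (Delta N (n + 1)))))
      (compose N n ([y, x].flatMap (fibPow (Delta N (n + 1))))) +
      2 * (⌊Real.goldenRatio ^ (N n - N 0)⌋₊ : ℝ) := by
    exact_mod_cast (by omega)
  linarith

/-! ## Translations by powers of `φ` -/

theorem sum_Ioc_inv_pow_le {m M : ℕ} (h : m ≤ M) :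
    ∑ j ∈ Finset.Ioc m M, (Real.goldenRatio⁻¹) ^ j ≤
      Real.goldenRatio * (Real.goldenRatio⁻¹) ^ m := by
  have hφ := Real.goldenRatio_pos
  suffices ∑ j ∈ Finset.Ioc m M, (Real.goldenRatio⁻¹) ^ j +
      Real.goldenRatio * (Real.goldenRatio⁻¹) ^ M =
      Real.goldenRatio * (Real.goldenRatio⁻¹) ^ m by
    have : 0 ≤ Real.goldenRatio * (Real.goldenRatio⁻¹) ^ M := by positivity
    linarith
  induction M, h using Nat.le_induction with
  | base => simp
  | succ M hM ih =>
    rw [Finset.sum_Ioc_succ_top (by omega), ← ih, pow_succ]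
    have : Real.goldenRatio⁻¹ + 1 = Real.goldenRatio := by
      rw [Real.inv_goldenRatio]
      linarith [Real.goldenRatio_add_goldenConj]
    have h2 : Real.goldenRatio * Real.goldenRatio⁻¹ = 1 := mul_inv_cancel₀ hφ.ne'
    linear_combination (Real.goldenRatio⁻¹) ^ M * this + (Real.goldenRatio⁻¹) ^ M * h2

/-- Splitting σ^K as σ^i applied after σ^(K-i) writes the word in blocks f(x) = S_{n+1}(σ^i(x)), and
the translation is exactly the length of f(a). Each of at most (length) · φ^(-(N(n+1)-N(0)+i))
blocks costs 14 = 7 + 7 units by `diff_word_rotate`. -/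
theorem mismatch_compose_flatMap {N : ℕ → ℕ} (hN : StrictMono N) {n : ℕ} (hn : ¬ Odd (n + 1))
    {K i : ℕ} (hi : i ≤ K) (w : List Letter) :
    (mismatch (ends 0 (compose N (n + 1) (w.flatMap (fibPow K))))
      (Real.goldenRatio ^ (N (n + 1) - N 0 + i + 1)) : ℝ) ≤
      14 * Real.goldenRatio ^ (N n - N 0) * (Real.goldenRatio⁻¹) ^ (N (n + 1) - N 0 + i) *
        len (compose N (n + 1) (w.flatMap (fibPow K))) +
      Real.goldenRatio ^ (N (n + 1) - N 0 + i + 1) := by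
  have hφ := Real.goldenRatio_pos
  set f : Letter → List Letter := fun x => compose N (n + 1) (fibPow i x)
  have hw : compose N (n + 1) (w.flatMap (fibPow K)) = (w.flatMap (fibPow (K - i))).flatMap f := by
    rw [← compose_flatMap, List.flatMap_assoc]
    congr 2
    funext x
    rw [← fibPow_add, Nat.sub_add_cancel hi]
  have hlen : len (f .a) = Real.goldenRatio ^ (N (n + 1) - N 0 + i + 1) := by
    simp only [f]
    rw [len_compose hN, len_fibPow, tileLength]; ring
  have hlen' : len ((w.flatMap (fibPow (K - i))).flatMap f) =
      Real.goldenRatio ^ (N (n + 1) - N 0 + i) * len (w.flatMap (fibPow (K - i))) := by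
    have h := len_flatMap f id (Real.goldenRatio ^ (N (n + 1) - N 0 + i)) (fun x => by
      simp only [f, id]
      rw [len_compose hN, len_fibPow, pow_add]; ring) (w.flatMap (fibPow (K - i)))
    rwa [List.map_id] at h
  have h1 := mismatch_flatMap f (w.flatMap (fibPow (K - i)))
  have h2 : (diff (f .a ++ f .b) (f .b ++ f .a) : ℝ) ≤ 14 * Real.goldenRatio ^ (N n - N 0) := by
    have h3 := diff_flatMap_fibPow (fun x => word N (n + 1) (some x)) i
    have h4 := diff_word_rotate hN hn (x := .a) (y := .b) (Or.inl ⟨rfl, rfl⟩)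
    have h5 := diff_word_rotate hN hn (x := .b) (y := .a) (Or.inr ⟨rfl, rfl⟩)
    have h6 : (diff (f .a ++ f .b) (f .b ++ f .a) : ℝ) ≤ _ := Nat.cast_le.mpr h3
    push_cast at h6
    linarith
  rw [hlen, ← hw] at h1
  have h3 : (mismatch (ends 0 (compose N (n + 1) (w.flatMap (fibPow K))))
      (Real.goldenRatio ^ (N (n + 1) - N 0 + i + 1)) : ℝ) ≤
      (w.flatMap (fibPow (K - i))).length * diff (f .a ++ f .b) (f .b ++ f .a) +
        (f .a).length := by exact_mod_cast h1
  have h4 := length_le_len (w.flatMap (fibPow (K - i)))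
  have h5 := length_le_len (f .a)
  have h6 := mul_le_mul h4 h2 (Nat.cast_nonneg _) (len_nonneg _)
  rw [hw, hlen', inv_pow]
  rw [hlen] at h5
  rw [hw] at h3
  refine h3.trans (add_le_add (h6.trans_eq ?_) h5)
  have : Real.goldenRatio ^ (N (n + 1) - N 0 + i) ≠ 0 := by positivity
  generalize Real.goldenRatio ^ (N (n + 1) - N 0 + i) = c at *
  field_simp

/-- Step n + 2 is unscrambled, so undoing step n + 3 alone gives S_{n+1} of a power of σ, at cost
φ^(-Δ(n+3)) per unit length in each direction. There all translations of the block are estimated by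
`mismatch_compose_flatMap`. Their costs form a geometric series, so a whole subset sum costs no more
than a constant times φ^(-Δ(n+1)), and 42 ≥ 14φ². -/
theorem mismatch_compose_le {N : ℕ → ℕ} (hN : StrictMono N) {n : ℕ} (hn : ¬ Odd (n + 1))
    {A : Finset ℕ} (hA : A ⊆ Finset.Ioc (N (n + 1) - N 0) (N (n + 3) - N 0)) (w : List Letter) :
    (mismatch (ends 0 (compose N (n + 3) w)) (∑ j ∈ A, Real.goldenRatio ^ j) : ℝ) ≤
      (42 * (Real.goldenRatio⁻¹) ^ Delta N (n + 1) + 2 * (Real.goldenRatio⁻¹) ^ Delta N (n + 3)) *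
        len (compose N (n + 3) w) + ∑ j ∈ A, Real.goldenRatio ^ j := by
  have hφ := Real.goldenRatio_pos
  have hodd : Odd (n + 2) := by
    rw [Nat.not_odd_iff_even] at hn
    exact hn.add_one
  have heven : ¬ Odd (n + 2 + 1) := by
    rw [Nat.not_odd_iff_even]
    exact hodd.add_one
  set K := Delta N (n + 3) + Delta N (n + 2) with hK
  have hE3 := sub_add_Delta hN (n + 2)
  have hE2 := sub_add_Delta hN (n + 1)
  have hE1 := sub_add_Delta hN n
  simp only [add_assoc, Nat.reduceAdd] at hE1 hE2 hE3 heven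
  set Y := compose N (n + 1) (w.flatMap (fibPow K)) with hY
  have hYeq : compose N (n + 2) (w.flatMap (fibPow (Delta N (n + 3)))) = Y := by
    rw [compose_succ_of_odd N hodd, List.flatMap_assoc, hY]
    congr 2
    funext x
    rw [hK, fibPow_add]
  have hlenY : len Y = len (compose N (n + 3) w) := by
    have h := len_flatMap (fibPow K) id _ (len_fibPow K) w
    rw [List.map_id] at h
    rw [hY, len_compose hN, len_compose hN, h, hE3, hE2, hK]
    ring
  have hd := diff_compose_succ hN heven w
  simp only [add_assoc, Nat.reduceAdd] at hd
  rw [hYeq] at hd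
  have h1 := mismatch_le (ends 0 (compose N (n + 3) w)) (ends 0 Y) (∑ j ∈ A, Real.goldenRatio ^ j)
  rw [← diff, ← diff] at h1
  have h2 : (mismatch (ends 0 (compose N (n + 3) w)) (∑ j ∈ A, Real.goldenRatio ^ j) : ℝ) ≤
      mismatch (ends 0 Y) (∑ j ∈ A, Real.goldenRatio ^ j) +
      2 * (w.length * (⌊Real.goldenRatio ^ (N (n + 2) - N 0)⌋₊ : ℝ)) := by
    exact_mod_cast (by omega)
  have h3 : (w.length * (⌊Real.goldenRatio ^ (N (n + 2) - N 0)⌋₊ : ℝ)) ≤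
      (Real.goldenRatio⁻¹) ^ Delta N (n + 3) * len (compose N (n + 3) w) := by
    refine (mul_le_mul (length_le_len w) (Nat.floor_le (by positivity)) (Nat.cast_nonneg _)
      (len_nonneg w)).trans_eq ?_
    rw [len_compose hN, hE3, pow_add, inv_pow]
    field_simp
  have h4 : (mismatch (ends 0 Y) (∑ j ∈ A, Real.goldenRatio ^ j) : ℝ) ≤
      ∑ j ∈ A, (14 * Real.goldenRatio ^ (N n - N 0) * Real.goldenRatio * len Y *
        (Real.goldenRatio⁻¹) ^ j + Real.goldenRatio ^ j) := by
    have h5 : (mismatch (ends 0 Y) (∑ j ∈ A, Real.goldenRatio ^ j) : ℝ) ≤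
        ∑ j ∈ A, (mismatch (ends 0 Y) (Real.goldenRatio ^ j) : ℝ) := by
      exact_mod_cast mismatch_sum (ends 0 Y) A fun j => Real.goldenRatio ^ j
    refine h5.trans (Finset.sum_le_sum fun j hj => ?_)
    have hj' := Finset.mem_Ioc.mp (hA hj)
    obtain ⟨i, rfl⟩ := Nat.exists_eq_add_of_lt hj'.1
    have h6 := mismatch_compose_flatMap hN hn (K := K) (i := i) (by omega) w
    refine h6.trans (add_le_add (le_of_eq ?_) le_rfl)
    rw [pow_succ (Real.goldenRatio⁻¹)]
    have h7 : Real.goldenRatio * Real.goldenRatio⁻¹ = 1 := mul_inv_cancel₀ hφ.ne'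
    rw [← hY]
    linear_combination (-14 * Real.goldenRatio ^ (N n - N 0) * len Y *
      (Real.goldenRatio⁻¹) ^ (N (n + 1) - N 0 + i)) * h7
  have h5 : ∑ j ∈ A, (14 * Real.goldenRatio ^ (N n - N 0) * Real.goldenRatio * len Y *
        (Real.goldenRatio⁻¹) ^ j + Real.goldenRatio ^ j) ≤
      42 * (Real.goldenRatio⁻¹) ^ Delta N (n + 1) * len Y + ∑ j ∈ A, Real.goldenRatio ^ j := by
    rw [Finset.sum_add_distrib, ← Finset.mul_sum]
    refine add_le_add ?_ le_rfl
    have hle : ∑ j ∈ A, (Real.goldenRatio⁻¹) ^ j ≤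
        Real.goldenRatio * (Real.goldenRatio⁻¹) ^ (N (n + 1) - N 0) :=
      (Finset.sum_le_sum_of_subset_of_nonneg hA fun _ _ _ => by positivity).trans
        (sum_Ioc_inv_pow_le (by omega))
    have hY0 := len_nonneg Y
    refine (mul_le_mul_of_nonneg_left hle (by positivity)).trans ?_
    have h6 : Real.goldenRatio ^ (N n - N 0) * (Real.goldenRatio⁻¹) ^ (N (n + 1) - N 0) =
        (Real.goldenRatio⁻¹) ^ Delta N (n + 1) := by
      rw [hE1, pow_add, ← mul_assoc, ← mul_pow, mul_inv_cancel₀ hφ.ne', one_pow, one_mul]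
    have h7 : Real.goldenRatio * Real.goldenRatio ≤ 3 := by
      nlinarith [Real.goldenRatio_sq, Real.goldenRatio_lt_two]
    calc _ = 14 * (Real.goldenRatio * Real.goldenRatio) * (Real.goldenRatio ^ (N n - N 0) *
          (Real.goldenRatio⁻¹) ^ (N (n + 1) - N 0)) * len Y := by ring
      _ ≤ 14 * 3 * (Real.goldenRatio⁻¹) ^ Delta N (n + 1) * len Y := by
          rw [h6]; gcongr
      _ = _ := by ring
  have h6 := h4.trans h5
  rw [hlenY] at h6
  linarith

/-- The incomplete superletters at the ends of a window change the mismatch by a bounded amount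
only. -/
theorem exists_mismatch_window_le {N : ℕ → ℕ} (hN : StrictMono N) {ξ : ℤ → Letter}
    (hξ : ξ ∈ sequenceSpace N) {n : ℕ} (hn : ¬ Odd (n + 1))
    {A : Finset ℕ} (hA : A ⊆ Finset.Ioc (N (n + 1) - N 0) (N (n + 3) - N 0)) :
    ∃ C : ℝ, ∀ t i m, (mismatch (ends t (window ξ i m)) (∑ j ∈ A, Real.goldenRatio ^ j) : ℝ) ≤
      (42 * (Real.goldenRatio⁻¹) ^ Delta N (n + 1) + 2 * (Real.goldenRatio⁻¹) ^ Delta N (n + 3)) *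
        len (window ξ i m) + C := by
  have hφ := Real.goldenRatio_pos
  refine ⟨∑ j ∈ A, Real.goldenRatio ^ j + 2 * (maxLength N (n + 3) : ℕ), fun t i m => ?_⟩
  have heven : Even (n + 3) := by
    rw [Nat.not_odd_iff_even] at hn
    exact hn.add even_two
  obtain ⟨s, w, p, h, hs, hp⟩ := exists_window_eq hN hξ heven i m
  rw [h]
  have h1 := mismatch_compose_le hN hn hA w
  rw [← mismatch_map _ (t + len s), ← ends_eq_map] at h1
  have h2 := mismatch_le (ends t (s ++ compose N (n + 3) w ++ p))
    (ends (t + len s) (compose N (n + 3) w)) (∑ j ∈ A, Real.goldenRatio ^ j)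
  have h3 : (ends t (s ++ compose N (n + 3) w ++ p) \
      ends (t + len s) (compose N (n + 3) w)).card ≤ s.length + p.length := by
    rw [← card_ends t s, ← card_ends (t + len (s ++ compose N (n + 3) w)) p]
    refine (Finset.card_le_card fun x hx => ?_).trans (Finset.card_union_le _ _)
    rw [Finset.mem_sdiff, ends_append, ends_append, Finset.mem_union, Finset.mem_union] at hx
    rw [Finset.mem_union]
    tauto
  have h4 : (ends (t + len s) (compose N (n + 3) w) \
      ends t (s ++ compose N (n + 3) w ++ p)).card = 0 := by
    rw [Finset.card_eq_zero, Finset.sdiff_eq_empty_iff_subset, ends_append, ends_append]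
    exact Finset.subset_union_right.trans Finset.subset_union_left
  have h5 : (mismatch (ends t (s ++ compose N (n + 3) w ++ p))
      (∑ j ∈ A, Real.goldenRatio ^ j) : ℝ) ≤
      mismatch (ends (t + len s) (compose N (n + 3) w)) (∑ j ∈ A, Real.goldenRatio ^ j) +
      2 * (maxLength N (n + 3) : ℕ) := by
    exact_mod_cast (by omega)
  have h6 : len (compose N (n + 3) w) ≤ len (s ++ compose N (n + 3) w ++ p) := by
    rw [len_append, len_append]
    linarith [len_nonneg s, len_nonneg p]
  have h7 := mul_le_mul_of_nonneg_left h6 (by positivity : 0 ≤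
    42 * (Real.goldenRatio⁻¹) ^ Delta N (n + 1) + 2 * (Real.goldenRatio⁻¹) ^ Delta N (n + 3))
  linarith

/-! ## Pure point diffraction of the scrambled tilings -/

theorem mem_ends_window {ξ : ℤ → Letter} {t : ℝ} {i : ℤ} {m : ℕ} {p : ℝ} :
    p ∈ ends (point ξ t i) (window ξ i m) ↔ ∃ k, i ≤ k ∧ k < i + m ∧ point ξ t k = p := by
  induction m generalizing i with
  | zero =>
    simp only [window_zero, ends_nil, Finset.notMem_empty, false_iff, not_exists]
    intro k hk
    push_cast at hk
    omega
  | succ m ih =>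
    rw [window_succ, ends_cons, ← point_succ, Finset.mem_insert, ih]
    push_cast
    constructor
    · rintro (rfl | ⟨k, h1, h2, h3⟩)
      · exact ⟨i, le_rfl, by omega, rfl⟩
      · exact ⟨k, by omega, by omega, h3⟩
    · rintro ⟨k, h1, h2, h3⟩
      rcases h1.eq_or_lt with rfl | h1
      · exact Or.inl h3.symm
      · exact Or.inr ⟨k, by omega, by omega, h3⟩

theorem strictMono_point (ξ : ℤ → Letter) (t : ℝ) : StrictMono (point ξ t) :=
  strictMono_int_of_lt_succ fun k => by linarith [(point_succ_le ξ t k).1]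

theorem separated_tiling (ξ : ℤ → Letter) (t : ℝ) :
    Separated (tiling Real.goldenRatio 1 ξ t) := by
  rw [tiling_eq_range]
  rintro _ ⟨k, rfl⟩ _ ⟨l, rfl⟩ hne
  refine le_trans ?_ (abs_sub_le_abs_point_sub ξ t k l)
  have h : k - l ≠ 0 := fun h => hne (by rw [sub_eq_zero.mp h])
  exact_mod_cast Int.one_le_abs h

theorem exists_window_Icc (ξ : ℤ → Letter) (t : ℝ) {R : ℝ} (hR : 0 ≤ R) : ∃ i m,
    (ends (point ξ t i) (window ξ i m) : Set ℝ) =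
      tiling Real.goldenRatio 1 ξ t ∩ Set.Icc (-R) R ∧
    |len (window ξ i m) - 2 * R| ≤ 2 := by
  have hmono := strictMono_point ξ t
  obtain ⟨i, hi1, hi2⟩ : ∃ i, point ξ t (i - 1) < -R ∧ -R ≤ point ξ t i := by
    obtain ⟨k, h1, h2⟩ := exists_point_le ξ t (-R)
    rcases h1.eq_or_lt with h1 | h1
    · exact ⟨k, by rw [← h1]; exact hmono (by omega), h1.ge⟩
    · exact ⟨k + 1, by rwa [add_sub_cancel_right], h2.le⟩
  obtain ⟨j, hj1, hj2⟩ := exists_point_le ξ t R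
  have hij : i ≤ j + 1 := by
    have : i - 1 < j + 1 := hmono.lt_iff_lt.mp (by linarith)
    omega
  obtain ⟨m, hm⟩ := Int.le.dest hij
  refine ⟨i, m, ?_, ?_⟩
  · ext p
    rw [Finset.mem_coe, mem_ends_window, tiling_eq_range, hm]
    constructor
    · rintro ⟨k, h1, h2, rfl⟩
      exact ⟨⟨k, rfl⟩, hi2.trans (hmono.monotone h1), (hmono.monotone (by omega)).trans hj1⟩
    · rintro ⟨⟨k, rfl⟩, h1, h2⟩
      refine ⟨k, ?_, hmono.lt_iff_lt.mp (h2.trans_lt hj2), rfl⟩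
      have : i - 1 < k := hmono.lt_iff_lt.mp (hi1.trans_le h1)
      omega
  · have h1 := point_add ξ t i m
    rw [hm] at h1
    have h2 := (point_succ_le ξ t (i - 1)).2
    have h3 := (point_succ_le ξ t j).2
    rw [sub_add_cancel] at h2
    rw [abs_le]
    constructor <;> linarith

theorem exists_mem_Ioc_sub_zero {N : ℕ → ℕ} (hN : StrictMono N) {j : ℕ} (hj : N 2 - N 0 < j) :
    ∃ r, j ∈ Finset.Ioc (N (2 * r + 2) - N 0) (N (2 * r + 4) - N 0) := by
  classical
  have hex : ∃ r, j ≤ N (2 * r + 4) - N 0 := ⟨j, by have := le_sub_zero hN (2 * j + 4); omega⟩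
  refine ⟨Nat.find hex, Finset.mem_Ioc.mpr ⟨?_, Nat.find_spec hex⟩⟩
  rcases Nat.eq_zero_or_pos (Nat.find hex) with h0 | h0
  · rw [h0]; exact hj
  · have := Nat.find_min hex (m := Nat.find hex - 1) (by omega)
    rw [not_le] at this
    rwa [show 2 * (Nat.find hex - 1) + 4 = 2 * Nat.find hex + 2 by omega] at this

theorem isPurePointDiffractive_tiling {N : ℕ → ℕ} (hN : StrictMono N)
    (hsum : Summable fun r : ℕ => (Real.goldenRatio⁻¹) ^ Delta N (2 * r + 2)) {ξ : ℤ → Letter}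
    (hξ : ξ ∈ sequenceSpace N) (t : ℝ) :
    IsPurePointDiffractive (tiling Real.goldenRatio 1 ξ t) := by
  have hfin : ∀ R : ℝ, (tiling Real.goldenRatio 1 ξ t ∩ Set.Icc (-R) R).Finite := by
    intro R
    rcases lt_or_ge R 0 with hR | hR
    · rw [Set.Icc_eq_empty (by linarith), Set.inter_empty]
      exact Set.finite_empty
    · obtain ⟨i, m, h, -⟩ := exists_window_Icc ξ t hR
      rw [← h]
      exact Finset.finite_toSet _
  have hS : ∀ R : ℝ, 0 ≤ R → ∃ i m, (hfin R).toFinset = ends (point ξ t i) (window ξ i m) ∧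
      |len (window ξ i m) - 2 * R| ≤ 2 := by
    intro R hR
    obtain ⟨i, m, h, h'⟩ := exists_window_Icc ξ t hR
    exact ⟨i, m, Finset.coe_injective (by rw [h, Set.Finite.coe_toFinset]), h'⟩
  refine isPurePointDiffractive_of_blocks (separated_tiling ξ t)
    (S := fun R => (hfin R).toFinset) (fun R => Set.Finite.coe_toFinset _) ?_
    (I := fun r => Finset.Ioc (N (2 * r + 2) - N 0) (N (2 * r + 4) - N 0))
    (ε := fun r => 42 * (Real.goldenRatio⁻¹) ^ Delta N (2 * r + 2) +
      2 * (Real.goldenRatio⁻¹) ^ Delta N (2 * r + 4))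
    ((hsum.mul_left 42).add (((summable_nat_add_iff 1).mpr hsum).mul_left 2))
    ((eventually_gt_atTop (N 2 - N 0)).mono fun j hj => exists_mem_Ioc_sub_zero hN hj) ?_
  · intro g hg hg'
    obtain ⟨C, hX⟩ := almostAdditive_pairSum hg hg'
    obtain ⟨Z, hZ⟩ := hX.exists_window_mean hN hξ
    refine ⟨Z, Metric.tendsto_nhds.mpr fun δ hδ => ?_⟩
    obtain ⟨C', hC'⟩ := hZ (δ / 2) (by positivity)
    have hlarge : ∀ᶠ R : ℝ in atTop, (δ / 2) * 2 + C' + |Z| * 2 < δ / 2 * (2 * R) := by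
      have : Tendsto (fun R : ℝ => δ / 2 * (2 * R)) atTop atTop :=
        (tendsto_id.const_mul_atTop two_pos).const_mul_atTop (by positivity)
      exact this.eventually_gt_atTop _
    filter_upwards [hlarge, eventually_gt_atTop 0] with R hR hR0
    obtain ⟨i, m, h1, h2⟩ := hS R hR0.le
    have h3 := hC' i m
    rw [← pairSum_map _ (point ξ t i), ← ends_eq_map, ← h1] at h3
    have h4 : |Z * len (window ξ i m) - Z * (2 * R)| ≤ |Z| * 2 := by
      rw [← mul_sub, abs_mul]
      exact mul_le_mul_of_nonneg_left h2 (abs_nonneg _)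
    have h5 := abs_sub_le (pairSum (hfin R).toFinset g) (Z * len (window ξ i m)) (Z * (2 * R))
    have h6 : δ / 2 * len (window ξ i m) ≤ δ / 2 * (2 * R + 2) :=
      mul_le_mul_of_nonneg_left (by linarith [(abs_le.mp h2).2]) (by positivity)
    rw [Real.dist_eq, show (2 * R)⁻¹ * pairSum (hfin R).toFinset g - Z =
      (2 * R)⁻¹ * (pairSum (hfin R).toFinset g - Z * (2 * R)) by field_simp, abs_mul,
      abs_of_pos (by positivity), inv_mul_lt_iff₀ (by positivity)]
    linarith
  · intro r A hA
    have hn : ¬ Odd (2 * r + 1 + 1) := by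
      rw [Nat.not_odd_iff_even]
      exact ⟨r + 1, by ring⟩
    obtain ⟨C, hC⟩ := exists_mismatch_window_le hN hξ hn hA
    set ε := 42 * (Real.goldenRatio⁻¹) ^ Delta N (2 * r + 2) +
      2 * (Real.goldenRatio⁻¹) ^ Delta N (2 * r + 4)
    -- The window that represents [-R, R] has length at most 2R + 2.
    refine ⟨2 * ε + C, (eventually_ge_atTop 0).mono fun R hR => ?_⟩
    obtain ⟨i, m, h1, h2⟩ := hS R hR
    have h3 := hC (point ξ t i) i m
    rw [← h1] at h3
    refine h3.trans ?_
    have h4 : ε * len (window ξ i m) ≤ ε * (2 * R + 2) :=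
      mul_le_mul_of_nonneg_left (by linarith [(abs_le.mp h2).2]) (by positivity)
    change ε * len (window ξ i m) + C ≤ _
    linarith

/-! ## The hypothesis on the growth of the levels -/

theorem summable_inv_pow_Delta {N : ℕ → ℕ}
    (h : Summable fun κ : {κ : ℕ // Odd κ} =>
      Real.goldenRatio ^ (-(Delta N ((κ : ℕ) + 1) : ℤ))) :
    Summable fun r : ℕ => (Real.goldenRatio⁻¹) ^ Delta N (2 * r + 2) := by
  have hinj : Function.Injective fun r : ℕ => (⟨2 * r + 1, odd_two_mul_add_one r⟩ :
      {κ : ℕ // Odd κ}) := fun r s h => by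
    have := congrArg Subtype.val h
    simp only at this
    omega
  refine (h.comp_injective hinj).congr fun r => ?_
  change Real.goldenRatio ^ (-(Delta N (2 * r + 2) : ℤ)) = _
  rw [zpow_neg, zpow_natCast, ← inv_pow]

/-- Summability forces φ^(-Δ) below φ^(-1) eventually. -/
theorem exists_two_le_Delta {N : ℕ → ℕ}
    (h : Summable fun r : ℕ => (Real.goldenRatio⁻¹) ^ Delta N (2 * r + 2)) :
    ∃ n₁, ∀ n, n₁ ≤ n → Even n → 2 ≤ Delta N n := by
  have hpos : (0 : ℝ) < Real.goldenRatio⁻¹ := inv_pos.mpr Real.goldenRatio_pos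
  obtain ⟨r₀, hr₀⟩ := eventually_atTop.mp (h.tendsto_atTop_zero.eventually_lt_const hpos)
  refine ⟨2 * r₀ + 2, fun n hn he => ?_⟩
  obtain ⟨s, rfl⟩ := he
  have h1 := hr₀ (s - 1) (by omega)
  rw [show 2 * (s - 1) + 2 = s + s by omega] at h1
  by_contra hlt
  have h2 := pow_le_pow_of_le_one hpos.le (inv_le_one_of_one_le₀ Real.one_lt_goldenRatio.le)
    (by omega : Delta N (s + s) ≤ 1)
  rw [pow_one] at h2
  linarith

-- The example N(n) = 2^n and the main theorem

theorem Delta_two_pow {κ : ℕ} (hκ : 1 ≤ κ) : Delta (fun n => 2 ^ n) κ = 2 ^ (κ - 1) := by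
  obtain ⟨k, rfl⟩ := Nat.exists_eq_add_of_le' hκ
  simp only [Delta, Nat.add_sub_cancel, pow_succ]
  omega

theorem summable_Delta_two_pow : Summable fun κ : {κ : ℕ // Odd κ} =>
    Real.goldenRatio ^ (-(Delta (fun n => 2 ^ n) ((κ : ℕ) + 1) : ℤ)) := by
  have hlt : Real.goldenRatio⁻¹ < 1 := inv_lt_one_of_one_lt₀ Real.one_lt_goldenRatio
  have hpos : (0 : ℝ) ≤ Real.goldenRatio⁻¹ := inv_nonneg.mpr Real.goldenRatio_pos.le
  have h : Summable fun κ : ℕ => (Real.goldenRatio⁻¹) ^ κ := summable_geometric_of_lt_one hpos hlt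
  refine Summable.of_nonneg_of_le (fun κ => zpow_nonneg Real.goldenRatio_pos.le _) (fun κ => ?_)
    (h.comp_injective Subtype.val_injective)
  rw [Delta_two_pow (by omega), zpow_neg, zpow_natCast, ← inv_pow]
  exact pow_le_pow_of_le_one hpos hlt.le (by simpa using Nat.lt_two_pow_self.le)

end ScrambledFibonacci

theorem mainTheorem6 :
    (∀ N : ℕ → ℕ, StrictMono N →
      (∀ κ : ℕ, Odd κ → N (κ - 1) ≤ Delta N κ) →
      (Summable fun κ : {κ : ℕ // Odd κ} =>
        Real.goldenRatio ^ (-(Delta N ((κ : ℕ) + 1) : ℤ))) →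
      (tilingSpace N Real.goldenRatio 1).Nonempty ∧
      (∀ β : ℝ, IsTopologicalEigenvalue (tilingSpace N Real.goldenRatio 1) β ↔ β = 0) ∧
      ∀ T ∈ tilingSpace N Real.goldenRatio 1,
        (∀ β : ℝ, IsTopologicalEigenvalue (hull T) β ↔ β = 0) ∧
        IsDelone T ∧ HasFLC T ∧ IsRepetitive T ∧ IsPurePointDiffractive T ∧
        ¬ IsMeyerSet T ∧ ¬ IsMeyerTiling T) ∧
    ∃ Λ : Set ℝ, IsDelone Λ ∧ HasFLC Λ ∧ IsRepetitive Λ ∧ IsPurePointDiffractive Λ ∧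
      ¬ IsMeyerSet Λ := by
  have main : ∀ N : ℕ → ℕ, StrictMono N →
      (∀ κ : ℕ, Odd κ → N (κ - 1) ≤ Delta N κ) →
      (Summable fun κ : {κ : ℕ // Odd κ} =>
        Real.goldenRatio ^ (-(Delta N ((κ : ℕ) + 1) : ℤ))) →
      (tilingSpace N Real.goldenRatio 1).Nonempty ∧
      (∀ β : ℝ, IsTopologicalEigenvalue (tilingSpace N Real.goldenRatio 1) β ↔ β = 0) ∧
      ∀ T ∈ tilingSpace N Real.goldenRatio 1,
        (∀ β : ℝ, IsTopologicalEigenvalue (hull T) β ↔ β = 0) ∧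
        IsDelone T ∧ HasFLC T ∧ IsRepetitive T ∧ IsPurePointDiffractive T ∧
        ¬ IsMeyerSet T ∧ ¬ IsMeyerTiling T := by
    intro N hN hodd hsum
    have hsum' := summable_inv_pow_Delta hsum
    have hev := exists_two_le_Delta hsum'
    refine ⟨?_, isTopologicalEigenvalue_tilingSpace_iff hN hodd hev, ?_⟩
    · obtain ⟨ξ, hξ⟩ := nonempty_sequenceSpace hN
      exact ⟨_, ξ, hξ, 0, rfl⟩
    · rintro _ ⟨ξ, hξ, t, rfl⟩
      exact ⟨isTopologicalEigenvalue_hull_iff hN hodd hev hξ t, isDelone_tiling ξ t,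
        hasFLC_tiling ξ t, isRepetitive_tiling hN hodd hξ t,
        isPurePointDiffractive_tiling hN hsum' hξ t, not_isMeyerSet_tiling hN hodd hev hξ t,
        not_isMeyerTiling_tiling hN hodd hev hξ t⟩
  refine ⟨main, ?_⟩
  -- For N(n) = 2^n one has Δ(κ) = N(κ-1) exactly, and Δ grows fast enough for summability.
  obtain ⟨⟨T, hT⟩, -, h⟩ := main (fun n => 2 ^ n) (pow_right_strictMono₀ one_lt_two)
    (fun κ hκ => (Delta_two_pow hκ.pos).ge) summable_Delta_two_pow
  obtain ⟨-, h1, h2, h3, h4, h5, -⟩ := h T hT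
  exact ⟨T, h1, h2, h3, h4, h5⟩
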